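/- Let $R$ be a commutative Noetherian ring. All modules are finitely generated, and all subcategories of the category $\mathrm{mod}(R)$ of finitely generated $R$-modules are full and closed under isomorphism. A subcategory $\mathcal M$ is \emph{resolving} if $R\in\mathcal M$; $X\oplus Y\in\mathcal M$ if and only if $X,Y\in\mathcal M$; and for every exact sequence $0\to X\to Y\to Z\to 0$ with $Z\in\mathcal M$ one has $Y\in\mathcal M$ if and only if $X\in\mathcal M$. Let $\operatorname{res}(\mathcal P)$ be the smallest resolving subcategory containing $\mathcal P$. A resolving subcategory $\mathcal M\subseteq\mathcal N$ is \emph{thick in} $\mathcal N$ if for every exact sequence $0\to X\to Y\to Z\to 0$ with $X,Y\in\mathcal M$ and $Z\in\mathcal N$ one has $Z\in\mathcal M$. For $\mathcal A\subseteq\mathcal M$, $\mathcal A$ \emph{cogenerates} $\mathcal M$ if every $X\in\mathcal M$ fits into an exact sequence $0\to X\to A\to X'\to0$ with $A\in\mathcal A$ and $X'\in\mathcal M$. Let $\operatorname{add}\mathcal M$ be the smallest subcategory containing $\mathcal M$ that is closed under finite direct sums and direct summands, and let $\mathcal M_p=\{X_p\mid X\in\mathcal M\}$ for $p\in\operatorname{Spec}R$.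 The dimension $\mathcal M\text{-}\dim X\in\mathbb N\cup\{\infty\}$ is the least $n$ such that there is an exact sequence $0\to M_n\to\cdots\to M_0\to X\to0$ with all $M_i\in\mathcal M$ ($\infty$ if there is none). Put $\Delta(\mathcal M)=\{X\mid\mathcal M\text{-}\dim X<\infty\}$, and let $\mathfrak R(\mathcal M)$ be the collection of resolving subcategories $\mathcal X$ with $\mathcal M\subseteq\mathcal X\subseteq\Delta(\mathcal M)$. Let $\Gamma$ be the set of \emph{grade consistent} functions, i.e. the functions $f:\operatorname{Spec}R\to\mathbb N$ with $f(p)\le f(q)$ whenever $p\subseteq q$ and with $f(p)\le\operatorname{grade}(p)$ for all $p$, where $\operatorname{grade}(p)$ is the supremum of the lengths of the $R$-regular sequences in $p$. For $f\in\Gamma$ and subcategories $\mathcal M,\mathcal X$ put \[\Lambda_{\mathcal M}(f)=\{X\in\mathrm{mod}(R)\mid \operatorname{add}\mathcal M_p\text{-}\dim X_p\le f(p)\ \text{for all } p\in\operatorname{Spec}R\},\qquad \Phi_{\mathcal M}(\mathcal X)(p)=\sup\{\operatorname{add}\mathcal M_p\text{-}\dim X_p\mid X\in\mathcal X\}.\]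 Let $C$ be a semidualizing $R$-module, i.e. a finitely generated module with $\operatorname{Ext}^{i}_R(C,C)=0$ for all $i>0$ for which $R\to\operatorname{Hom}_R(C,C)$, $r\mapsto(c\mapsto rc)$, is an isomorphism. Write $X^\dagger=\operatorname{Hom}_R(X,C)$ and let $\mathcal G_C$ be the category of totally $C$-reflexive modules, i.e. of those $X$ with $\operatorname{Ext}_R^{i}(X,C)=0=\operatorname{Ext}_R^{i}(X^\dagger,C)$ for all $i>0$ for which the evaluation map $X\to X^{\dagger\dagger}$ is an isomorphism. There is a smallest thick subcategory $\mathcal A$ of $\mathcal G_C$ containing $C$. Let $\mathfrak S(C)$ be the collection of resolving subcategories $\mathcal M\supseteq\mathcal A$ such that $\mathcal A$ cogenerates $\mathcal M$ and $\operatorname{add}\mathcal A_p$ is thick in $\operatorname{add}\mathcal M_p$ for all $p\in\operatorname{Spec}R$. Then: (1) Every thick subcategory of $\mathcal G_C$ containing $C$ belongs to $\mathfrak S(C)$. (2) For every $\mathcal M\in\mathfrak S(C)$, $\Lambda_{\mathcal M}:\Gamma\to\mathfrak R(\mathcal M)$ and $\Phi_{\mathcal M}:\mathfrak R(\mathcal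 M)\to\Gamma$ are well-defined and mutually inverse bijections. (3) The map $\Lambda:\mathfrak S(C)\times\Gamma\to\bigcup_{\mathcal M\in\mathfrak S(C)}\mathfrak R(\mathcal M)$, $(\mathcal M,f)\mapsto\Lambda_{\mathcal M}(f)$, is a bijection. (4) For $\mathcal M,\mathcal N\in\mathfrak S(C)$ with $\mathcal M\subseteq\mathcal N$, the maps $\eta_{\mathcal M}^{\mathcal N}:\mathfrak R(\mathcal M)\to\mathfrak R(\mathcal N)$, $\mathcal X\mapsto\operatorname{res}(\mathcal X\cup\mathcal N)$, and $\rho_{\mathcal M}^{\mathcal N}:\mathfrak R(\mathcal N)\to\mathfrak R(\mathcal M)$, $\mathcal X\mapsto\mathcal X\cap\Delta(\mathcal M)$, are well-defined and inverse to each other, and $\Phi_{\mathcal N}\circ\eta_{\mathcal M}^{\mathcal N}=\Phi_{\mathcal M}$ and $\Phi_{\mathcal M}\circ\rho_{\mathcal M}^{\mathcal N}=\Phi_{\mathcal N}$. In particular $\Phi_{\mathcal M}\circ\eta_{\mathcal A}^{\mathcal M}=\Phi_{\mathcal A}$ on $\mathfrak R(\mathcal A)$ for every $\mathcal M\in\mathfrak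 S(C)$. -/

import Mathlib

open CategoryTheory

universe u

namespace ResolvingSubcat

noncomputable section

variable {R : Type u} [CommRing R]

/-! Full subcategories of the category of finitely generated `R`-modules are encoded as predicates
on `ModuleCat R` that imply finite generation and are invariant under isomorphism. -/

/-- Resolving subcategories of the category of finitely generated `R`-modules. -/
structure IsResolving (M : ObjectProperty (ModuleCat.{u} R)) : Prop where
  fg : M ≤ ModuleCat.isFG R
  iso : M.IsClosedUnderIsomorphisms
  self : M (ModuleCat.of R R)
  prod_iff (X Y : ModuleCat.{u} R) : M (ModuleCat.of R (X × Y)) ↔ M X ∧ M Y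
  mid_iff_left (S : ShortComplex (ModuleCat.{u} R)) (hS : S.ShortExact) (h₃ : M S.X₃) :
    M S.X₂ ↔ M S.X₁

/-- `M` is a thick subcategory of `N`. -/
structure IsThickIn (M N : ObjectProperty (ModuleCat.{u} R)) : Prop where
  resolving : IsResolving M
  le : M ≤ N
  right (S : ShortComplex (ModuleCat.{u} R)) (hS : S.ShortExact) (h₁ : M S.X₁) (h₂ : M S.X₂)
    (h₃ : N S.X₃) : M S.X₃

/-- `res P`, the smallest resolving subcategory containing `P`. -/
def res (P : ObjectProperty (ModuleCat.{u} R)) : ObjectProperty (ModuleCat.{u} R) :=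
  sInf {Q | IsResolving Q ∧ P ≤ Q}

/-- `Q` is closed under isomorphisms, (finite) direct sums and direct summands. -/
structure IsAddClosed (Q : ObjectProperty (ModuleCat.{u} R)) : Prop where
  iso : Q.IsClosedUnderIsomorphisms
  prod_iff (X Y : ModuleCat.{u} R) : Q (ModuleCat.of R (X × Y)) ↔ Q X ∧ Q Y

/-- `add P`, the smallest subcategory containing `P` closed under direct sums and summands. -/
def add (P : ObjectProperty (ModuleCat.{u} R)) : ObjectProperty (ModuleCat.{u} R) :=
  sInf {Q | IsAddClosed Q ∧ P ≤ Q}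

/-- There is an exact sequence `0 → Mₙ → ⋯ → M₀ → X → 0` with all `Mᵢ` in `P`. For `n + 1` such a
sequence is spliced from `0 → K → M₀ → X → 0` and a sequence `0 → Mₙ₊₁ → ⋯ → M₁ → K → 0`. -/
def HasResolution (P : ObjectProperty (ModuleCat.{u} R)) : ℕ → ModuleCat.{u} R → Prop
  | 0, X => ∃ M : ModuleCat.{u} R, P M ∧ Nonempty (M ≅ X)
  | n + 1, X => ∃ (K M : ModuleCat.{u} R) (i : K ⟶ M) (π : M ⟶ X) (w : i ≫ π = 0),
      (ShortComplex.mk i π w).ShortExact ∧ P M ∧ HasResolution P n K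

/-- The dimension of `X` with respect to `P`; it is `⊤` if `X` has no finite `P`-resolution. -/
def pdim (P : ObjectProperty (ModuleCat.{u} R)) (X : ModuleCat.{u} R) : ℕ∞ :=
  ⨅ (n : ℕ) (_ : HasResolution P n X), (n : ℕ∞)

/-- The finitely generated modules of finite dimension with respect to `P`. -/
def finDim (P : ObjectProperty (ModuleCat.{u} R)) : ObjectProperty (ModuleCat.{u} R) :=
  fun X => ModuleCat.isFG R X ∧ pdim P X < ⊤

/-- The collection of resolving subcategories `X` with `M ⊆ X ⊆ finDim M`. -/
def resolvingOver (M : ObjectProperty (ModuleCat.{u} R)) :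
    Set (ObjectProperty (ModuleCat.{u} R)) :=
  {X | IsResolving X ∧ M ≤ X ∧ X ≤ finDim M}

/-- The localization `X_p`, a module over `R_p`. -/
def locModule (X : ModuleCat.{u} R) (p : PrimeSpectrum R) :
    ModuleCat.{u} (Localization.AtPrime p.asIdeal) :=
  X.localizedModule p.asIdeal.primeCompl

/-- `add M_p`, where `M_p` consists of the localizations at `p` of the modules in `M`. -/
def addLoc (M : ObjectProperty (ModuleCat.{u} R)) (p : PrimeSpectrum R) :
    ObjectProperty (ModuleCat.{u} (Localization.AtPrime p.asIdeal)) :=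
  add fun Y => ∃ X : ModuleCat.{u} R, M X ∧ Nonempty (locModule X p ≅ Y)

/-- The grade of an ideal: the supremum of the lengths of the `R`-regular sequences in it. -/
def grade (I : Ideal R) : ℕ∞ :=
  ⨆ (rs : List R) (_ : (∀ r ∈ rs, r ∈ I) ∧ RingTheory.Sequence.IsRegular R rs), (rs.length : ℕ∞)

variable (R) in
/-- The grade consistent functions `Spec R → ℕ`, seen as functions to `ℕ∞` with finite values. -/
def gradeConsistent : Set (PrimeSpectrum R → ℕ∞) :=
  {f | (∀ p, f p ≠ ⊤) ∧ Monotone f ∧ ∀ p, f p ≤ grade p.asIdeal}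

/-- `Λ_M(f)`, the finitely generated `X` with `add M_p`-dimension of `X_p` at most `f p`
for all `p`. -/
def Lam (M : ObjectProperty (ModuleCat.{u} R)) (f : PrimeSpectrum R → ℕ∞) :
    ObjectProperty (ModuleCat.{u} R) :=
  fun X => ModuleCat.isFG R X ∧ ∀ p, pdim (addLoc M p) (locModule X p) ≤ f p

/-- `Φ_M(X)`, sending `p` to the supremum of the `add M_p`-dimensions of `Y_p` for `Y` in `X`. -/
def Phi (M X : ObjectProperty (ModuleCat.{u} R)) : PrimeSpectrum R → ℕ∞ :=
  fun p => ⨆ (Y : ModuleCat.{u} R) (_ : X Y), pdim (addLoc M p) (locModule Y p)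

/-- The map `η_M^N`, `X ↦ res (X ∪ N)`, on `resolvingOver M`. -/
def eta (_M N X : ObjectProperty (ModuleCat.{u} R)) : ObjectProperty (ModuleCat.{u} R) :=
  res (X ⊔ N)

/-- The map `ρ_M^N`, `X ↦ X ∩ finDim M`, on `resolvingOver N`. -/
def rho (M _N X : ObjectProperty (ModuleCat.{u} R)) : ObjectProperty (ModuleCat.{u} R) :=
  X ⊓ finDim M

/-- `A` cogenerates `M`. -/
def Cogenerates (A M : ObjectProperty (ModuleCat.{u} R)) : Prop :=
  A ≤ M ∧ ∀ X, M X → ∃ (Y Z : ModuleCat.{u} R) (i : X ⟶ Y) (π : Y ⟶ Z) (w : i ≫ π = 0),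
    (ShortComplex.mk i π w).ShortExact ∧ A Y ∧ M Z

/-- `C` is a semidualizing module. -/
structure IsSemidualizing (C : ModuleCat.{u} R) : Prop where
  fg : Module.Finite R C
  ext (i : ℕ) (hi : 0 < i) : Subsingleton (Abelian.Ext C C i)
  homothety : Function.Bijective (LinearMap.lsmul R C)

/-- The dual `Hom(X, C)`. -/
abbrev dual (C X : ModuleCat.{u} R) : ModuleCat.{u} R :=
  ModuleCat.of R (X →ₗ[R] C)

/-- `X` is totally `C`-reflexive. The last condition is about the evaluation map
`X → Hom(Hom(X, C), C)`. -/
structure IsTotallyReflexive (C X : ModuleCat.{u} R) : Prop where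
  fg : Module.Finite R X
  ext (i : ℕ) (hi : 0 < i) : Subsingleton (Abelian.Ext X C i)
  ext_dual (i : ℕ) (hi : 0 < i) : Subsingleton (Abelian.Ext (dual C X) C i)
  reflexive : Function.Bijective
    (LinearMap.applyₗ : X →ₗ[R] (X →ₗ[R] C) →ₗ[R] C)

/-- The category `G_C` of totally `C`-reflexive modules. -/
def GC (C : ModuleCat.{u} R) : ObjectProperty (ModuleCat.{u} R) := IsTotallyReflexive C

/-- The thick subcategories of `G_C` containing `C`. -/
def thickGC (C : ModuleCat.{u} R) : Set (ObjectProperty (ModuleCat.{u} R)) :=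
  {M | IsThickIn M (GC C) ∧ M C}

/-- The smallest thick subcategory of `G_C` containing `C`. -/
def minThick (C : ModuleCat.{u} R) : ObjectProperty (ModuleCat.{u} R) := sInf (thickGC C)

/-- The collection `S(C)` of resolving subcategories `M` that are cogenerated by
`A = minThick C` and such that `add A_p` is thick in `add M_p` for every prime `p`. -/
def SC (C : ModuleCat.{u} R) : Set (ObjectProperty (ModuleCat.{u} R)) :=
  {M | IsResolving M ∧ Cogenerates (minThick C) M ∧
    ∀ p : PrimeSpectrum R, IsThickIn (addLoc (minThick C) p) (addLoc M p)}

end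

end ResolvingSubcat

open ResolvingSubcat

/-! The class `S(C)` is exactly the set of thick subcategories of `G_C` containing `C`
(`thickGC_subset_SC`, `SC_subset_thickGC`), and these are the resolving subcategories of `G_C`
containing `C` whose members embed into powers of `C` with cokernel again in the subcategory. For
such an `M`, a module `X` of finite `M`-dimension has dimension at most `n` iff `Extⁱ(X, C) = 0` for
all `i > n` (`thickGC_shift_iff`). So the dimension does not depend on `M` as long as it is finite,
which makes `η` and `ρ` the identity on `Γ`, and `M` is recovered from `Λ_M(f)` as its intersection
with `G_C` (`Lam_inf_GC`), which makes `Λ` injective.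

Local conditions are expressed over `R` itself: the scalars whose multiplication on `X` factors
through a module in `P` form an ideal `annFac`, and `X_p` lies in `add P_p` iff this ideal is not
contained in `p`.

`Φ` takes values in `Γ` because a maximal regular sequence in `p` bounds the dimension at `p`
(`exists_isRegular_pdim_le`), by a depth argument in the style of Auslander and Buchsbaum
(`extend_of_isWeaklyRegular`). `Φ ∘ Λ` is the identity because applying `Hom(-, C)` to a free
resolution of `R ⧸ p` yields, up to the grade of `p`, cosyzygies of prescribed dimension on `V(p)`
and of dimension zero elsewhere (`Tower`, `Phi_Lam`).

For `Λ ∘ Φ`, localize a hypothetical counterexample `X` at a minimal prime of its `annFac`. What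
remains is a local statement (`mem_of_punctured_mem`): a resolving `P` containing `M` and a module
of dimension `n + 1` contains every module of dimension at most `n + 1` that lies in `P` on the
punctured spectrum. Pulling free covers back along multiplications (`exists_twist`) reduces this to
modules that lie in `M` on the punctured spectrum. For those, the towers over the maximal ideal play
the part of simple objects: `P` contains them (`Tower.mem`), and the `Ext` modules of `X` are then
killed one socle element at a time (`mem_of_towers`). -/

namespace ResolvingSubcat

/-! ### Short exact sequences, pullbacks and pushouts, and first closure properties. -/

section Basics

variable {R : Type u} [CommRing R]
variable {X Y Z N K : Type u} [AddCommGroup X] [Module R X] [AddCommGroup Y] [Module R Y]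
  [AddCommGroup Z] [Module R Z] [AddCommGroup N] [Module R N] [AddCommGroup K] [Module R K]

/-- `0 → X → Y → Z → 0` is a short exact sequence of modules. -/
structure SES (f : X →ₗ[R] Y) (g : Y →ₗ[R] Z) : Prop where
  inj : Function.Injective f
  exact : Function.Exact f g
  surj : Function.Surjective g

namespace SES

variable {f : X →ₗ[R] Y} {g : Y →ₗ[R] Z}

theorem comp_apply (h : SES f g) (x : X) : g (f x) = 0 := h.exact.apply_apply_eq_zero x

theorem exists_preimage (h : SES f g) {y : Y} (hy : g y = 0) : ∃ x, f x = y := (h.exact y).1 hy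

theorem comp_eq_zero (h : SES f g) : ModuleCat.ofHom f ≫ ModuleCat.ofHom g = 0 := by
  ext x; exact h.comp_apply x

/-- The short complex in `ModuleCat R` given by a short exact sequence. -/
abbrev complex (h : SES f g) : ShortComplex (ModuleCat.{u} R) :=
  ShortComplex.mk (ModuleCat.ofHom f) (ModuleCat.ofHom g) h.comp_eq_zero

theorem shortExact (h : SES f g) : h.complex.ShortExact :=
  ModuleCat.shortComplex_shortExact _ h.exact h.inj h.surj

theorem of_shortExact {S : ShortComplex (ModuleCat.{u} R)} (h : S.ShortExact) :
    SES S.f.hom S.g.hom :=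
  ⟨h.moduleCat_injective_f, (ShortComplex.ShortExact.moduleCat_exact_iff_function_exact _).1 h.exact,
    h.moduleCat_surjective_g⟩

theorem ker (hg : Function.Surjective g) : SES (LinearMap.ker g).subtype g :=
  ⟨Subtype.val_injective, LinearMap.exact_subtype_ker_map g, hg⟩

theorem coker (hf : Function.Injective f) : SES f (LinearMap.range f).mkQ :=
  ⟨hf, LinearMap.exact_map_mkQ_range f, Submodule.mkQ_surjective _⟩

variable (R X Y) in
theorem prod : SES (LinearMap.inl R X Y) (LinearMap.snd R X Y) :=
  ⟨LinearMap.inl_injective, Function.Exact.inl_snd, LinearMap.snd_surjective⟩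

/-- Maps vanishing on the kernel descend along a surjection. -/
theorem exists_desc (h : SES f g) (k : Y →ₗ[R] N) (hk : ∀ x, k (f x) = 0) :
    ∃ l : Z →ₗ[R] N, ∀ y, l (g y) = k y := by
  have hle : LinearMap.ker g ≤ LinearMap.ker k := by
    intro y hy
    obtain ⟨x, rfl⟩ := h.exists_preimage hy
    exact hk x
  refine ⟨((LinearMap.ker g).liftQ k hle) ∘ₗ (g.quotKerEquivOfSurjective h.surj).symm, fun y => ?_⟩
  have : (g.quotKerEquivOfSurjective h.surj).symm (g y) = (LinearMap.ker g).mkQ y := by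
    rw [LinearEquiv.symm_apply_eq]; rfl
  simp [this]

/-- Maps vanishing after projection lift to the kernel. -/
theorem exists_lift (h : SES f g) (k : N →ₗ[R] Y) (hk : ∀ n, g (k n) = 0) :
    ∃ l : N →ₗ[R] X, ∀ n, f (l n) = k n := by
  let e := LinearEquiv.ofInjective f h.inj
  have hr : ∀ n, k n ∈ LinearMap.range f := fun n => h.exists_preimage (hk n)
  refine ⟨e.symm ∘ₗ k.codRestrict _ hr, fun n => ?_⟩
  have : e (e.symm (k.codRestrict _ hr n)) = k.codRestrict _ hr n := e.apply_symm_apply _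
  exact congrArg Subtype.val this

/-- The pullback of a short exact sequence. -/
theorem exists_pullback (h : SES f g) (k : N →ₗ[R] Z) :
    ∃ (W : ModuleCat.{u} R) (i : X →ₗ[R] W) (p : W →ₗ[R] Y) (q : W →ₗ[R] N),
      SES i q ∧ (∀ x, p (i x) = f x) ∧ (∀ w, g (p w) = k (q w)) ∧
      (∀ y n, g y = k n → ∃ w, p w = y ∧ q w = n) ∧
      (∀ w, p w = 0 → q w = 0 → w = 0) ∧
      (∀ (V : ModuleCat.{u} R) (a : V →ₗ[R] Y) (b : V →ₗ[R] N), (∀ v, g (a v) = k (b v)) →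
        ∃ c : V →ₗ[R] W, (∀ v, p (c v) = a v) ∧ ∀ v, q (c v) = b v) := by
  let D : Y × N →ₗ[R] Z := g ∘ₗ LinearMap.fst R Y N - k ∘ₗ LinearMap.snd R Y N
  have hD : ∀ w : LinearMap.ker D, g w.1.1 = k w.1.2 := fun w =>
    sub_eq_zero.1 (LinearMap.mem_ker.1 w.2)
  refine ⟨ModuleCat.of R (LinearMap.ker D),
    (LinearMap.inl R Y N ∘ₗ f).codRestrict _ (fun x => by simp [D, h.comp_apply]),
    LinearMap.fst R Y N ∘ₗ (LinearMap.ker D).subtype,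
    LinearMap.snd R Y N ∘ₗ (LinearMap.ker D).subtype, ⟨?_, ?_, ?_⟩, fun _ => rfl, hD, ?_, ?_, ?_⟩
  · intro a b hab
    exact h.inj (congrArg (fun w => w.1.1) hab)
  · intro w
    constructor
    · intro hw
      have hw' : w.1.2 = 0 := hw
      obtain ⟨x, hx⟩ := h.exists_preimage (y := w.1.1) (by rw [hD w, hw', map_zero])
      exact ⟨x, Subtype.ext (Prod.ext hx hw'.symm)⟩
    · rintro ⟨x, rfl⟩; rfl
  · intro n
    obtain ⟨y, hy⟩ := h.surj (k n)
    exact ⟨⟨(y, n), by simp [D, hy]⟩, rfl⟩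
  · intro y n hyn
    exact ⟨⟨(y, n), by simp [D, hyn]⟩, rfl, rfl⟩
  · intro w h1 h2
    exact Subtype.ext (Prod.ext h1 h2)
  · intro V a b hab
    exact ⟨(a.prod b).codRestrict _ (fun v => by simp [D, hab]), fun _ => rfl, fun _ => rfl⟩

/-- The pushout of a short exact sequence. -/
theorem exists_pushout (h : SES f g) (k : X →ₗ[R] N) :
    ∃ (W : ModuleCat.{u} R) (i : N →ₗ[R] W) (j : Y →ₗ[R] W) (q : W →ₗ[R] Z),
      SES i q ∧ (∀ x, j (f x) = i (k x)) ∧ (∀ y, q (j y) = g y) ∧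
      (∀ w, ∃ n y, w = i n + j y) ∧
      (∀ (V : ModuleCat.{u} R) (a : N →ₗ[R] V) (b : Y →ₗ[R] V), (∀ x, b (f x) = a (k x)) →
        ∃ c : W →ₗ[R] V, (∀ n, c (i n) = a n) ∧ ∀ y, c (j y) = b y) := by
  let D : X →ₗ[R] N × Y := LinearMap.prod (-k) f
  let π := (LinearMap.range D).mkQ
  have hD : ∀ x, π (D x) = 0 := fun x => by simp [π]
  have hπ : ∀ w, π w = 0 → ∃ x, D x = w := fun w hw => by simpa [π] using hw
  have hq : LinearMap.range D ≤ LinearMap.ker (g ∘ₗ LinearMap.snd R N Y) := by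
    rintro _ ⟨x, rfl⟩; simp [D, h.comp_apply]
  refine ⟨ModuleCat.of R ((N × Y) ⧸ LinearMap.range D), π ∘ₗ LinearMap.inl R N Y,
    π ∘ₗ LinearMap.inr R N Y, (LinearMap.range D).liftQ _ hq, ⟨?_, ?_, ?_⟩, ?_, ?_, ?_, ?_⟩
  · refine (injective_iff_map_eq_zero _).2 fun n hn => ?_
    obtain ⟨x, hx⟩ := hπ _ hn
    have h2 : f x = 0 := congrArg Prod.snd hx
    have h1 : -k x = n := congrArg Prod.fst hx
    have : x = 0 := h.inj (by rw [h2, map_zero])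
    rw [← h1, this]; simp
  · intro w
    obtain ⟨⟨n, y⟩, rfl⟩ := Submodule.mkQ_surjective _ w
    constructor
    · intro hw
      have hw' : g y = 0 := hw
      obtain ⟨x, hx⟩ := h.exists_preimage hw'
      refine ⟨n + k x, ?_⟩
      rw [← sub_eq_zero]
      change π (n + k x, 0) - π (n, y) = 0
      rw [← map_sub, ← neg_eq_zero, ← map_neg]
      convert! hD x using 2
      simp [D, hx]
    · rintro ⟨m, hm⟩
      rw [← hm]
      exact map_zero g
  · intro z
    obtain ⟨y, rfl⟩ := h.surj z
    exact ⟨π (0, y), rfl⟩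
  · intro x
    rw [← sub_eq_zero]
    change π (0, f x) - π (k x, 0) = 0
    rw [← map_sub]
    convert! hD x using 2
    simp [D]
  · intro y; rfl
  · intro w
    obtain ⟨⟨n, y⟩, rfl⟩ := Submodule.mkQ_surjective _ w
    refine ⟨n, y, ?_⟩
    change π (n, y) = π (n, 0) + π (0, y)
    rw [← map_add]; simp
  · intro V a b hab
    have hc : LinearMap.range D ≤ LinearMap.ker (LinearMap.coprod a b) := by
      rintro _ ⟨x, rfl⟩; simp [D, hab]
    refine ⟨(LinearMap.range D).liftQ _ hc, fun n => ?_, fun y => ?_⟩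
    · change LinearMap.coprod a b (n, 0) = a n
      simp
    · change LinearMap.coprod a b (0, y) = b y
      simp

/-- The pullback of two short exact sequences with the same right end. -/
theorem exists_pullback_pair {X' Y' : Type u} [AddCommGroup X'] [Module R X'] [AddCommGroup Y']
    [Module R Y'] {f' : X' →ₗ[R] Y'} {g' : Y' →ₗ[R] Z} (h : SES f g) (h' : SES f' g') :
    ∃ (W : ModuleCat.{u} R) (i : X →ₗ[R] W) (q : W →ₗ[R] Y') (i' : X' →ₗ[R] W) (p : W →ₗ[R] Y),
      SES i q ∧ SES i' p := by
  obtain ⟨W, i, p, q, hiq, -, hpq, hex, h0, hu⟩ := h.exists_pullback g'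
  obtain ⟨i', h1, h2⟩ := hu (ModuleCat.of R X') 0 f' (fun x => by simp [h'.comp_apply])
  refine ⟨W, i, q, i', p, hiq, ⟨?_, ?_, ?_⟩⟩
  · intro a b hab
    exact h'.inj (by rw [← h2, ← h2, hab])
  · intro w
    constructor
    · intro hw
      obtain ⟨x, hx⟩ := h'.exists_preimage (y := q w) (by rw [← hpq, hw, map_zero])
      refine ⟨x, ?_⟩
      rw [← sub_eq_zero]
      exact h0 _ (by rw [map_sub, h1, hw]; simp) (by rw [map_sub, h2, hx, sub_self])
    · rintro ⟨x, rfl⟩; exact h1 x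
  · intro y
    obtain ⟨n, hn⟩ := h'.surj (g y)
    obtain ⟨w, hw, -⟩ := hex y n hn.symm
    exact ⟨w, hw⟩

/-- The pushout of two short exact sequences with the same left end. -/
theorem exists_pushout_pair {Y' Z' : Type u} [AddCommGroup Z'] [Module R Z'] [AddCommGroup Y']
    [Module R Y'] {f' : X →ₗ[R] Y'} {g' : Y' →ₗ[R] Z'} (h : SES f g) (h' : SES f' g') :
    ∃ (W : ModuleCat.{u} R) (i : Y' →ₗ[R] W) (q : W →ₗ[R] Z) (j : Y →ₗ[R] W) (q' : W →ₗ[R] Z'),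
      SES i q ∧ SES j q' := by
  obtain ⟨W, i, j, q, hiq, hc, hq, hex, hu⟩ := h.exists_pushout f'
  obtain ⟨q', h1, h2⟩ := hu (ModuleCat.of R Z') g' 0 (fun x => by simp [h'.comp_apply])
  refine ⟨W, i, q, j, q', hiq, ⟨?_, ?_, ?_⟩⟩
  · refine (injective_iff_map_eq_zero _).2 fun y hy => ?_
    obtain ⟨x, rfl⟩ := h.exists_preimage (y := y) (by rw [← hq, hy, map_zero])
    rw [hc] at hy
    have h3 := hiq.inj (hy.trans (map_zero i).symm)
    rw [h'.inj (h3.trans (map_zero f').symm), map_zero]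
  · intro w
    obtain ⟨n, y, rfl⟩ := hex w
    rw [map_add, h1, h2]
    constructor
    · intro hw
      obtain ⟨x, rfl⟩ := h'.exists_preimage (y := n) (by simpa using hw)
      exact ⟨f x + y, by rw [map_add, hc]⟩
    · rintro ⟨y', hy'⟩
      have := congrArg q' hy'
      rw [h2, map_add, h1, h2] at this
      exact this.symm
  · intro z
    obtain ⟨y, rfl⟩ := h'.surj z
    exact ⟨i y, h1 y⟩

end SES

theorem exists_free_cover (X : Type u) [AddCommGroup X] [Module R X] [Module.Finite R X] :
    ∃ (n : ℕ) (f : (Fin n → R) →ₗ[R] X), Function.Surjective f :=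
  Module.Finite.exists_fin' R X

/-- Linear maps out of a finite free module lift along surjections. -/
theorem exists_lift_of_free {n : ℕ} {g : Y →ₗ[R] Z} (hg : Function.Surjective g)
    (f : (Fin n → R) →ₗ[R] Z) : ∃ l : (Fin n → R) →ₗ[R] Y, ∀ x, g (l x) = f x := by
  obtain ⟨l, hl⟩ := Module.projective_lifting_property g f hg
  exact ⟨l, fun x => LinearMap.congr_fun hl x⟩

namespace IsResolving

variable {P : ObjectProperty (ModuleCat.{u} R)} (hP : IsResolving P)
include hP

theorem of_equiv (e : X ≃ₗ[R] Y) (h : P (ModuleCat.of R X)) : P (ModuleCat.of R Y) := by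
  have := hP.iso
  exact P.prop_of_iso e.toModuleIso h

theorem mid_iff {f : X →ₗ[R] Y} {g : Y →ₗ[R] Z} (h : SES f g) (hZ : P (ModuleCat.of R Z)) :
    P (ModuleCat.of R Y) ↔ P (ModuleCat.of R X) :=
  hP.mid_iff_left _ h.shortExact hZ

theorem mid {f : X →ₗ[R] Y} {g : Y →ₗ[R] Z} (h : SES f g) (hX : P (ModuleCat.of R X))
    (hZ : P (ModuleCat.of R Z)) : P (ModuleCat.of R Y) := (hP.mid_iff h hZ).2 hX

theorem left {f : X →ₗ[R] Y} {g : Y →ₗ[R] Z} (h : SES f g) (hY : P (ModuleCat.of R Y))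
    (hZ : P (ModuleCat.of R Z)) : P (ModuleCat.of R X) := (hP.mid_iff h hZ).1 hY

theorem finite (X : ModuleCat.{u} R) (h : P X) : Module.Finite R X := hP.fg _ h

theorem prod (hX : P (ModuleCat.of R X)) (hY : P (ModuleCat.of R Y)) :
    P (ModuleCat.of R (X × Y)) :=
  (hP.prod_iff (ModuleCat.of R X) (ModuleCat.of R Y)).2 ⟨hX, hY⟩

theorem of_subsingleton [Subsingleton X] : P (ModuleCat.of R X) := by
  have : Unique X := uniqueOfSubsingleton 0
  have h : P (ModuleCat.of R (R × X)) :=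
    hP.of_equiv (X := R) (LinearEquiv.prodUnique (R := R) (M := R) (M₂ := X) |>.symm) hP.self
  exact ((hP.prod_iff (ModuleCat.of R R) (ModuleCat.of R X)).1 h).2

theorem pi (n : ℕ) (hX : P (ModuleCat.of R X)) : P (ModuleCat.of R (Fin n → X)) := by
  induction n with
  | zero => exact hP.of_subsingleton
  | succ n ih => exact hP.of_equiv (Fin.consLinearEquiv R (fun _ => X)) (hP.prod hX ih)

theorem free (n : ℕ) : P (ModuleCat.of R (Fin n → R)) := hP.pi n hP.self

end IsResolving

theorem IsResolving.isAddClosed {P : ObjectProperty (ModuleCat.{u} R)} (hP : IsResolving P) :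
    IsAddClosed P := ⟨hP.iso, hP.prod_iff⟩

theorem IsAddClosed.of_equiv {P : ObjectProperty (ModuleCat.{u} R)} (hP : IsAddClosed P)
    (e : X ≃ₗ[R] Y) (h : P (ModuleCat.of R X)) : P (ModuleCat.of R Y) := by
  have := hP.iso
  exact P.prop_of_iso e.toModuleIso h

/-- A short exact sequence with a retraction of the injection identifies the middle term with a
product. -/
theorem SES.exists_equiv_of_retraction {f : X →ₗ[R] Y} {g : Y →ₗ[R] Z} (h : SES f g)
    (r : Y →ₗ[R] X) (hr : ∀ x, r (f x) = x) : Nonempty (Y ≃ₗ[R] X × Z) := by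
  refine ⟨LinearEquiv.ofBijective (r.prod g) ⟨?_, ?_⟩⟩
  · refine (injective_iff_map_eq_zero _).2 fun y hy => ?_
    obtain ⟨x, rfl⟩ := h.exists_preimage (congrArg Prod.snd hy)
    have : r (f x) = 0 := congrArg Prod.fst hy
    rw [hr] at this
    simp [this]
  · rintro ⟨x, z⟩
    obtain ⟨y, rfl⟩ := h.surj z
    refine ⟨y + f (x - r y), ?_⟩
    simp [hr, h.comp_apply]

/-- Retracts of modules in an additively closed subcategory belong to it. -/
theorem IsAddClosed.retract {P : ObjectProperty (ModuleCat.{u} R)} (hP : IsAddClosed P)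
    (h : X →ₗ[R] Y) (g : Y →ₗ[R] X) (hgh : ∀ x, g (h x) = x) (hY : P (ModuleCat.of R Y)) :
    P (ModuleCat.of R X) := by
  have hi : Function.Injective h := Function.LeftInverse.injective hgh
  obtain ⟨e⟩ := (SES.coker hi).exists_equiv_of_retraction g hgh
  exact ((hP.prod_iff (ModuleCat.of R X) (ModuleCat.of R _)).1 (hP.of_equiv e hY)).1

end Basics

end ResolvingSubcat

namespace ResolvingSubcat

/-! ### Dimension with respect to a resolving subcategory, by iterated syzygies. -/

section Shift

variable {R : Type u} [CommRing R]
variable {X Y Z K M : Type u} [AddCommGroup X] [Module R X] [AddCommGroup Y] [Module R Y]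
  [AddCommGroup Z] [Module R Z] [AddCommGroup M] [Module R M] [AddCommGroup K] [Module R K]

/-- The modules having a first syzygy in `P`. -/
def shift (P : ObjectProperty (ModuleCat.{u} R)) : ObjectProperty (ModuleCat.{u} R) :=
  fun X => ∃ (n : ℕ) (f : (Fin n → R) →ₗ[R] X),
    Function.Surjective f ∧ P (ModuleCat.of R (LinearMap.ker f))

variable {P Q : ObjectProperty (ModuleCat.{u} R)}

theorem shift_mono (h : P ≤ Q) : shift P ≤ shift Q := by
  rintro X ⟨n, f, hf, hK⟩
  exact ⟨n, f, hf, h _ hK⟩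

theorem shift_iterate_mono (h : P ≤ Q) (n : ℕ) : shift^[n] P ≤ shift^[n] Q := by
  induction n with
  | zero => exact h
  | succ n ih => simpa only [Function.iterate_succ_apply'] using shift_mono ih

theorem shift_finite {X : ModuleCat.{u} R} (h : shift P X) : Module.Finite R X := by
  obtain ⟨n, f, hf, -⟩ := h
  exact Module.Finite.of_surjective f hf

namespace IsResolving

/-- Schanuel's argument: the pullback of `M` and a free cover over `X` is an extension of the free
module by `K` and also of `M` by the syzygy of `X`. This and its converse `left_of_shift` make
`shift` independent of the cover, and even allow covers from `P`. -/
theorem shift_of_ses (hP : IsResolving P) {i : K →ₗ[R] M} {π : M →ₗ[R] X} (h : SES i π)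
    (hM : P (ModuleCat.of R M)) (hK : P (ModuleCat.of R K)) : shift P (ModuleCat.of R X) := by
  have := hP.finite _ hM
  have : Module.Finite R X := Module.Finite.of_surjective π h.surj
  obtain ⟨n, f, hf⟩ := exists_free_cover (R := R) X
  obtain ⟨W, _, _, _, _, h1, h2⟩ := h.exists_pullback_pair (SES.ker hf)
  exact ⟨n, f, hf, hP.left h2 (hP.mid h1 hK (hP.free n)) hM⟩

theorem left_of_shift (hP : IsResolving P) {i : K →ₗ[R] M} {π : M →ₗ[R] X} (h : SES i π)
    (hM : P (ModuleCat.of R M)) (hX : shift P (ModuleCat.of R X)) : P (ModuleCat.of R K) := by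
  obtain ⟨n, f, hf, hK⟩ := hX
  obtain ⟨W, _, _, _, _, h1, h2⟩ := h.exists_pullback_pair (SES.ker hf)
  exact hP.left h1 (hP.mid h2 hK hM) (hP.free n)

theorem shift_iff (hP : IsResolving P) {i : K →ₗ[R] M} {π : M →ₗ[R] X} (h : SES i π)
    (hM : P (ModuleCat.of R M)) : shift P (ModuleCat.of R X) ↔ P (ModuleCat.of R K) :=
  ⟨hP.left_of_shift h hM, hP.shift_of_ses h hM⟩

theorem le_shift (hP : IsResolving P) : P ≤ shift P := by
  intro X hX
  have := hP.finite _ hX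
  obtain ⟨n, f, hf⟩ := exists_free_cover (R := R) X
  exact ⟨n, f, hf, hP.left (SES.ker hf) (hP.free n) hX⟩

theorem shift (hP : IsResolving P) : IsResolving (shift P) where
  fg _ h := shift_finite h
  iso := by
    refine ⟨fun {X Y} e h => ?_⟩
    obtain ⟨n, f, hf, hK⟩ := h
    refine ⟨n, e.toLinearEquiv.toLinearMap ∘ₗ f, e.toLinearEquiv.surjective.comp hf, ?_⟩
    rwa [LinearEquiv.ker_comp]
  self := hP.le_shift _ hP.self
  prod_iff X Y := by
    have key : ∀ (n m : ℕ) (f : (Fin n → R) →ₗ[R] X) (g : (Fin m → R) →ₗ[R] Y),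
        Function.Surjective f → Function.Surjective g →
        (ResolvingSubcat.shift P (ModuleCat.of R (X × Y)) ↔
          P (ModuleCat.of R (LinearMap.ker f)) ∧ P (ModuleCat.of R (LinearMap.ker g))) := by
      intro n m f g hf hg
      have hs : SES ((LinearMap.ker f).subtype.prodMap (LinearMap.ker g).subtype)
          (f.prodMap g) := by
        refine ⟨Function.Injective.prodMap Subtype.val_injective Subtype.val_injective, ?_,
          Function.Surjective.prodMap hf hg⟩
        rintro ⟨a, b⟩
        simp [Prod.ext_iff]
      rw [hP.shift_iff hs (hP.prod (hP.free n) (hP.free m))]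
      exact hP.prod_iff (ModuleCat.of R (LinearMap.ker f)) (ModuleCat.of R (LinearMap.ker g))
    constructor
    · intro h
      have := shift_finite h
      have : Module.Finite R (X × Y) := this
      have : Module.Finite R X := 
        Module.Finite.of_surjective (LinearMap.fst R X Y) LinearMap.fst_surjective
      have : Module.Finite R Y :=
        Module.Finite.of_surjective (LinearMap.snd R X Y) LinearMap.snd_surjective
      obtain ⟨n, f, hf⟩ := exists_free_cover (R := R) X
      obtain ⟨m, g, hg⟩ := exists_free_cover (R := R) Y
      have := (key n m f g hf hg).1 h
      exact ⟨⟨n, f, hf, this.1⟩, ⟨m, g, hg, this.2⟩⟩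
    · rintro ⟨⟨n, f, hf, hK⟩, ⟨m, g, hg, hL⟩⟩
      exact (key n m f g hf hg).2 ⟨hK, hL⟩
  mid_iff_left S hS h₃ := by
    have h := SES.of_shortExact hS
    -- A cover `f` of `X₂` also covers `X₃`, and `0 → ker f → ker (g ∘ f) → X₁ → 0` is exact with
    -- middle term in `P`, so `ker f` serves as a syzygy of `X₁`.
    have key : ∀ (n : ℕ) (f : (Fin n → R) →ₗ[R] S.X₂), Function.Surjective f →
        (ResolvingSubcat.shift P S.X₁ ↔ P (ModuleCat.of R (LinearMap.ker f))) := by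
      intro n f hf
      have hgf : Function.Surjective (S.g.hom ∘ₗ f) := h.surj.comp hf
      have hZ := hP.left_of_shift (SES.ker hgf) (hP.free n) h₃
      have hle : LinearMap.ker f ≤ LinearMap.ker (S.g.hom ∘ₗ f) := LinearMap.ker_le_ker_comp _ _
      obtain ⟨l, hl⟩ := h.exists_lift (f ∘ₗ (LinearMap.ker (S.g.hom ∘ₗ f)).subtype)
        (fun x => x.2)
      refine hP.shift_iff (i := Submodule.inclusion hle) (π := l) ⟨Submodule.inclusion_injective _, ?_, ?_⟩ hZ
      · intro x
        constructor
        · intro hx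
          exact ⟨⟨x, by have := hl x; rw [hx, map_zero] at this; exact this.symm⟩, rfl⟩
        · rintro ⟨y, rfl⟩
          apply h.inj
          rw [hl, map_zero]
          exact y.2
      · intro x
        obtain ⟨y, hy⟩ := hf (S.f x)
        refine ⟨⟨y, ?_⟩, h.inj ?_⟩
        · change S.g.hom (f y) = 0
          rw [hy]; exact h.comp_apply x
        · rw [hl]; exact hy
    constructor
    · rintro ⟨n, f, hf, hK⟩
      exact (key n f hf).2 hK
    · intro hX
      have := shift_finite hX
      have := shift_finite h₃
      have : Module.Finite R S.X₂ := Module.Finite.of_exact h.exact h.surj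
      obtain ⟨n, f, hf⟩ := exists_free_cover (R := R) S.X₂
      exact ⟨n, f, hf, (key n f hf).1 hX⟩

theorem shift_iterate (hP : IsResolving P) (n : ℕ) :
    IsResolving (ResolvingSubcat.shift^[n] P) := by
  induction n with
  | zero => exact hP
  | succ n ih => simpa only [Function.iterate_succ_apply'] using ih.shift

theorem shift_iterate_le (hP : IsResolving P) {m n : ℕ} (h : m ≤ n) :
    ResolvingSubcat.shift^[m] P ≤ ResolvingSubcat.shift^[n] P := by
  induction h with
  | refl => exact le_rfl
  | step _ ih =>
    refine ih.trans ?_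
    rw [Function.iterate_succ_apply']
    exact (hP.shift_iterate _).le_shift

theorem le_shift_iterate (hP : IsResolving P) (n : ℕ) : P ≤ ResolvingSubcat.shift^[n] P :=
  hP.shift_iterate_le (Nat.zero_le n)

/-- In a short exact sequence with middle term in `P`, the dimension drops by one. -/
theorem shift_iterate_succ_iff (hP : IsResolving P) {i : K →ₗ[R] M} {π : M →ₗ[R] X} (h : SES i π)
    (hM : P (ModuleCat.of R M)) (n : ℕ) :
    ResolvingSubcat.shift^[n + 1] P (ModuleCat.of R X) ↔
      ResolvingSubcat.shift^[n] P (ModuleCat.of R K) := by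
  rw [Function.iterate_succ_apply']
  exact (hP.shift_iterate n).shift_iff h (hP.le_shift_iterate n _ hM)

/-- All terms of a `P`-resolution except the last may be taken free, by `shift_iterate_succ_iff`. -/
theorem hasResolution_iff (hP : IsResolving P) (n : ℕ) (X : ModuleCat.{u} R) :
    HasResolution P n X ↔ ResolvingSubcat.shift^[n] P X := by
  induction n generalizing X with
  | zero =>
    constructor
    · rintro ⟨M, hM, ⟨e⟩⟩
      have := hP.iso
      exact P.prop_of_iso e hM
    · intro h
      exact ⟨X, h, ⟨Iso.refl _⟩⟩
  | succ n ih =>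
    constructor
    · rintro ⟨K, M, i, π, w, hS, hM, hK⟩
      exact (hP.shift_iterate_succ_iff (SES.of_shortExact hS) hM n).2 ((ih K).1 hK)
    · intro h
      rw [Function.iterate_succ_apply'] at h
      obtain ⟨m, f, hf, hK⟩ := h
      have hs := SES.ker hf
      exact ⟨_, _, _, _, hs.comp_eq_zero, hs.shortExact, hP.free m, (ih _).2 hK⟩

theorem pdim_le_iff (hP : IsResolving P) (n : ℕ) (X : ModuleCat.{u} R) :
    pdim P X ≤ n ↔ ResolvingSubcat.shift^[n] P X := by
  constructor
  · intro h
    by_contra hc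
    have : ((n + 1 : ℕ) : ℕ∞) ≤ pdim P X := by
      refine le_iInf₂ fun m hm => ?_
      rw [hP.hasResolution_iff] at hm
      by_contra hlt
      refine hc (hP.shift_iterate_le ?_ _ hm)
      have : m < n + 1 := by exact_mod_cast not_le.1 hlt
      omega
    have h2 := this.trans h
    have : n + 1 ≤ n := by exact_mod_cast h2
    omega
  · intro h
    exact iInf₂_le n ((hP.hasResolution_iff n X).2 h)

theorem pdim_lt_top_iff (hP : IsResolving P) (X : ModuleCat.{u} R) :
    pdim P X < ⊤ ↔ ∃ n : ℕ, ResolvingSubcat.shift^[n] P X := by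
  constructor
  · intro h
    obtain ⟨n, hn⟩ := ENat.ne_top_iff_exists.1 h.ne
    exact ⟨n, (hP.pdim_le_iff n X).1 hn.symm.le⟩
  · rintro ⟨n, hn⟩
    exact ((hP.pdim_le_iff n X).2 hn).trans_lt (ENat.natCast_lt_top n)

theorem finDim_iff (hP : IsResolving P) (X : ModuleCat.{u} R) :
    finDim P X ↔ ∃ n : ℕ, ResolvingSubcat.shift^[n] P X := by
  rw [finDim, hP.pdim_lt_top_iff]
  exact ⟨fun h => h.2, fun ⟨n, hn⟩ => ⟨(hP.shift_iterate n).fg _ hn, n, hn⟩⟩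

end IsResolving

end Shift

/-! ### Multiplications factoring through a subcategory, and membership locally on the spectrum. -/

section Factor

variable {R : Type u} [CommRing R]
variable {X Y Z M : Type u} [AddCommGroup X] [Module R X] [AddCommGroup Y] [Module R Y]
  [AddCommGroup Z] [Module R Z] [AddCommGroup M] [Module R M]

/-- Multiplication by `s` on `X` factors through a module in `P`. -/
def Factors (P : ObjectProperty (ModuleCat.{u} R)) (X : Type u) [AddCommGroup X] [Module R X]
    (s : R) : Prop :=
  ∃ (M : ModuleCat.{u} R) (h : X →ₗ[R] M) (g : M →ₗ[R] X), P M ∧ ∀ x, g (h x) = s • x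

variable {P Q : ObjectProperty (ModuleCat.{u} R)}

theorem Factors.mono (h : P ≤ Q) {s : R} (hs : Factors P X s) : Factors Q X s := by
  obtain ⟨M, a, b, hM, hab⟩ := hs
  exact ⟨M, a, b, h _ hM, hab⟩

theorem Factors.trans {s t : R} {h : X →ₗ[R] Y} {g : Y →ₗ[R] X} (hgh : ∀ x, g (h x) = s • x)
    (ht : Factors P Y t) : Factors P X (s * t) := by
  obtain ⟨M, a, b, hM, hab⟩ := ht
  refine ⟨M, a ∘ₗ h, g ∘ₗ b, hM, fun x => ?_⟩
  simp [hab, hgh, smul_smul, mul_comm]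

theorem Factors.of_equiv (e : X ≃ₗ[R] Y) {s : R} (hs : Factors P X s) : Factors P Y s := by
  have := Factors.trans (X := Y) (s := 1) (h := e.symm.toLinearMap) (g := e.toLinearMap)
    (fun x => by simp) hs
  rwa [one_mul] at this

/-- The ideal of all scalars whose multiplication on `X` factors through a module in `P`. -/
def annFac (hP : IsResolving P) (X : Type u) [AddCommGroup X] [Module R X] : Ideal R where
  carrier := {s | Factors P X s}
  zero_mem' := ⟨ModuleCat.of R PUnit, 0, 0, hP.of_subsingleton, fun x => by simp⟩
  add_mem' := by
    rintro s t ⟨M, h, g, hM, hs⟩ ⟨N, h', g', hN, ht⟩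
    exact ⟨ModuleCat.of R (M × N), h.prod h', g.coprod g', hP.prod hM hN,
      fun x => by simp [hs, ht, add_smul]⟩
  smul_mem' := by
    rintro r s ⟨M, h, g, hM, hs⟩
    exact ⟨M, h, r • g, hM, fun x => by simp [hs, smul_smul]⟩

theorem one_mem_annFac_iff (hP : IsResolving P) : 1 ∈ annFac hP X ↔ P (ModuleCat.of R X) := by
  constructor
  · rintro ⟨M, h, g, hM, hs⟩
    exact hP.isAddClosed.retract h g (fun x => by simp [hs]) hM
  · intro h
    exact ⟨ModuleCat.of R X, LinearMap.id, LinearMap.id, h, fun x => by simp⟩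

/-- Pulling back along `N → Z` gives an extension `W` of `N` by `X` through which `t` on `Y`
factors. Pushing `W` out along `X → M` gives an extension of `N` by `M`, a module in `P` through
which `s` on `W` factors. -/
theorem Factors.ses_mid (hP : IsResolving P) {f : X →ₗ[R] Y} {g : Y →ₗ[R] Z} (h : SES f g)
    {s t : R} (hX : Factors P X s) (hZ : Factors P Z t) : Factors P Y (t * s) := by
  obtain ⟨N, a, b, hN, hab⟩ := hZ
  obtain ⟨M, c, d, hM, hcd⟩ := hX
  obtain ⟨W, i, p, q, hiq, hpi, hpq, -, -, hu⟩ := h.exists_pullback b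
  obtain ⟨l, hl1, hl2⟩ := hu (ModuleCat.of R Y) (t • LinearMap.id) (a ∘ₗ g)
    (fun y => by simp [hab])
  obtain ⟨W', i', j', q', hiq', hc', hq', -, hu'⟩ := hiq.exists_pushout c
  obtain ⟨m, hm1, hm2⟩ := hu' W (i ∘ₗ d) (s • LinearMap.id) (fun x => by simp [hcd])
  refine Factors.trans (Y := W) (h := l) (g := p) (fun y => by simp [hl1]) ?_
  exact ⟨W', j', m, hP.mid hiq' hM hN, fun w => by simp [hm2]⟩

/-- Adding a free summand to `M` makes the map to `Z` surjective, so that its kernel lies in `P`.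
The factorization of `s` on `Y` restricts to one of `s` on `X` through this kernel. -/
theorem Factors.ses_left_of_mem (hP : IsResolving P) {f : X →ₗ[R] Y} {g : Y →ₗ[R] Z}
    (h : SES f g) {s : R} (hY : Factors P Y s) (hZ : P (ModuleCat.of R Z)) : Factors P X s := by
  obtain ⟨M, c, d, hM, hcd⟩ := hY
  have := hP.finite _ hZ
  obtain ⟨n, φ, hφ⟩ := exists_free_cover (R := R) Z
  obtain ⟨ψ, hψ⟩ := exists_lift_of_free h.surj φ
  let e : M × (Fin n → R) →ₗ[R] Y := d.coprod ψ
  have he : Function.Surjective (g ∘ₗ e) := fun z => by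
    obtain ⟨y, rfl⟩ := hφ z
    exact ⟨(0, y), by simp [e, hψ]⟩
  have hK := hP.left (SES.ker he) (hP.prod hM (hP.free n)) hZ
  obtain ⟨l, hl⟩ := h.exists_lift (e ∘ₗ (LinearMap.ker (g ∘ₗ e)).subtype) (fun x => x.2)
  refine ⟨ModuleCat.of R (LinearMap.ker (g ∘ₗ e)),
    (LinearMap.inl R M (Fin n → R) ∘ₗ c ∘ₗ f).codRestrict _ ?_, l, hK, fun x => h.inj ?_⟩
  · intro x
    simp [e, hcd, h.comp_apply]
  · rw [hl]
    change d (c (f x)) + ψ 0 = _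
    simp [hcd]

/-- Replace `Z` by the module `N × Rⁿ` of `P` covering it. On the kernel of `b'` the scalar `t`
factors through `N × Rⁿ`, since `t - a' b'` maps into this kernel and equals `t` on it. The pullback
of `Y` and `N × Rⁿ` over `Z` then falls under `ses_mid`, and `X` under `ses_left_of_mem`. -/
theorem Factors.ses_left (hP : IsResolving P) {f : X →ₗ[R] Y} {g : Y →ₗ[R] Z} (h : SES f g)
    {s t : R} (hY : Factors P Y s) (hZ : Factors P Z t) (hfin : Module.Finite R Z) :
    Factors P X (s * t) := by
  obtain ⟨N, a, b, hN, hab⟩ := hZ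
  obtain ⟨n, φ, hφ⟩ := exists_free_cover (R := R) Z
  let b' : N × (Fin n → R) →ₗ[R] Z := b.coprod φ
  let a' : Z →ₗ[R] N × (Fin n → R) := LinearMap.inl R N (Fin n → R) ∘ₗ a
  have hab' : ∀ z, b' (a' z) = t • z := fun z => by simp [b', a', hab]
  have hb' : Function.Surjective b' := fun z => by
    obtain ⟨y, rfl⟩ := hφ z
    exact ⟨(0, y), by simp [b']⟩
  have hN' := hP.prod hN (hP.free n)
  have hker : Factors P (LinearMap.ker b') t :=
    ⟨ModuleCat.of R (N × (Fin n → R)), (LinearMap.ker b').subtype,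
      (t • LinearMap.id - a' ∘ₗ b').codRestrict _ (fun x => by simp [hab']), hN',
      fun x => Subtype.ext (by simp [LinearMap.mem_ker.1 x.2])⟩
  obtain ⟨W, _, _, _, _, h1, h2⟩ := h.exists_pullback_pair (SES.ker hb')
  exact Factors.ses_left_of_mem hP h1 (Factors.ses_mid hP h2 hker hY) hN'

/-- The finitely generated modules that belong to `P` after inverting some element of `S`, up to
direct summands. -/
def LocIn (P : ObjectProperty (ModuleCat.{u} R)) (S : Submonoid R) :
    ObjectProperty (ModuleCat.{u} R) :=
  fun X => Module.Finite R X ∧ ∃ s ∈ S, Factors P X s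

theorem LocIn.mono {S T : Submonoid R} (h : P ≤ Q) (hST : S ≤ T) : LocIn P S ≤ LocIn Q T := by
  rintro X ⟨hX, s, hs, hf⟩
  exact ⟨hX, s, hST hs, hf.mono h⟩

theorem IsResolving.le_locIn (hP : IsResolving P) (S : Submonoid R) : P ≤ LocIn P S :=
  fun X hX => ⟨hP.finite X hX, 1, S.one_mem, (one_mem_annFac_iff hP).2 hX⟩

theorem IsResolving.locIn (hP : IsResolving P) [IsNoetherianRing R] (S : Submonoid R) :
    IsResolving (LocIn P S) where
  fg _ h := h.1
  iso := by
    refine ⟨fun {X Y} e h => ?_⟩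
    obtain ⟨hX, s, hs, hf⟩ := h
    exact ⟨Module.Finite.equiv e.toLinearEquiv, s, hs, hf.of_equiv e.toLinearEquiv⟩
  self := hP.le_locIn S _ hP.self
  prod_iff X Y := by
    constructor
    · rintro ⟨hX, s, hs, hf⟩
      have hX' : Module.Finite R (X × Y) := hX
      refine ⟨⟨Module.Finite.of_surjective (LinearMap.fst R X Y) LinearMap.fst_surjective,
        1 * s, S.mul_mem S.one_mem hs,
        Factors.trans (h := LinearMap.inl R X Y) (g := LinearMap.fst R X Y) (by simp) hf⟩,
        ⟨Module.Finite.of_surjective (LinearMap.snd R X Y) LinearMap.snd_surjective,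
        1 * s, S.mul_mem S.one_mem hs,
        Factors.trans (h := LinearMap.inr R X Y) (g := LinearMap.snd R X Y) (by simp) hf⟩⟩
    · rintro ⟨⟨hX, s, hs, hf⟩, ⟨hY, t, ht, hg⟩⟩
      refine ⟨show Module.Finite R (X × Y) from inferInstance, t * s, S.mul_mem ht hs, ?_⟩
      exact Factors.ses_mid hP (SES.prod R X Y) hf hg
  mid_iff_left T hT h₃ := by
    have h := SES.of_shortExact hT
    obtain ⟨hZ, t, ht, hg⟩ := h₃
    constructor
    · rintro ⟨hY, s, hs, hf⟩
      exact ⟨Module.Finite.of_injective _ h.inj, s * t, S.mul_mem hs ht,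
        Factors.ses_left hP h hf hg hZ⟩
    · rintro ⟨hX, s, hs, hf⟩
      exact ⟨Module.Finite.of_exact h.exact h.surj, t * s, S.mul_mem ht hs,
        Factors.ses_mid hP h hf hg⟩

theorem mem_radical_annFac_iff (hP : IsResolving P) [Module.Finite R X] {s : R} :
    s ∈ (annFac hP X).radical ↔ LocIn P (Submonoid.powers s) (ModuleCat.of R X) := by
  constructor
  · rintro ⟨n, hn⟩
    exact ⟨‹_›, s ^ n, ⟨n, rfl⟩, hn⟩
  · rintro ⟨-, _, ⟨n, rfl⟩, hn⟩
    exact ⟨n, hn⟩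

/-- The modules that belong to `P` locally at `p`, up to direct summands. -/
abbrev LocAt (P : ObjectProperty (ModuleCat.{u} R)) (p : PrimeSpectrum R) :
    ObjectProperty (ModuleCat.{u} R) :=
  LocIn P p.asIdeal.primeCompl

theorem locAt_iff (hP : IsResolving P) [Module.Finite R X] (p : PrimeSpectrum R) :
    LocAt P p (ModuleCat.of R X) ↔ ¬ annFac hP X ≤ p.asIdeal := by
  rw [SetLike.not_le_iff_exists]
  constructor
  · rintro ⟨-, s, hs, hf⟩
    exact ⟨s, hf, hs⟩
  · rintro ⟨s, hf, hs⟩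
    exact ⟨‹_›, s, hs, hf⟩

theorem locAt_anti (P : ObjectProperty (ModuleCat.{u} R)) {p q : PrimeSpectrum R} (h : p ≤ q) :
    LocAt P q ≤ LocAt P p :=
  LocIn.mono le_rfl fun _ hs hp => hs (h hp)

/-- Membership in a resolving subcategory is a local property. -/
theorem IsResolving.of_forall_locAt (hP : IsResolving P) [Module.Finite R X]
    (h : ∀ p, LocAt P p (ModuleCat.of R X)) : P (ModuleCat.of R X) := by
  rw [← one_mem_annFac_iff hP, ← Ideal.eq_top_iff_one]
  by_contra hne
  obtain ⟨m, hm, hle⟩ := Ideal.exists_le_maximal _ hne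
  exact (locAt_iff hP ⟨m, hm.isPrime⟩).1 (h _) hle

theorem IsResolving.shift_of_forall_locAt [IsNoetherianRing R] (hP : IsResolving P) (n : ℕ)
    [Module.Finite R X] (h : ∀ p, ResolvingSubcat.shift^[n] (LocAt P p) (ModuleCat.of R X)) :
    ResolvingSubcat.shift^[n] P (ModuleCat.of R X) := by
  induction n generalizing X with
  | zero => exact hP.of_forall_locAt h
  | succ n ih =>
    obtain ⟨m, f, hf⟩ := exists_free_cover (R := R) X
    rw [hP.shift_iterate_succ_iff (SES.ker hf) (hP.free m)]
    refine ih fun p => ?_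
    rw [← (hP.locIn _).shift_iterate_succ_iff (SES.ker hf) ((hP.locIn _).free m)]
    exact h p

/-- For `n = 0` this is the complement of the closed set cut out by `annFac`; passing to a syzygy
lowers `n`. -/
theorem IsResolving.isOpen_shift_locAt [IsNoetherianRing R] (hP : IsResolving P) (n : ℕ)
    (X : Type u) [AddCommGroup X] [Module R X] [Module.Finite R X] :
    IsOpen {p | ResolvingSubcat.shift^[n] (LocAt P p) (ModuleCat.of R X)} := by
  induction n generalizing X with
  | zero =>
    have : {p | LocAt P p (ModuleCat.of R X)} =
        (PrimeSpectrum.zeroLocus (annFac hP X : Set R))ᶜ := by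
      ext p
      exact locAt_iff hP p
    change IsOpen {p | LocAt P p (ModuleCat.of R X)}
    rw [this]
    exact (PrimeSpectrum.isClosed_zeroLocus _).isOpen_compl
  | succ n ih =>
    obtain ⟨m, f, hf⟩ := exists_free_cover (R := R) X
    convert ih (LinearMap.ker f) using 3 with p
    exact (hP.locIn _).shift_iterate_succ_iff (SES.ker hf) ((hP.locIn _).free m) n

/-- Modules of finite dimension at every prime have finite dimension. -/
theorem IsResolving.exists_shift_of_forall [IsNoetherianRing R] (hP : IsResolving P)
    [Module.Finite R X] (h : ∀ p, ∃ n : ℕ, ResolvingSubcat.shift^[n] (LocAt P p) (ModuleCat.of R X)) :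
    ∃ n : ℕ, ResolvingSubcat.shift^[n] P (ModuleCat.of R X) := by
  let U : ℕ → Set (PrimeSpectrum R) :=
    fun n => {p | ResolvingSubcat.shift^[n] (LocAt P p) (ModuleCat.of R X)}
  have hmono : Monotone U := fun a b hab p hp => (hP.locIn _).shift_iterate_le hab _ hp
  -- The spectrum is quasi-compact, so one of the increasing open sets `U n` is everything.
  obtain ⟨n, hn⟩ := isCompact_univ.elim_directed_cover U (fun n => hP.isOpen_shift_locAt n X)
    (fun p _ => Set.mem_iUnion.2 (h p)) (Monotone.directed_le hmono)
  exact ⟨n, hP.shift_of_forall_locAt n fun p => hn (Set.mem_univ p)⟩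

end Factor

end ResolvingSubcat

namespace ResolvingSubcat

/-! ### Comparison of subcategories over `R` with subcategories over the local rings. -/

section Localize

variable {R : Type u} [CommRing R]
variable {X Y Z M : Type u} [AddCommGroup X] [Module R X] [AddCommGroup Y] [Module R Y]
  [AddCommGroup Z] [Module R Z] [AddCommGroup M] [Module R M]

/-- The local ring at `p`. -/
abbrev LocRing (p : PrimeSpectrum R) : Type u := Localization.AtPrime p.asIdeal

/-- The localization at `p` of an unbundled module. -/
noncomputable abbrev Loc (p : PrimeSpectrum R) (X : Type u) [AddCommGroup X] [Module R X] :
    ModuleCat.{u} (LocRing p) := locModule (ModuleCat.of R X) p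

noncomputable instance (p : PrimeSpectrum R) (X : ModuleCat.{u} R) : Module R (locModule X p) :=
  inferInstanceAs (Module R (X.localizedModule p.asIdeal.primeCompl))

instance (p : PrimeSpectrum R) (X : ModuleCat.{u} R) :
    IsScalarTower R (LocRing p) (locModule X p) :=
  inferInstanceAs (IsScalarTower R (Localization p.asIdeal.primeCompl)
    (X.localizedModule p.asIdeal.primeCompl))

/-- The canonical map to the localization. -/
noncomputable def locMk (p : PrimeSpectrum R) (X : Type u) [AddCommGroup X] [Module R X] :
    X →ₗ[R] Loc p X :=
  (ModuleCat.of R X).localizedModuleMkLinearMap p.asIdeal.primeCompl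

instance (p : PrimeSpectrum R) : IsLocalizedModule p.asIdeal.primeCompl (locMk p X) :=
  ModuleCat.localizedModule_isLocalizedModule _ _

/-- The map induced on localizations. -/
noncomputable def locMap (p : PrimeSpectrum R) (f : X →ₗ[R] Y) : Loc p X →ₗ[LocRing p] Loc p Y :=
  IsLocalizedModule.mapExtendScalars p.asIdeal.primeCompl (locMk p X) (locMk p Y) (LocRing p) f

@[simp]
theorem locMap_mk (p : PrimeSpectrum R) (f : X →ₗ[R] Y) (x : X) :
    locMap p f (locMk p X x) = locMk p Y (f x) := by
  simp [locMap]

theorem exists_smul_eq_locMk (p : PrimeSpectrum R) (y : Loc p X) :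
    ∃ (s : R) (x : X), s ∉ p.asIdeal ∧ s • y = locMk p X x := by
  obtain ⟨⟨x, s⟩, hx⟩ := IsLocalizedModule.surj p.asIdeal.primeCompl (locMk p X) y
  exact ⟨s, x, s.2, hx⟩

theorem locMk_eq_zero_iff {p : PrimeSpectrum R} {x : X} :
    locMk p X x = 0 ↔ ∃ s ∉ p.asIdeal, s • x = 0 := by
  rw [IsLocalizedModule.eq_zero_iff p.asIdeal.primeCompl]
  exact ⟨fun ⟨s, hs⟩ => ⟨s, s.2, hs⟩, fun ⟨s, hs, h⟩ => ⟨⟨s, hs⟩, h⟩⟩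

theorem smul_injective_of_notMem {p : PrimeSpectrum R} {V : Type u} [AddCommGroup V]
    [Module (LocRing p) V] [Module R V] [IsScalarTower R (LocRing p) V] {s : R}
    (hs : s ∉ p.asIdeal) {v w : V} (h : s • v = s • w) : v = w := by
  have hu : IsUnit (algebraMap R (LocRing p) s) :=
    IsLocalization.map_units (LocRing p) (⟨s, hs⟩ : p.asIdeal.primeCompl)
  rw [← algebraMap_smul (LocRing p) s v, ← algebraMap_smul (LocRing p) s w] at h
  exact hu.smul_left_cancel.1 h

/-- Linear maps over the local ring that agree on the image of the module are equal. -/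
theorem loc_hom_ext {p : PrimeSpectrum R} {V : Type u} [AddCommGroup V]
    [Module (LocRing p) V] {f g : Loc p X →ₗ[LocRing p] V}
    (h : ∀ x, f (locMk p X x) = g (locMk p X x)) : f = g := by
  let _ : Module R V := Module.compHom V (algebraMap R (LocRing p))
  have : IsScalarTower R (LocRing p) V := IsScalarTower.of_algebraMap_smul fun _ _ => rfl
  ext y
  obtain ⟨s, x, hs, hx⟩ := exists_smul_eq_locMk p y
  refine smul_injective_of_notMem hs ?_
  have e : ∀ k : Loc p X →ₗ[LocRing p] V, s • k y = k (s • y) := fun k => by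
    rw [← algebraMap_smul (LocRing p) s y, map_smul]; rfl
  rw [e, e, hx, h]

theorem SES.loc (p : PrimeSpectrum R) {f : X →ₗ[R] Y} {g : Y →ₗ[R] Z} (h : SES f g) :
    SES (locMap p f) (locMap p g) where
  inj := IsLocalizedModule.map_injective p.asIdeal.primeCompl (locMk p X) (locMk p Y) f h.inj
  exact := IsLocalizedModule.map_exact p.asIdeal.primeCompl (locMk p X) (locMk p Y) (locMk p Z)
    f g h.exact
  surj := IsLocalizedModule.map_surjective p.asIdeal.primeCompl (locMk p Y) (locMk p Z) g h.surj

/-- The localization is characterized by its universal property. -/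
theorem nonempty_loc_equiv (p : PrimeSpectrum R) {V : Type u} [AddCommGroup V]
    [Module (LocRing p) V] [Module R V] [IsScalarTower R (LocRing p) V] (i : X →ₗ[R] V)
    [IsLocalizedModule p.asIdeal.primeCompl i] :
    ∃ e : Loc p X ≃ₗ[LocRing p] V, ∀ x, e (locMk p X x) = i x :=
  ⟨(IsLocalizedModule.linearEquiv p.asIdeal.primeCompl (locMk p X) i).extendScalarsOfIsLocalization
    p.asIdeal.primeCompl (LocRing p), fun x =>
    IsLocalizedModule.linearEquiv_apply p.asIdeal.primeCompl (locMk p X) i x⟩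

instance (p : PrimeSpectrum R) [Module.Finite R X] : Module.Finite (LocRing p) (Loc p X) :=
  Module.Finite.of_isLocalizedModule p.asIdeal.primeCompl (locMk p X)

theorem loc_pi_equiv (p : PrimeSpectrum R) (n : ℕ) (X : Type u) [AddCommGroup X] [Module R X] :
    ∃ e : Loc p (Fin n → X) ≃ₗ[LocRing p] (Fin n → Loc p X),
      ∀ x, e (locMk p _ x) = fun i => locMk p X (x i) := by
  let i : (Fin n → X) →ₗ[R] (Fin n → Loc p X) := .pi fun i => locMk p X ∘ₗ .proj i
  have : IsLocalizedModule p.asIdeal.primeCompl i := inferInstance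
  exact nonempty_loc_equiv p i

theorem loc_prod_equiv (p : PrimeSpectrum R) :
    Nonempty (Loc p (X × Y) ≃ₗ[LocRing p] (Loc p X × Loc p Y)) := by
  let i : X × Y →ₗ[R] (Loc p X × Loc p Y) := (locMk p X).prodMap (locMk p Y)
  have : IsLocalizedModule p.asIdeal.primeCompl i := inferInstance
  exact ⟨(nonempty_loc_equiv p i).choose⟩

theorem loc_self_equiv (p : PrimeSpectrum R) :
    ∃ e : Loc p R ≃ₗ[LocRing p] LocRing p, ∀ x, e (locMk p R x) = algebraMap R _ x :=
  nonempty_loc_equiv p (Algebra.linearMap R (LocRing p))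

/-- Maps between localizations lift up to a denominator. -/
theorem exists_lift_loc [IsNoetherianRing R] [Module.Finite R X] {p : PrimeSpectrum R}
    (φ : Loc p X →ₗ[LocRing p] Loc p Y) :
    ∃ (f : X →ₗ[R] Y) (s : R), s ∉ p.asIdeal ∧ ∀ x, locMk p Y (f x) = s • φ (locMk p X x) := by
  have := Module.finitePresentation_of_finite R X
  obtain ⟨f, s, h⟩ := Module.FinitePresentation.exists_lift_of_isLocalizedModule
    p.asIdeal.primeCompl (locMk p Y) (φ.restrictScalars R ∘ₗ locMk p X)
  exact ⟨f, s, s.2, fun x => LinearMap.congr_fun h x⟩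

/-- A map from a finite module vanishing at `p` is killed by an element outside `p`. -/
theorem exists_smul_eq_zero_of_loc [Module.Finite R X] {p : PrimeSpectrum R} (f : X →ₗ[R] Y)
    (h : ∀ x, locMk p Y (f x) = 0) : ∃ s ∉ p.asIdeal, ∀ x, s • f x = 0 := by
  obtain ⟨n, π, hπ⟩ := exists_free_cover (R := R) X
  choose s hs hsx using fun i : Fin n => locMk_eq_zero_iff.1 (h (π (Pi.single i 1)))
  refine ⟨∏ i, s i, fun hm => ?_, fun x => ?_⟩
  · obtain ⟨i, -, hi⟩ := (p.isPrime.prod_mem_iff).1 hm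
    exact hs i hi
  · obtain ⟨y, rfl⟩ := hπ x
    have : ((∏ i, s i) • f ∘ₗ π) = 0 := by
      refine LinearMap.pi_ext' fun i => LinearMap.ext_ring ?_
      obtain ⟨c, hc⟩ := Finset.dvd_prod_of_mem s (Finset.mem_univ i)
      simp only [LinearMap.smul_apply, LinearMap.comp_apply, LinearMap.single_apply,
        LinearMap.zero_apply]
      rw [hc, mul_comm, mul_smul, hsx, smul_zero]
    exact LinearMap.congr_fun this y

variable {P : ObjectProperty (ModuleCat.{u} R)}

theorem sInf_objectProperty_iff {A : Type u} [CommRing A]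
    {T : Set (ObjectProperty (ModuleCat.{u} A))} {X : ModuleCat.{u} A} :
    sInf T X ↔ ∀ Q ∈ T, Q X := by
  simp [sInf_apply]

theorem add_iff {A : Type u} [CommRing A] {Q : ObjectProperty (ModuleCat.{u} A)}
    {X : ModuleCat.{u} A} : add Q X ↔ ∀ T, IsAddClosed T → Q ≤ T → T X := by
  rw [add, sInf_objectProperty_iff]
  exact ⟨fun h T h1 h2 => h T ⟨h1, h2⟩, fun h T hT => h T hT.1 hT.2⟩

theorem add_isAddClosed {A : Type u} [CommRing A] (Q : ObjectProperty (ModuleCat.{u} A)) :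
    IsAddClosed (add Q) := by
  refine ⟨⟨fun {X Y} e h => add_iff.2 fun T hT hle => ?_⟩, fun X Y => ⟨fun h => ⟨?_, ?_⟩,
    fun h => ?_⟩⟩
  · have := hT.iso
    exact T.prop_of_iso e (add_iff.1 h T hT hle)
  · exact add_iff.2 fun T hT hle => ((hT.prod_iff X Y).1 (add_iff.1 h T hT hle)).1
  · exact add_iff.2 fun T hT hle => ((hT.prod_iff X Y).1 (add_iff.1 h T hT hle)).2
  · exact add_iff.2 fun T hT hle =>
      (hT.prod_iff X Y).2 ⟨add_iff.1 h.1 T hT hle, add_iff.1 h.2 T hT hle⟩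

theorem addLoc_of_mem (p : PrimeSpectrum R) {X : ModuleCat.{u} R} (h : P X) :
    addLoc P p (locModule X p) :=
  add_iff.2 fun _ _ hle => hle _ ⟨X, h, ⟨Iso.refl _⟩⟩

/-- The modules in `addLoc P p` are the retracts of localizations of modules in `P`. -/
theorem addLoc_iff (hP : IsResolving P) (p : PrimeSpectrum R) (V : ModuleCat.{u} (LocRing p)) :
    addLoc P p V ↔ ∃ (M : ModuleCat.{u} R) (h : V →ₗ[LocRing p] locModule M p)
      (g : locModule M p →ₗ[LocRing p] V), P M ∧ ∀ v, g (h v) = v := by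
  constructor
  · intro h
    refine add_iff.1 h (fun V => ∃ (M : ModuleCat.{u} R) (h : V →ₗ[LocRing p] locModule M p)
      (g : locModule M p →ₗ[LocRing p] V), P M ∧ ∀ v, g (h v) = v) ⟨⟨?_⟩, ?_⟩ ?_
    · rintro V W e ⟨M, h, g, hM, hgh⟩
      exact ⟨M, h ∘ₗ e.toLinearEquiv.symm, e.toLinearEquiv ∘ₗ g, hM, fun v => by simp [hgh]⟩
    · intro V W
      constructor
      · rintro ⟨M, h, g, hM, hgh⟩
        exact ⟨⟨M, h ∘ₗ LinearMap.inl _ V W, LinearMap.fst _ V W ∘ₗ g, hM, fun v => by simp [hgh]⟩,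
          ⟨M, h ∘ₗ LinearMap.inr _ V W, LinearMap.snd _ V W ∘ₗ g, hM, fun v => by simp [hgh]⟩⟩
      · rintro ⟨⟨M, h, g, hM, hgh⟩, ⟨M', h', g', hM', hgh'⟩⟩
        obtain ⟨e⟩ := loc_prod_equiv (X := M) (Y := M') p
        exact ⟨ModuleCat.of R (M × M'), e.symm ∘ₗ h.prodMap h', g.prodMap g' ∘ₗ e,
          hP.prod hM hM', fun v => by simp [hgh, hgh']⟩
    · rintro V ⟨M, hM, ⟨e⟩⟩
      exact ⟨M, e.toLinearEquiv.symm, e.toLinearEquiv, hM, fun v => by simp⟩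
  · rintro ⟨M, h, g, hM, hgh⟩
    exact (add_isAddClosed _).retract h g hgh (addLoc_of_mem p hM)

/-- A retraction of `M_p` onto `X_p` lifts, after clearing denominators, to maps over `R` whose
composite is multiplication by an element outside `p`. Conversely such an element becomes invertible
at `p`. -/
theorem addLoc_loc_iff [IsNoetherianRing R] (hP : IsResolving P) (p : PrimeSpectrum R)
    [Module.Finite R X] : addLoc P p (Loc p X) ↔ LocAt P p (ModuleCat.of R X) := by
  rw [addLoc_iff hP]
  constructor
  · rintro ⟨M, h, g, hM, hgh⟩
    have : Module.Finite R M := hP.finite _ hM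
    obtain ⟨h', s, hs, hh⟩ := exists_lift_loc (X := X) (Y := M) h
    obtain ⟨g', t, ht, hg⟩ := exists_lift_loc (X := M) (Y := X) g
    obtain ⟨v, hv, hvx⟩ := exists_smul_eq_zero_of_loc (p := p)
      (g' ∘ₗ h' - (t * s) • LinearMap.id) (fun x => by
        have e : g (s • h (locMk p X x)) = s • locMk p X x := by
          rw [← algebraMap_smul (LocRing p) s, map_smul, hgh, algebraMap_smul]
        simp only [LinearMap.sub_apply, LinearMap.comp_apply, LinearMap.smul_apply,
          LinearMap.id_apply, map_sub, map_smul, hg, hh]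
        rw [e, smul_smul, sub_self])
    refine ⟨‹_›, v * (t * s), ?_, M, h', v • g', hM, fun x => ?_⟩
    · exact p.asIdeal.primeCompl.mul_mem hv (p.asIdeal.primeCompl.mul_mem ht hs)
    · have := hvx x
      simp only [LinearMap.sub_apply, LinearMap.comp_apply, LinearMap.smul_apply,
          LinearMap.id_apply, smul_sub, sub_eq_zero] at this
      rw [LinearMap.smul_apply, this, smul_smul]
  · rintro ⟨-, s, hs, M, h, g, hM, hgh⟩
    obtain ⟨u, hu⟩ : IsUnit (algebraMap R (LocRing p) s) :=
      IsLocalization.map_units (LocRing p) (⟨s, hs⟩ : p.asIdeal.primeCompl)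
    refine ⟨M, locMap p h, (↑u⁻¹ : LocRing p) • locMap p g, hM, fun v => ?_⟩
    have : locMap p g ∘ₗ locMap p h = algebraMap R (LocRing p) s • LinearMap.id :=
      loc_hom_ext fun x => by
        simp only [LinearMap.comp_apply, locMap_mk, hgh, LinearMap.smul_apply, LinearMap.id_apply,
          map_smul, algebraMap_smul]
    have := LinearMap.congr_fun this v
    rw [LinearMap.comp_apply] at this
    rw [LinearMap.smul_apply, this, LinearMap.smul_apply, LinearMap.id_apply, smul_smul, ← hu,
      Units.inv_mul, one_smul]

/-- Elements outside `p` already act invertibly on `V`, so `V` is the localization of `U`. -/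
theorem isLocalizedModule_subtype (p : PrimeSpectrum R) {V : Type u} [AddCommGroup V]
    [Module (LocRing p) V] [Module R V] [IsScalarTower R (LocRing p) V] (U : Submodule R V)
    (hU : ∀ v, ∃ s ∉ p.asIdeal, s • v ∈ U) :
    IsLocalizedModule p.asIdeal.primeCompl U.subtype where
  map_units s := by
    have hu := IsLocalization.map_units (LocRing p) s
    have := hu.map (algebraMap (LocRing p) (Module.End (LocRing p) V))
    rw [Module.End.isUnit_iff] at this ⊢
    convert this using 1
    ext v
    simp
  surj v := by
    obtain ⟨s, hs, h⟩ := hU v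
    exact ⟨(⟨s • v, h⟩, ⟨s, hs⟩), rfl⟩
  exists_of_eq {x y} h := ⟨1, by rw [Subtype.ext h]⟩

/-- Short exact sequences of finite modules over the local ring come from short exact sequences
over `R`. -/
theorem SES.exists_global (p : PrimeSpectrum R) {A B D : Type u} [AddCommGroup A]
    [Module (LocRing p) A] [AddCommGroup B] [Module (LocRing p) B] [AddCommGroup D]
    [Module (LocRing p) D] [Module.Finite (LocRing p) B] {f : A →ₗ[LocRing p] B}
    {g : B →ₗ[LocRing p] D} (h : SES f g) :
    ∃ (X Y Z : ModuleCat.{u} R) (f' : X →ₗ[R] Y) (g' : Y →ₗ[R] Z), SES f' g' ∧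
      Module.Finite R Y ∧ Nonempty (locModule X p ≃ₗ[LocRing p] A) ∧
      Nonempty (locModule Y p ≃ₗ[LocRing p] B) ∧ Nonempty (locModule Z p ≃ₗ[LocRing p] D) := by
  let _ : Module R A := Module.compHom A (algebraMap R (LocRing p))
  have : IsScalarTower R (LocRing p) A := IsScalarTower.of_algebraMap_smul fun _ _ => rfl
  let _ : Module R B := Module.compHom B (algebraMap R (LocRing p))
  have : IsScalarTower R (LocRing p) B := IsScalarTower.of_algebraMap_smul fun _ _ => rfl
  let _ : Module R D := Module.compHom D (algebraMap R (LocRing p))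
  have : IsScalarTower R (LocRing p) D := IsScalarTower.of_algebraMap_smul fun _ _ => rfl
  obtain ⟨T, hT⟩ := Module.Finite.fg_top (R := LocRing p) (M := B)
  let f₀ : A →ₗ[R] B := f.restrictScalars R
  let g₀ : B →ₗ[R] D := g.restrictScalars R
  -- The `R`-lattice spanned by finitely many generators of `B`. Together with its preimage in `A`
  -- and its image in `D` it forms the sequence over `R`.
  let U : Submodule R B := Submodule.span R T
  have hU : ∀ v, ∃ s ∉ p.asIdeal, s • v ∈ U := by
    intro v
    have hv : v ∈ Submodule.span (LocRing p) (T : Set B) := hT ▸ Submodule.mem_top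
    induction hv using Submodule.span_induction with
    | mem x hx => exact ⟨1, p.asIdeal.primeCompl.one_mem, by
        rw [one_smul]; exact Submodule.subset_span hx⟩
    | zero => exact ⟨1, p.asIdeal.primeCompl.one_mem, by simp⟩
    | add x y _ _ hx hy =>
      obtain ⟨s, hs, hs'⟩ := hx
      obtain ⟨t, ht, ht'⟩ := hy
      refine ⟨s * t, p.asIdeal.primeCompl.mul_mem hs ht, ?_⟩
      rw [smul_add]
      refine U.add_mem ?_ ?_
      · rw [mul_comm, mul_smul]; exact U.smul_mem _ hs'
      · rw [mul_smul]; exact U.smul_mem _ ht'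
    | smul a x _ hx =>
      obtain ⟨s, hs, hs'⟩ := hx
      obtain ⟨⟨r, t⟩, hr⟩ := IsLocalization.surj p.asIdeal.primeCompl a
      refine ⟨t * s, p.asIdeal.primeCompl.mul_mem t.2 hs, ?_⟩
      have : ((t : R) * s) • a • x = r • s • x := by
        rw [← algebraMap_smul (LocRing p) ((t : R) * s), ← algebraMap_smul (LocRing p) r,
          ← algebraMap_smul (LocRing p) s, smul_smul, smul_smul]
        dsimp only at hr
        rw [← hr, map_mul]
        congr 1
        ring
      rw [this]
      exact U.smul_mem _ hs'
  have l1 := isLocalizedModule_subtype p (U.comap f₀) (fun v => by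
    obtain ⟨s, hs, h⟩ := hU (f v)
    exact ⟨s, hs, by rw [Submodule.mem_comap, map_smul]; exact h⟩)
  have l2 := isLocalizedModule_subtype p U hU
  have l3 := isLocalizedModule_subtype p (U.map g₀) (fun v => by
    obtain ⟨b, rfl⟩ := h.surj v
    obtain ⟨s, hs, h⟩ := hU b
    exact ⟨s, hs, s • b, h, map_smul g₀ s b⟩)
  refine ⟨ModuleCat.of R (U.comap f₀), ModuleCat.of R U, ModuleCat.of R (U.map g₀),
    f₀.restrict (fun x hx => hx), g₀.restrict (fun x hx => ⟨x, hx, rfl⟩), ⟨?_, ?_, ?_⟩,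
    Module.Finite.iff_fg.2 ⟨T, rfl⟩,
    ⟨(nonempty_loc_equiv p (U.comap f₀).subtype).choose⟩,
    ⟨(nonempty_loc_equiv p U.subtype).choose⟩, ⟨(nonempty_loc_equiv p (U.map g₀).subtype).choose⟩⟩
  · intro a b hab
    exact Subtype.ext (h.inj (congrArg Subtype.val hab))
  · intro y
    constructor
    · intro hy
      obtain ⟨x, hx⟩ := h.exists_preimage (y := y.1) (congrArg Subtype.val hy)
      refine ⟨⟨x, ?_⟩, Subtype.ext hx⟩
      change f x ∈ U
      rw [hx]; exact y.2
    · rintro ⟨x, rfl⟩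
      exact Subtype.ext (h.comp_apply x.1)
  · rintro ⟨_, y, hy, rfl⟩
    exact ⟨⟨y, hy⟩, rfl⟩

/-- A short exact sequence over the local ring descends to one over `R` by `exists_global`, where
the claim is that `LocAt P p` is resolving. Descent needs a finitely generated middle term, which is
checked separately in each direction. -/
theorem IsResolving.addLoc [IsNoetherianRing R] (hP : IsResolving P) (p : PrimeSpectrum R) :
    IsResolving (addLoc P p) := by
  have hfg : ResolvingSubcat.addLoc P p ≤ ModuleCat.isFG _ := by
    intro V hV
    obtain ⟨M, h, g, hM, hgh⟩ := (addLoc_iff hP p V).1 hV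
    have : Module.Finite R M := hP.finite M hM
    have : Module.Finite (LocRing p) (Loc p M) := inferInstance
    exact Module.Finite.of_surjective (M := Loc p M) g fun v => ⟨h v, hgh v⟩
  have hadd : IsAddClosed (ResolvingSubcat.addLoc P p) := add_isAddClosed _
  refine ⟨hfg, hadd.iso, ?_, hadd.prod_iff, fun S hS h₃ => ?_⟩
  · obtain ⟨e, -⟩ := loc_self_equiv p
    exact hadd.of_equiv e (addLoc_of_mem p hP.self)
  · have h := SES.of_shortExact hS
    have key : Module.Finite (LocRing p) S.X₂ →
        (ResolvingSubcat.addLoc P p S.X₂ ↔ ResolvingSubcat.addLoc P p S.X₁) := by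
      intro hfin
      obtain ⟨X, Y, Z, f', g', hs, hY, ⟨e₁⟩, ⟨e₂⟩, ⟨e₃⟩⟩ := h.exists_global p
      have : Module.Finite R X := Module.Finite.of_injective f' hs.inj
      have : Module.Finite R Z := Module.Finite.of_surjective g' hs.surj
      have hZ := (addLoc_loc_iff (X := Z) hP p).1 (hadd.of_equiv e₃.symm h₃)
      have hXY := (hP.locIn _).mid_iff hs hZ
      constructor
      · intro h2
        exact hadd.of_equiv e₁ ((addLoc_loc_iff (X := X) hP p).2
          (hXY.1 ((addLoc_loc_iff (X := Y) hP p).1 (hadd.of_equiv e₂.symm h2))))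
      · intro h1
        exact hadd.of_equiv e₂ ((addLoc_loc_iff (X := Y) hP p).2
          (hXY.2 ((addLoc_loc_iff (X := X) hP p).1 (hadd.of_equiv e₁.symm h1))))
    constructor
    · intro h2
      exact (key (hfg _ h2)).1 h2
    · intro h1
      have : Module.Finite (LocRing p) S.X₁ := hfg _ h1
      have : Module.Finite (LocRing p) S.X₃ := hfg _ h₃
      exact (key (Module.Finite.of_exact h.exact h.surj)).2 h1

theorem shift_addLoc_iff [IsNoetherianRing R] (hP : IsResolving P) (p : PrimeSpectrum R) (n : ℕ)
    (X : Type u) [AddCommGroup X] [Module R X] [Module.Finite R X] :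
    shift^[n] (addLoc P p) (Loc p X) ↔ shift^[n] (LocAt P p) (ModuleCat.of R X) := by
  induction n generalizing X with
  | zero => exact addLoc_loc_iff hP p
  | succ n ih =>
    obtain ⟨m, f, hf⟩ := exists_free_cover (R := R) X
    have hs := SES.ker hf
    rw [(hP.locIn _).shift_iterate_succ_iff hs ((hP.locIn _).free m), ← ih]
    exact (hP.addLoc p).shift_iterate_succ_iff (hs.loc p) (addLoc_of_mem p (hP.free m)) n

theorem pdim_addLoc_le_iff [IsNoetherianRing R] (hP : IsResolving P) (p : PrimeSpectrum R) (n : ℕ)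
    (X : ModuleCat.{u} R) [Module.Finite R X] :
    pdim (addLoc P p) (locModule X p) ≤ n ↔ shift^[n] (LocAt P p) X := by
  rw [(hP.addLoc p).pdim_le_iff]
  exact shift_addLoc_iff hP p n X

end Localize

end ResolvingSubcat

namespace ResolvingSubcat

open Abelian

/-! ### Vanishing of `Ext` into `C` along short exact sequences. -/

section ExtVanishing

variable {R : Type u} [CommRing R]
variable {X Y Z M : Type u} [AddCommGroup X] [Module R X] [AddCommGroup Y] [Module R Y]
  [AddCommGroup Z] [Module R Z] [AddCommGroup M] [Module R M]

/-- `Extⁱ(X, C) = 0`. -/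
abbrev ExtZero (C : ModuleCat.{u} R) (X : Type u) [AddCommGroup X] [Module R X] (i : ℕ) : Prop :=
  Subsingleton (Ext (ModuleCat.of R X) C i)

/-- `Extⁱ(X, C) = 0` for all `i > k`. -/
def ExtVanish (C : ModuleCat.{u} R) (X : Type u) [AddCommGroup X] [Module R X] (k : ℕ) : Prop :=
  ∀ i, k < i → ExtZero C X i

variable {C : ModuleCat.{u} R}

theorem ExtZero.eq_zero {i : ℕ} (h : ExtZero C X i) (e : Ext (ModuleCat.of R X) C i) : e = 0 :=
  Subsingleton.elim _ _

theorem ExtVanish.mono {k l : ℕ} (h : ExtVanish C X k) (hkl : k ≤ l) : ExtVanish C X l :=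
  fun i hi => h i (hkl.trans_lt hi)

variable {f : X →ₗ[R] Y} {g : Y →ₗ[R] Z}

namespace SES

theorem extZero_mid (h : SES f g) {i : ℕ} (hX : ExtZero C X i) (hZ : ExtZero C Z i) :
    ExtZero C Y i := by
  refine subsingleton_of_forall_eq 0 fun e => ?_
  obtain ⟨e', rfl⟩ := Ext.contravariant_sequence_exact₂ h.shortExact C e (hX.eq_zero _)
  rw [hZ.eq_zero e', Ext.comp_zero]

theorem extZero_left (h : SES f g) {i : ℕ} (hY : ExtZero C Y i) (hZ : ExtZero C Z (i + 1)) :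
    ExtZero C X i := by
  refine subsingleton_of_forall_eq 0 fun e => ?_
  obtain ⟨e', rfl⟩ := Ext.contravariant_sequence_exact₁ h.shortExact C e (add_comm 1 i)
    (hZ.eq_zero _)
  rw [hY.eq_zero e', Ext.comp_zero]

theorem exists_connecting (h : SES f g) {i : ℕ} (hY : ExtZero C Y (i + 1))
    (e : Ext (ModuleCat.of R Z) C (i + 1)) :
    ∃ e' : Ext (ModuleCat.of R X) C i, h.shortExact.extClass.comp e' (add_comm 1 i) = e :=
  Ext.contravariant_sequence_exact₃ h.shortExact C e (hY.eq_zero _) (add_comm 1 i)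

theorem connecting_injective (h : SES f g) {i : ℕ} (hY : ExtZero C Y i)
    {e : Ext (ModuleCat.of R X) C i} (he : h.shortExact.extClass.comp e (add_comm 1 i) = 0) :
    e = 0 := by
  obtain ⟨e', rfl⟩ := Ext.contravariant_sequence_exact₁ h.shortExact C e (add_comm 1 i) he
  rw [hY.eq_zero e', Ext.comp_zero]

theorem extZero_right (h : SES f g) {i : ℕ} (hX : ExtZero C X i) (hY : ExtZero C Y (i + 1)) :
    ExtZero C Z (i + 1) := by
  refine subsingleton_of_forall_eq 0 fun e => ?_
  obtain ⟨e', rfl⟩ := h.exists_connecting hY e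
  rw [hX.eq_zero e', Ext.comp_zero]

/-- If `Ext¹(Z, C) = 0`, maps from `X` to `C` extend to `Y`. -/
theorem exists_extend (h : SES f g) (hZ : ExtZero C Z 1) (φ : X →ₗ[R] C) :
    ∃ ψ : Y →ₗ[R] C, ∀ x, ψ (f x) = φ x := by
  obtain ⟨e, he⟩ := Ext.contravariant_sequence_exact₁ h.shortExact C
    (Ext.mk₀ (ModuleCat.ofHom φ)) (add_zero 1) (hZ.eq_zero _)
  obtain ⟨ψ, rfl⟩ := Ext.homEquiv₀.symm.surjective e
  change (Ext.mk₀ (ModuleCat.ofHom f)).comp (Ext.mk₀ ψ) (zero_add 0) = _ at he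
  rw [Ext.mk₀_comp_mk₀] at he
  have := (Ext.mk₀_bijective _ _).1 he
  exact ⟨ψ.hom, fun x => congrArg (fun k => k.hom x) this⟩

theorem exists_extend_pi (h : SES f g) (hZ : ExtZero C Z 1) {n : ℕ} (φ : X →ₗ[R] (Fin n → C)) :
    ∃ ψ : Y →ₗ[R] (Fin n → C), ∀ x, ψ (f x) = φ x := by
  choose ψ hψ using fun i => h.exists_extend hZ (LinearMap.proj i ∘ₗ φ)
  exact ⟨LinearMap.pi ψ, fun x => funext fun i => hψ i x⟩

theorem extZero_one_of_exists_extend (h : SES f g) (hY : ExtZero C Y 1)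
    (hext : ∀ φ : X →ₗ[R] C, ∃ ψ : Y →ₗ[R] C, ∀ x, ψ (f x) = φ x) : ExtZero C Z 1 := by
  refine subsingleton_of_forall_eq 0 fun e => ?_
  obtain ⟨e', rfl⟩ := h.exists_connecting hY e
  obtain ⟨φ, rfl⟩ := Ext.homEquiv₀.symm.surjective e'
  obtain ⟨ψ, hψ⟩ := hext φ.hom
  have : φ = ModuleCat.ofHom f ≫ ModuleCat.ofHom ψ := by
    ext x; exact (hψ x).symm
  change h.shortExact.extClass.comp (Ext.mk₀ φ) _ = 0
  rw [this, ← Ext.mk₀_comp_mk₀]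
  exact h.shortExact.extClass_comp_assoc (Ext.mk₀ (ModuleCat.ofHom ψ)) (h := add_comm 1 0)

end SES

theorem extZero_free (n : ℕ) {i : ℕ} (hi : 0 < i) : ExtZero C (Fin n → R) i := by
  obtain ⟨i, rfl⟩ := Nat.exists_eq_succ_of_ne_zero hi.ne'
  exact Ext.subsingleton_of_projective _ _ _

theorem extVanish_free (n : ℕ) : ExtVanish C (Fin n → R) 0 := fun _ hi => extZero_free n hi

/-- If multiplication by `s` on `X` factors through a module with vanishing `Ext`, it annihilates
the `Ext` of `X`. -/
theorem smul_ext_eq_zero {i : ℕ} {s : R} {h : X →ₗ[R] Y} {g : Y →ₗ[R] X}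
    (hgh : ∀ x, g (h x) = s • x) (hY : ExtZero C Y i) (e : Ext (ModuleCat.of R X) C i) :
    s • e = 0 := by
  have h1 : ModuleCat.ofHom h ≫ ModuleCat.ofHom g = s • 𝟙 (ModuleCat.of R X) := by
    ext x; exact hgh x
  have h2 : s • e = (Ext.mk₀ (s • 𝟙 (ModuleCat.of R X))).comp e (zero_add i) := by
    rw [Ext.mk₀_smul, Ext.smul_comp, Ext.mk₀_id_comp]
  rw [h2, ← h1, ← Ext.mk₀_comp_mk₀_assoc, hY.eq_zero ((Ext.mk₀ (ModuleCat.ofHom g)).comp e _),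
    Ext.comp_zero]

theorem ExtZero.retract {i : ℕ} {h : X →ₗ[R] Y} {g : Y →ₗ[R] X}
    (hgh : ∀ x, g (h x) = x) (hY : ExtZero C Y i) : ExtZero C X i :=
  subsingleton_of_forall_eq 0 fun e => by
    have := smul_ext_eq_zero (s := 1) (h := h) (g := g) (by simpa using hgh) hY e
    rwa [one_smul] at this

theorem ExtZero.of_equiv {i : ℕ} (e : X ≃ₗ[R] Y) (h : ExtZero C X i) : ExtZero C Y i :=
  ExtZero.retract (h := e.symm.toLinearMap) (g := e.toLinearMap) (by simp) h

theorem ExtZero.prod {i : ℕ} (hX : ExtZero C X i) (hY : ExtZero C Y i) : ExtZero C (X × Y) i :=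
  (SES.prod R X Y).extZero_mid hX hY

theorem ExtZero.pi {i : ℕ} (hX : ExtZero C X i) (n : ℕ) : ExtZero C (Fin n → X) i := by
  induction n with
  | zero =>
    have h0 : Subsingleton (Fin 0 → X) := inferInstance
    exact ExtZero.retract (Y := X) (h := 0) (g := 0) (fun x => Subsingleton.elim _ _) hX
  | succ n ih => exact (hX.prod ih).of_equiv (Fin.consLinearEquiv R (fun _ => X))

theorem ExtVanish.shift {f : X →ₗ[R] Y} {g : Y →ₗ[R] Z} (h : SES f g) (hY : ExtVanish C Y 0)
    {k : ℕ} (hX : ExtVanish C X k) : ExtVanish C Z (k + 1) := by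
  intro i hi
  obtain ⟨i, rfl⟩ := Nat.exists_eq_succ_of_ne_zero (show i ≠ 0 by omega)
  exact h.extZero_right (hX i (by omega)) (hY _ (by omega))

theorem ExtVanish.unshift {f : X →ₗ[R] Y} {g : Y →ₗ[R] Z} (h : SES f g) (hY : ExtVanish C Y 0)
    {k : ℕ} (hZ : ExtVanish C Z (k + 1)) : ExtVanish C X k := fun i hi =>
  h.extZero_left (hY i (by omega)) (hZ _ (by omega))

end ExtVanishing

/-! ### Totally `C`-reflexive modules form a resolving subcategory. -/

section TotallyReflexive

variable {R : Type u} [CommRing R]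
variable {X Y Z M : Type u} [AddCommGroup X] [Module R X] [AddCommGroup Y] [Module R Y]
  [AddCommGroup Z] [Module R Z] [AddCommGroup M] [Module R M]
variable {C : ModuleCat.{u} R}

/-- The evaluation map to the bidual. -/
abbrev evMap (C : ModuleCat.{u} R) (X : Type u) [AddCommGroup X] [Module R X] :
    X →ₗ[R] (X →ₗ[R] C) →ₗ[R] C := LinearMap.applyₗ

theorem SES.dual_exact {f : X →ₗ[R] Y} {g : Y →ₗ[R] Z} (h : SES f g) (φ : Y →ₗ[R] C)
    (hφ : ∀ x, φ (f x) = 0) : ∃ ψ : Z →ₗ[R] C, ψ ∘ₗ g = φ := by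
  obtain ⟨ψ, hψ⟩ := h.exists_desc φ hφ
  exact ⟨ψ, LinearMap.ext hψ⟩

/-- The dual of a short exact sequence is short exact if maps to `C` extend. -/
theorem SES.dual {f : X →ₗ[R] Y} {g : Y →ₗ[R] Z} (h : SES f g)
    (hext : ∀ φ : X →ₗ[R] C, ∃ ψ : Y →ₗ[R] C, ∀ x, ψ (f x) = φ x) :
    SES (LinearMap.lcomp R C g) (LinearMap.lcomp R C f) where
  inj a b hab := by
    ext z
    obtain ⟨y, rfl⟩ := h.surj z
    exact LinearMap.congr_fun hab y
  exact φ := by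
    constructor
    · intro hφ
      exact h.dual_exact φ fun x => LinearMap.congr_fun hφ x
    · rintro ⟨ψ, rfl⟩
      ext x
      simp [h.comp_apply]
  surj φ := by
    obtain ⟨ψ, hψ⟩ := hext φ
    exact ⟨ψ, LinearMap.ext hψ⟩

theorem ev_lcomp (f : X →ₗ[R] Y) (x : X) :
    evMap C Y (f x) = LinearMap.lcomp R C (LinearMap.lcomp R C f) (evMap C X x) := rfl

theorem IsTotallyReflexive.of_equiv (e : X ≃ₗ[R] Y) (h : IsTotallyReflexive C (ModuleCat.of R X)) :
    IsTotallyReflexive C (ModuleCat.of R Y) := by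
  have := h.fg
  have hd : (X →ₗ[R] C) ≃ₗ[R] (Y →ₗ[R] C) := LinearEquiv.congrLeft C R e
  refine ⟨Module.Finite.equiv e, fun i hi => ExtZero.of_equiv e (h.ext i hi),
    fun i hi => ExtZero.of_equiv hd (h.ext_dual i hi), ?_⟩
  have e1 : Function.Injective (LinearMap.lcomp R C e.toLinearMap) := fun a b hab => by
    ext y
    obtain ⟨x, rfl⟩ := e.surjective y
    exact LinearMap.congr_fun hab x
  have e2 : Function.Surjective (LinearMap.lcomp R C e.toLinearMap) := fun φ =>
    ⟨φ ∘ₗ e.symm.toLinearMap, by ext x; simp⟩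
  constructor
  · intro a b hab
    obtain ⟨a, rfl⟩ := e.surjective a
    obtain ⟨b, rfl⟩ := e.surjective b
    congr 1
    apply h.reflexive.1
    ext φ
    obtain ⟨ψ, rfl⟩ := e2 φ
    exact LinearMap.congr_fun hab ψ
  · intro Φ
    obtain ⟨x, hx⟩ := h.reflexive.2 (Φ ∘ₗ LinearMap.lcomp R C e.symm.toLinearMap)
    refine ⟨e x, ?_⟩
    ext φ
    have := LinearMap.congr_fun hx (LinearMap.lcomp R C e.toLinearMap φ)
    change φ (e x) = _ at this
    change φ (e x) = _
    rw [this]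
    change Φ _ = _
    congr 1
    ext y
    simp

theorem IsTotallyReflexive.mid [IsNoetherianRing R] {f : X →ₗ[R] Y} {g : Y →ₗ[R] Z} (h : SES f g)
    (hX : IsTotallyReflexive C (ModuleCat.of R X)) (hZ : IsTotallyReflexive C (ModuleCat.of R Z)) :
    IsTotallyReflexive C (ModuleCat.of R Y) := by
  have := hX.fg
  have := hZ.fg
  have hd := h.dual (h.exists_extend (hZ.ext 1 one_pos))
  refine ⟨Module.Finite.of_exact h.exact h.surj,
    fun i hi => h.extZero_mid (hX.ext i hi) (hZ.ext i hi),
    fun i hi => hd.extZero_mid (hZ.ext_dual i hi) (hX.ext_dual i hi), ?_, ?_⟩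
  · refine (injective_iff_map_eq_zero _).2 fun y hy => ?_
    have hz : g y = 0 := hZ.reflexive.1 (by
      rw [map_zero]
      ext φ
      exact LinearMap.congr_fun hy (φ ∘ₗ g))
    obtain ⟨x, rfl⟩ := h.exists_preimage hz
    have : x = 0 := hX.reflexive.1 (by
      rw [map_zero]
      ext φ
      obtain ⟨ψ, rfl⟩ := hd.surj φ
      exact LinearMap.congr_fun hy ψ)
    rw [this, map_zero]
  · intro Φ
    obtain ⟨z, hz⟩ := hZ.reflexive.2 (Φ ∘ₗ LinearMap.lcomp R C g)
    obtain ⟨y, rfl⟩ := h.surj z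
    obtain ⟨Ψ, hΨ⟩ := hd.dual_exact (Φ - evMap C Y y) (fun φ => by
      have := LinearMap.congr_fun hz φ
      rw [LinearMap.sub_apply, sub_eq_zero]
      exact this.symm)
    obtain ⟨x, rfl⟩ := hX.reflexive.2 Ψ
    refine ⟨y + f x, ?_⟩
    rw [map_add]
    have : evMap C Y (f x) = Φ - evMap C Y y := by rw [ev_lcomp, ← hΨ]; rfl
    change evMap C Y y + evMap C Y (f x) = Φ
    rw [this, add_sub_cancel]

/-- The point beyond dimension shifting is `Ext¹(X†, C) = 0`: every map `Z† → C` is evaluation at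
some `z`, and evaluation at a preimage of `z` in `Y` extends it to `Y†`. -/
theorem IsTotallyReflexive.left [IsNoetherianRing R] {f : X →ₗ[R] Y} {g : Y →ₗ[R] Z} (h : SES f g)
    (hY : IsTotallyReflexive C (ModuleCat.of R Y)) (hZ : IsTotallyReflexive C (ModuleCat.of R Z)) :
    IsTotallyReflexive C (ModuleCat.of R X) := by
  have := hY.fg
  have hd := h.dual (h.exists_extend (hZ.ext 1 one_pos))
  have hext : ∀ Φ : (Z →ₗ[R] C) →ₗ[R] C, ∃ Ψ : (Y →ₗ[R] C) →ₗ[R] C,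
      ∀ φ, Ψ (LinearMap.lcomp R C g φ) = Φ φ := fun Φ => by
    obtain ⟨z, rfl⟩ := hZ.reflexive.2 Φ
    obtain ⟨y, rfl⟩ := h.surj z
    exact ⟨evMap C Y y, fun φ => rfl⟩
  refine ⟨Module.Finite.of_injective f h.inj,
    fun i hi => h.extZero_left (hY.ext i hi) (hZ.ext _ (by omega)), fun i hi => ?_, ?_, ?_⟩
  · obtain ⟨i, rfl⟩ := Nat.exists_eq_succ_of_ne_zero hi.ne'
    rcases i with _ | i
    · exact hd.extZero_one_of_exists_extend (hY.ext_dual 1 one_pos) hext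
    · exact hd.extZero_right (hZ.ext_dual _ (by omega)) (hY.ext_dual _ (by omega))
  · refine (injective_iff_map_eq_zero _).2 fun x hx => h.inj (hY.reflexive.1 ?_)
    rw [map_zero, map_zero]
    ext φ
    exact LinearMap.congr_fun hx (φ ∘ₗ f)
  · intro Φ
    obtain ⟨y, hy⟩ := hY.reflexive.2 (Φ ∘ₗ LinearMap.lcomp R C f)
    have hz : g y = 0 := hZ.reflexive.1 (by
      rw [map_zero]
      ext φ
      have := LinearMap.congr_fun hy (φ ∘ₗ g)
      change φ (g y) = Φ (LinearMap.lcomp R C f (LinearMap.lcomp R C g φ)) at this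
      change φ (g y) = 0
      rw [this, hd.comp_apply, map_zero])
    obtain ⟨x, rfl⟩ := h.exists_preimage hz
    refine ⟨x, ?_⟩
    ext φ
    obtain ⟨ψ, rfl⟩ := hd.surj φ
    exact LinearMap.congr_fun hy ψ

theorem IsTotallyReflexive.fst (h : IsTotallyReflexive C (ModuleCat.of R (X × Y))) :
    IsTotallyReflexive C (ModuleCat.of R X) := by
  have hfg : Module.Finite R (X × Y) := h.fg
  refine ⟨Module.Finite.of_surjective (LinearMap.fst R X Y) LinearMap.fst_surjective,
    fun i hi => ExtZero.retract (h := LinearMap.inl R X Y) (g := LinearMap.fst R X Y) (by simp)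
      (h.ext i hi),
    fun i hi => ExtZero.retract (h := LinearMap.lcomp R C (LinearMap.fst R X Y))
      (g := LinearMap.lcomp R C (LinearMap.inl R X Y)) (fun φ => by ext x; simp)
      (h.ext_dual i hi), ?_, ?_⟩
  · refine (injective_iff_map_eq_zero _).2 fun x hx =>
      LinearMap.inl_injective (R := R) (M := X) (M₂ := Y) (h.reflexive.1 ?_)
    rw [map_zero, map_zero]
    ext φ
    exact LinearMap.congr_fun hx (φ ∘ₗ LinearMap.inl R X Y)
  · intro Φ
    obtain ⟨w, hw⟩ := h.reflexive.2 (Φ ∘ₗ LinearMap.lcomp R C (LinearMap.inl R X Y))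
    refine ⟨w.1, ?_⟩
    ext φ
    have := LinearMap.congr_fun hw (φ ∘ₗ LinearMap.fst R X Y)
    change φ w.1 = _ at this
    change φ w.1 = _
    rw [this]
    change Φ _ = _
    congr 1

theorem isTotallyReflexive_prod_iff [IsNoetherianRing R] :
    IsTotallyReflexive C (ModuleCat.of R (X × Y)) ↔
      IsTotallyReflexive C (ModuleCat.of R X) ∧ IsTotallyReflexive C (ModuleCat.of R Y) :=
  ⟨fun h => ⟨h.fst, (h.of_equiv (LinearEquiv.prodComm R X Y)).fst⟩,
    fun h => h.1.mid (SES.prod R X Y) h.2⟩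

variable (hC : IsSemidualizing C)
include hC

theorem IsSemidualizing.self_equiv : Nonempty (R ≃ₗ[R] (C →ₗ[R] C)) :=
  ⟨LinearEquiv.ofBijective _ hC.homothety⟩

theorem IsSemidualizing.exists_smul (φ : C →ₗ[R] C) : ∃ r : R, ∀ c, φ c = r • c := by
  obtain ⟨r, rfl⟩ := hC.homothety.2 φ
  exact ⟨r, fun _ => rfl⟩

theorem IsSemidualizing.eq_zero_of_smul {r : R} (h : ∀ c : C, r • c = 0) : r = 0 :=
  hC.homothety.1 (by rw [map_zero]; exact LinearMap.ext h)

/-- Duality exchanges `C` and `R`, because `C† ≅ R` by the homothety isomorphism and `R† ≅ C`. The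
same exchange gives `isTotallyReflexive_self`. -/
theorem IsSemidualizing.isTotallyReflexive : IsTotallyReflexive C C := by
  obtain ⟨e⟩ := hC.self_equiv
  refine ⟨hC.fg, hC.ext, fun i hi => ?_, ?_, ?_⟩
  · refine ExtZero.of_equiv e ?_
    exact (extZero_free 1 hi).of_equiv (LinearEquiv.funUnique (Fin 1) R R)
  · intro a b hab
    exact LinearMap.congr_fun hab LinearMap.id
  · intro Φ
    refine ⟨Φ LinearMap.id, ?_⟩
    ext φ
    obtain ⟨r, rfl⟩ := hC.homothety.2 φ
    change r • Φ LinearMap.id = _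
    rw [← map_smul]
    rfl

theorem IsSemidualizing.isTotallyReflexive_self : IsTotallyReflexive C (ModuleCat.of R R) := by
  refine ⟨Module.Finite.self R, fun i hi => ?_, fun i hi => ?_, ?_, ?_⟩
  · exact (extZero_free 1 hi).of_equiv (LinearEquiv.funUnique (Fin 1) R R)
  · exact ExtZero.of_equiv (LinearMap.ringLmapEquivSelf R R C).symm (hC.ext i hi)
  · refine (injective_iff_map_eq_zero _).2 fun r hr => hC.eq_zero_of_smul fun c => ?_
    have := LinearMap.congr_fun hr (LinearMap.toSpanSingleton R C c)
    change r • c = 0 at this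
    exact this
  · intro Φ
    obtain ⟨r, hr⟩ := hC.exists_smul (Φ ∘ₗ (LinearMap.ringLmapEquivSelf R R C).symm.toLinearMap)
    refine ⟨r, ?_⟩
    ext φ
    have := hr (φ 1)
    have e : (LinearMap.ringLmapEquivSelf R R C).symm (φ 1) = φ := by ext; simp
    rw [LinearMap.comp_apply, LinearEquiv.coe_coe, e] at this
    rw [this]
    change φ r = _
    rw [← map_smul, smul_eq_mul, mul_one]

theorem isResolving_GC [IsNoetherianRing R] : IsResolving (GC C) where
  fg _ h := h.fg
  iso := ⟨fun {X Y} e h => IsTotallyReflexive.of_equiv (X := X) (Y := Y) e.toLinearEquiv h⟩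
  self := hC.isTotallyReflexive_self
  prod_iff _ _ := isTotallyReflexive_prod_iff
  mid_iff_left _ hS h₃ :=
    ⟨fun h => IsTotallyReflexive.left (SES.of_shortExact hS) h h₃,
      fun h => IsTotallyReflexive.mid (SES.of_shortExact hS) h h₃⟩

omit hC in
theorem GC_extVanish {X : ModuleCat.{u} R} (h : GC C X) : ExtVanish C X 0 := h.ext

/-- Totally reflexive modules embed into powers of `C` with totally reflexive cokernel. -/
theorem IsTotallyReflexive.exists_ses [IsNoetherianRing R]
    (hX : IsTotallyReflexive C (ModuleCat.of R X)) :
    ∃ (n : ℕ) (W : ModuleCat.{u} R) (f : X →ₗ[R] (Fin n → C)) (g : (Fin n → C) →ₗ[R] W),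
      SES f g ∧ GC C W := by
  have := hX.fg
  have := hC.fg
  obtain ⟨n, π, hπ⟩ := exists_free_cover (R := R) (X →ₗ[R] C)
  -- The components of `f` generate `X†`, so every map `X → C` extends along `f`.
  let f : X →ₗ[R] (Fin n → C) := LinearMap.pi fun i => π (Pi.single i 1)
  have hext : ∀ φ : X →ₗ[R] C, ∃ ψ : (Fin n → C) →ₗ[R] C, ∀ x, ψ (f x) = φ x := by
    intro φ
    obtain ⟨a, rfl⟩ := hπ φ
    refine ⟨∑ i, a i • LinearMap.proj i, fun x => ?_⟩
    have : π a = ∑ i, a i • π (Pi.single i 1) := by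
      conv_lhs => rw [pi_eq_sum_univ' a]
      simp only [map_sum, map_smul]
    rw [this]
    simp [f]
  have hf : Function.Injective f := by
    refine (injective_iff_map_eq_zero _).2 fun x hx => hX.reflexive.1 ?_
    rw [map_zero]
    ext φ
    obtain ⟨ψ, hψ⟩ := hext φ
    change φ x = 0
    rw [← hψ, hx, map_zero]
  have h := SES.coker hf
  have hCn : IsTotallyReflexive C (ModuleCat.of R (Fin n → C)) :=
    (isResolving_GC hC).pi n hC.isTotallyReflexive
  have hd := h.dual hext
  -- The bidual sequence is exact because `Ext¹(X†, C) = 0`. Comparing it with the original one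
  -- makes the cokernel reflexive, as `X` and the power of `C` are.
  have hdd := hd.dual (hd.exists_extend (hX.ext_dual 1 one_pos))
  refine ⟨n, ModuleCat.of R _, f, _, h, inferInstance, fun i hi => ?_, fun i hi => ?_, ?_, ?_⟩
  · obtain ⟨i, rfl⟩ := Nat.exists_eq_succ_of_ne_zero hi.ne'
    rcases i with _ | i
    · exact h.extZero_one_of_exists_extend (hCn.ext 1 one_pos) hext
    · exact h.extZero_right (hX.ext _ (by omega)) (hCn.ext _ (by omega))
  · exact hd.extZero_left (hCn.ext_dual i hi) (hX.ext_dual _ (by omega))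
  · refine (injective_iff_map_eq_zero _).2 fun w hw => ?_
    obtain ⟨c, rfl⟩ := h.surj w
    obtain ⟨Φ, hΦ⟩ := hdd.exists_preimage (y := evMap C _ c) hw
    obtain ⟨x, rfl⟩ := hX.reflexive.2 Φ
    have : f x = c := hCn.reflexive.1 hΦ
    rw [← this, h.comp_apply]
  · intro Φ
    obtain ⟨Ψ, rfl⟩ := hdd.surj Φ
    obtain ⟨c, rfl⟩ := hCn.reflexive.2 Ψ
    exact ⟨_, rfl⟩

omit hC in
/-- A class of modules with vanishing `Ext` to `C` that is cogenerated by totally reflexive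
modules consists of totally reflexive modules. -/
theorem le_GC_of_cogenerated (Q : ObjectProperty (ModuleCat.{u} R))
    (hfg : ∀ X, Q X → Module.Finite R X) (hext : ∀ X : ModuleCat.{u} R, Q X → ExtVanish C X 0)
    (hcog : ∀ X : ModuleCat.{u} R, Q X → ∃ (A W : ModuleCat.{u} R) (f : X →ₗ[R] A)
      (g : A →ₗ[R] W), SES f g ∧ GC C A ∧ Q W) : Q ≤ GC C := by
  have hinj : ∀ X : ModuleCat.{u} R, Q X → Function.Injective (evMap C X) := by
    intro X hX
    obtain ⟨A, W, f, g, h, hA, -⟩ := hcog X hX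
    refine (injective_iff_map_eq_zero _).2 fun x hx => h.inj (hA.reflexive.1 ?_)
    rw [map_zero, map_zero]
    ext φ
    exact LinearMap.congr_fun hx (φ ∘ₗ f)
  -- Surjectivity for `X` uses injectivity for the cokernel `W`, which is why injectivity is first
  -- settled on all of `Q`.
  have hsurj : ∀ X : ModuleCat.{u} R, Q X → Function.Surjective (evMap C X) := by
    intro X hX Φ
    obtain ⟨A, W, f, g, h, hA, hW⟩ := hcog X hX
    obtain ⟨y, hy⟩ := hA.reflexive.2 (Φ ∘ₗ LinearMap.lcomp R C f)
    have hd := h.dual (h.exists_extend (hext W hW 1 one_pos))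
    have hz : g y = 0 := hinj W hW (by
      rw [map_zero]
      ext φ
      have := LinearMap.congr_fun hy (φ ∘ₗ g)
      change φ (g y) = Φ (LinearMap.lcomp R C f (LinearMap.lcomp R C g φ)) at this
      change φ (g y) = 0
      rw [this, hd.comp_apply, map_zero])
    obtain ⟨x, rfl⟩ := h.exists_preimage hz
    refine ⟨x, ?_⟩
    ext φ
    obtain ⟨ψ, rfl⟩ := hd.surj φ
    exact LinearMap.congr_fun hy ψ
  -- Degree one uses surjectivity of evaluation for `W`. A higher degree for `X` comes from the
  -- degree below for `W`.
  have hdual : ∀ i, ∀ X : ModuleCat.{u} R, Q X → ExtZero C (X →ₗ[R] C) (i + 1) := by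
    intro i
    induction i with
    | zero =>
      intro X hX
      obtain ⟨A, W, f, g, h, hA, hW⟩ := hcog X hX
      have hd := h.dual (h.exists_extend (hext W hW 1 one_pos))
      refine hd.extZero_one_of_exists_extend (hA.ext_dual 1 one_pos) fun Φ => ?_
      obtain ⟨w, rfl⟩ := hsurj W hW Φ
      obtain ⟨a, rfl⟩ := h.surj w
      exact ⟨evMap C A a, fun φ => rfl⟩
    | succ i ih =>
      intro X hX
      obtain ⟨A, W, f, g, h, hA, hW⟩ := hcog X hX
      have hd := h.dual (h.exists_extend (hext W hW 1 one_pos))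
      exact hd.extZero_right (ih W hW) (hA.ext_dual _ (by omega))
  intro X hX
  refine ⟨hfg X hX, hext X hX, fun i hi => ?_, hinj X hX, hsurj X hX⟩
  obtain ⟨i, rfl⟩ := Nat.exists_eq_succ_of_ne_zero hi.ne'
  exact hdual i X hX

end TotallyReflexive

end ResolvingSubcat

namespace ResolvingSubcat

open Abelian

/-! ### Thick subcategories of `G_C`: cogeneration by powers of `C`, and dimension via `Ext`. -/

section Thick

variable {R : Type u} [CommRing R]
variable {X Y Z K W : Type u} [AddCommGroup X] [Module R X] [AddCommGroup Y] [Module R Y]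
  [AddCommGroup Z] [Module R Z] [AddCommGroup K] [Module R K] [AddCommGroup W] [Module R W]
variable {C : ModuleCat.{u} R} {M N : ObjectProperty (ModuleCat.{u} R)}

/-- The quotients by the members of a chain of submodules. -/
theorem SES.exists_comp {a : X →ₗ[R] Y} {b : Y →ₗ[R] Z} {c : Y →ₗ[R] K} {d : K →ₗ[R] W}
    (h : SES a b) (h' : SES c d) :
    ∃ (D : ModuleCat.{u} R) (j : K →ₗ[R] D) (i : Z →ₗ[R] D) (q : D →ₗ[R] W),
      SES (c ∘ₗ a) j ∧ SES i q := by
  obtain ⟨D, i, j, q, hiq, hc, hq, hex, -⟩ := h'.exists_pushout b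
  refine ⟨D, j, i, q, ⟨h'.inj.comp h.inj, fun y => ⟨fun hy => ?_, ?_⟩, fun w => ?_⟩, hiq⟩
  · obtain ⟨m, rfl⟩ := h'.exists_preimage (y := y) (by rw [← hq, hy, map_zero])
    rw [hc] at hy
    obtain ⟨x, rfl⟩ := h.exists_preimage (hiq.inj (hy.trans (map_zero i).symm))
    exact ⟨x, rfl⟩
  · rintro ⟨x, rfl⟩
    rw [LinearMap.comp_apply, hc, h.comp_apply, map_zero]
  · obtain ⟨z, y, rfl⟩ := hex w
    obtain ⟨m, rfl⟩ := h.surj z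
    exact ⟨c m + y, by rw [map_add, hc]⟩

/-- The modules in `M` embed into powers of `C` with cokernel in `M`. -/
def PowCogenerated (C : ModuleCat.{u} R) (M : ObjectProperty (ModuleCat.{u} R)) : Prop :=
  ∀ X : ModuleCat.{u} R, M X → ∃ (n : ℕ) (W : ModuleCat.{u} R) (f : X →ₗ[R] (Fin n → C))
    (g : (Fin n → C) →ₗ[R] W), SES f g ∧ M W

/-- Push out `Y` and the power of `C` under `X`. The result is an extension of `W` by `Y`, hence in
`M`, and an extension of `Z` by a power of `C`, which splits because `Ext¹(Z, C) = 0`. So `Z` is a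
direct summand of a module in `M`. -/
theorem PowCogenerated.right (hM : IsResolving M) (hcog : PowCogenerated C M)
    {f : X →ₗ[R] Y} {g : Y →ₗ[R] Z} (h : SES f g) (hX : M (ModuleCat.of R X))
    (hY : M (ModuleCat.of R Y)) (hZ : ExtZero C Z 1) : M (ModuleCat.of R Z) := by
  obtain ⟨n, W, f', g', h', hW⟩ := hcog _ hX
  obtain ⟨D, i, q, j, q', h1, h2⟩ := h.exists_pushout_pair h'
  have hD := hM.mid h2 hY hW
  obtain ⟨r, hr⟩ := h1.exists_extend_pi hZ LinearMap.id
  obtain ⟨e⟩ := h1.exists_equiv_of_retraction r hr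
  exact ((hM.prod_iff (ModuleCat.of R (Fin n → C)) (ModuleCat.of R Z)).1 (hM.of_equiv e hD)).2

theorem mem_thickGC_of_cogenerated (hM : IsResolving M) (hle : M ≤ GC C) (hMC : M C)
    (hcog : PowCogenerated C M) : M ∈ thickGC C :=
  ⟨⟨hM, hle, fun _ hS h₁ h₂ h₃ => hcog.right hM (SES.of_shortExact hS) h₁ h₂ (h₃.ext 1 one_pos)⟩,
    hMC⟩

theorem thickGC_cogenerated [IsNoetherianRing R] (hC : IsSemidualizing C) (hM : M ∈ thickGC C) :
    PowCogenerated C M := by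
  intro X hX
  obtain ⟨n, W, f, g, h, hW⟩ := (hM.1.le X hX).exists_ses hC (X := X)
  exact ⟨n, W, f, g, h, hM.1.right _ h.shortExact hX (hM.1.resolving.pi n hM.2) hW⟩

/-- Taking `k` syzygies turns `Extᵏ⁺¹` into `Ext¹`, and then `PowCogenerated.right` applies to a
first syzygy sequence. -/
theorem thickGC_of_shift [IsNoetherianRing R] (hC : IsSemidualizing C) (hM : M ∈ thickGC C)
    (k : ℕ) (hX : shift^[k + 1] M (ModuleCat.of R X)) (hext : ExtZero C X (k + 1)) :
    shift^[k] M (ModuleCat.of R X) := by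
  have hr := hM.1.resolving
  induction k generalizing X with
  | zero =>
    obtain ⟨n, f, hf, hK⟩ := hX
    exact (thickGC_cogenerated hC hM).right hr (SES.ker hf) hK (hr.free n) hext
  | succ k ih =>
    have := shift_finite (Function.iterate_succ_apply' shift (k + 1) M ▸ hX)
    obtain ⟨n, f, hf⟩ := exists_free_cover (R := R) X
    rw [hr.shift_iterate_succ_iff (SES.ker hf) (hr.free n)] at hX ⊢
    exact ih hX ((SES.ker hf).extZero_left (extZero_free n (Nat.succ_pos k)) hext)

theorem extVanish_of_shift (hle : M ≤ GC C) (k : ℕ)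
    (hX : shift^[k] M (ModuleCat.of R X)) : ExtVanish C X k := by
  induction k generalizing X with
  | zero => exact GC_extVanish (hle _ hX)
  | succ k ih =>
    rw [Function.iterate_succ_apply'] at hX
    obtain ⟨n, f, hf, hK⟩ := hX
    exact ExtVanish.shift (SES.ker hf) (extVanish_free n) (ih hK)

/-- For modules of finite dimension, the dimension is detected by the vanishing of `Ext`. -/
theorem thickGC_shift_iff [IsNoetherianRing R] (hC : IsSemidualizing C) (hM : M ∈ thickGC C)
    {n : ℕ} (hX : shift^[n] M (ModuleCat.of R X)) (k : ℕ) :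
    shift^[k] M (ModuleCat.of R X) ↔ ExtVanish C X k := by
  refine ⟨extVanish_of_shift hM.1.le k, fun hext => ?_⟩
  have key : ∀ l, shift^[k + l] M (ModuleCat.of R X) → shift^[k] M (ModuleCat.of R X) := by
    intro l
    induction l with
    | zero => exact id
    | succ l ih => exact fun h => ih (thickGC_of_shift hC hM (k + l) h (hext _ (by omega)))
  exact key n (hM.1.resolving.shift_iterate_le (by omega) _ hX)

theorem GC_mem_thickGC [IsNoetherianRing R] (hC : IsSemidualizing C) : GC C ∈ thickGC C :=
  ⟨⟨isResolving_GC hC, le_rfl, fun _ _ _ _ h => h⟩, hC.isTotallyReflexive⟩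

/-- A thick subcategory consists of the totally reflexive modules of finite dimension. -/
theorem thickGC_iff_GC [IsNoetherianRing R] (hC : IsSemidualizing C) (hM : M ∈ thickGC C)
    {n : ℕ} (hX : shift^[n] M (ModuleCat.of R X)) :
    M (ModuleCat.of R X) ↔ GC C (ModuleCat.of R X) :=
  ⟨fun h => hM.1.le _ h, fun h => (thickGC_shift_iff hC hM hX 0).2 (GC_extVanish h)⟩

theorem isResolving_sInf {T : Set (ObjectProperty (ModuleCat.{u} R))} (hT : T.Nonempty)
    (h : ∀ Q ∈ T, IsResolving Q) : IsResolving (sInf T) where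
  fg X hX := by
    obtain ⟨Q, hQ⟩ := hT
    exact (h Q hQ).fg X (sInf_objectProperty_iff.1 hX Q hQ)
  iso := ⟨fun {X Y} e hX => sInf_objectProperty_iff.2 fun Q hQ => by
    have := (h Q hQ).iso
    exact Q.prop_of_iso e (sInf_objectProperty_iff.1 hX Q hQ)⟩
  self := sInf_objectProperty_iff.2 fun Q hQ => (h Q hQ).self
  prod_iff X Y := by
    simp only [sInf_objectProperty_iff]
    exact ⟨fun hXY => ⟨fun Q hQ => (((h Q hQ).prod_iff X Y).1 (hXY Q hQ)).1,
      fun Q hQ => (((h Q hQ).prod_iff X Y).1 (hXY Q hQ)).2⟩,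
      fun hXY Q hQ => ((h Q hQ).prod_iff X Y).2 ⟨hXY.1 Q hQ, hXY.2 Q hQ⟩⟩
  mid_iff_left S hS h₃ := by
    simp only [sInf_objectProperty_iff] at h₃ ⊢
    exact ⟨fun h₂ Q hQ => ((h Q hQ).mid_iff_left S hS (h₃ Q hQ)).1 (h₂ Q hQ),
      fun h₁ Q hQ => ((h Q hQ).mid_iff_left S hS (h₃ Q hQ)).2 (h₁ Q hQ)⟩

theorem minThick_isLeast [IsNoetherianRing R] (hC : IsSemidualizing C) :
    IsLeast (thickGC C) (minThick C) := by
  have hne : (thickGC C).Nonempty := ⟨_, GC_mem_thickGC hC⟩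
  refine ⟨⟨⟨isResolving_sInf hne fun Q hQ => hQ.1.resolving,
    sInf_le (GC_mem_thickGC hC), fun S hS h₁ h₂ h₃ => ?_⟩, ?_⟩, fun Q hQ => sInf_le hQ⟩
  · exact sInf_objectProperty_iff.2 fun Q hQ => hQ.1.right S hS
      (sInf_objectProperty_iff.1 h₁ Q hQ) (sInf_objectProperty_iff.1 h₂ Q hQ) h₃
  · exact sInf_objectProperty_iff.2 fun Q hQ => hQ.2

end Thick

/-! ### Localization of thick subcategories, and the identification of `S(C)`. -/

section LocalizeThick

variable {R : Type u} [CommRing R] [IsNoetherianRing R]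
variable {X Y Z : Type u} [AddCommGroup X] [Module R X] [AddCommGroup Y] [Module R Y]
  [AddCommGroup Z] [Module R Z]
variable {C : ModuleCat.{u} R} {M N : ObjectProperty (ModuleCat.{u} R)}

omit [IsNoetherianRing R] in
theorem loc_free_equiv (p : PrimeSpectrum R) (n : ℕ) :
    Nonempty (Loc p (Fin n → R) ≃ₗ[LocRing p] (Fin n → LocRing p)) := by
  obtain ⟨e, -⟩ := loc_pi_equiv p n R
  obtain ⟨e', -⟩ := loc_self_equiv p
  exact ⟨e.trans (LinearEquiv.piCongrRight fun _ => e')⟩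

omit [IsNoetherianRing R] in
theorem exists_unit_inv (p : PrimeSpectrum R) {s : R} (hs : s ∉ p.asIdeal) :
    ∃ t : LocRing p, t * algebraMap R (LocRing p) s = 1 := by
  obtain ⟨u, hu⟩ : IsUnit (algebraMap R (LocRing p) s) :=
    IsLocalization.map_units (LocRing p) (⟨s, hs⟩ : p.asIdeal.primeCompl)
  exact ⟨↑u⁻¹, by rw [← hu, Units.inv_mul]⟩

/-- The vanishing of `Ext` localizes. -/
theorem ExtVanish.loc (p : PrimeSpectrum R) [Module.Finite R X] (h : ExtVanish C X 0) :
    ExtVanish (locModule C p) (Loc p X) 0 := by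
  have hF : ∀ n i, ExtZero (locModule C p) (Loc p (Fin n → R)) (i + 1) := fun n i => by
    obtain ⟨e⟩ := loc_free_equiv p n
    exact (extZero_free n (Nat.succ_pos i)).of_equiv e.symm
  have key : ∀ i, ∀ (X : Type u) [AddCommGroup X] [Module R X] [Module.Finite R X],
      ExtVanish C X 0 → ExtZero (locModule C p) (Loc p X) (i + 1) := by
    intro i
    induction i with
    | zero =>
      intro X _ _ _ h
      obtain ⟨n, f, hf⟩ := exists_free_cover (R := R) X
      have hs := SES.ker hf
      refine (hs.loc p).extZero_one_of_exists_extend (hF n 0) fun φ => ?_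
      -- Up to a denominator `φ` comes from a map over `R`, which extends because `Ext¹(X, C) = 0`;
      -- the denominator is divided out afterwards.
      obtain ⟨k, s, hsp, hk⟩ := exists_lift_loc (X := LinearMap.ker f) (Y := C) φ
      obtain ⟨ψ, hψ⟩ := hs.exists_extend (h 1 one_pos) k
      obtain ⟨t, ht⟩ := exists_unit_inv p hsp
      refine ⟨t • locMap p ψ, fun x => ?_⟩
      have : (t • locMap p ψ) ∘ₗ locMap p (LinearMap.ker f).subtype = φ :=
        loc_hom_ext fun x => by
          rw [LinearMap.comp_apply, locMap_mk, LinearMap.smul_apply, locMap_mk, hψ]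
          refine (congrArg (t • ·) (hk x)).trans ?_
          change t • (s • φ (locMk p _ x)) = _
          rw [← algebraMap_smul (LocRing p) s, smul_smul, ht, one_smul]
      exact LinearMap.congr_fun this x
    | succ i ih =>
      intro X _ _ _ h
      obtain ⟨n, f, hf⟩ := exists_free_cover (R := R) X
      have hs := SES.ker hf
      exact (hs.loc p).extZero_right
        (ih _ (ExtVanish.unshift hs (extVanish_free n) (h.mono (Nat.zero_le 1)))) (hF n _)
  intro i hi
  obtain ⟨i, rfl⟩ := Nat.exists_eq_succ_of_ne_zero hi.ne'
  exact key i X h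

theorem IsSemidualizing.loc (hC : IsSemidualizing C) (p : PrimeSpectrum R) :
    IsSemidualizing (locModule C p) := by
  have := hC.fg
  refine ⟨inferInstanceAs (Module.Finite (LocRing p) (Loc p C)),
    ExtVanish.loc (X := C) p (fun i hi => hC.ext i hi), ?_, ?_⟩
  · refine (injective_iff_map_eq_zero _).2 fun a ha => ?_
    obtain ⟨⟨r, s⟩, hr⟩ := IsLocalization.surj p.asIdeal.primeCompl a
    dsimp only at hr
    have h0 : ∀ c : C, locMk p C (LinearMap.lsmul R C r c) = 0 := fun c => by
      have h1 : a • locMk p C c = 0 := LinearMap.congr_fun ha (locMk p C c)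
      rw [LinearMap.lsmul_apply, map_smul, ← algebraMap_smul (LocRing p) r, ← hr, mul_comm,
        mul_smul]
      exact (congrArg _ h1).trans (smul_zero _)
    obtain ⟨t, ht, htc⟩ := exists_smul_eq_zero_of_loc _ h0
    have h2 : t * r = 0 := hC.eq_zero_of_smul fun c => by rw [mul_smul]; exact htc c
    have hs := IsLocalization.map_units (LocRing p) s
    have ht' : IsUnit (algebraMap R (LocRing p) t) :=
      IsLocalization.map_units (LocRing p) (⟨t, ht⟩ : p.asIdeal.primeCompl)
    have h3 : algebraMap R (LocRing p) r = 0 := by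
      rw [← ht'.mul_right_eq_zero, ← map_mul, h2, map_zero]
    rw [h3] at hr
    exact (hs.mul_left_eq_zero).1 hr
  · intro φ
    obtain ⟨k, s, hs, hk⟩ := exists_lift_loc (X := C) (Y := C) φ
    obtain ⟨r, hr⟩ := hC.exists_smul k
    obtain ⟨t, ht⟩ := exists_unit_inv p hs
    refine ⟨t * algebraMap R (LocRing p) r, loc_hom_ext (X := C) fun c => ?_⟩
    have h1 := hk c
    rw [hr, map_smul] at h1
    change (t * algebraMap R (LocRing p) r) • locMk p C c = φ (locMk p C c)
    rw [mul_smul, algebraMap_smul, h1, ← algebraMap_smul (LocRing p) s, smul_smul, ht, one_smul]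

/-- Applying `le_GC_of_cogenerated` to the class of all localizations avoids comparing duals before
and after localization: only the vanishing of `Ext(X, C)` and the embeddings into powers of `C` have
to be localized. -/
theorem GC_loc (hC : IsSemidualizing C) (p : PrimeSpectrum R) {X : ModuleCat.{u} R} (hX : GC C X) :
    GC (locModule C p) (locModule X p) := by
  refine le_GC_of_cogenerated (C := locModule C p)
    (fun V => ∃ X : ModuleCat.{u} R, GC C X ∧ V = locModule X p) ?_ ?_ ?_ _ ⟨X, hX, rfl⟩
  · rintro V ⟨X, hX, rfl⟩
    have := hX.fg
    exact inferInstanceAs (Module.Finite (LocRing p) (Loc p X))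
  · rintro V ⟨X, hX, rfl⟩
    have := hX.fg
    exact ExtVanish.loc (X := X) p (GC_extVanish hX)
  · rintro V ⟨X, hX, rfl⟩
    obtain ⟨n, W, f, g, h, hW⟩ := IsTotallyReflexive.exists_ses (X := X) hC hX
    obtain ⟨e, -⟩ := loc_pi_equiv p n C
    exact ⟨_, _, _, _, h.loc p, (isResolving_GC (hC.loc p)).of_equiv e.symm
      ((isResolving_GC (hC.loc p)).pi n (hC.loc p).isTotallyReflexive), W, hW, rfl⟩

/-- A summand `V` of `L_p` embeds through `L_p` into a power of `C_p`. The cokernel is an extension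
of `W_p` by the complementary summand of `V`, hence in `add M_p`. -/
theorem thickGC_addLoc (hC : IsSemidualizing C) (p : PrimeSpectrum R) (hM : M ∈ thickGC C) :
    addLoc M p ∈ thickGC (locModule C p) := by
  have hr := hM.1.resolving
  have hG := isResolving_GC (hC.loc p)
  refine mem_thickGC_of_cogenerated (hr.addLoc p) ?_ (addLoc_of_mem p hM.2) ?_
  · intro V hV
    exact add_iff.1 hV _ hG.isAddClosed (by
      rintro V ⟨X, hX, ⟨e⟩⟩
      exact hG.of_equiv e.toLinearEquiv (GC_loc hC p (hM.1.le X hX)))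
  · intro V hV
    obtain ⟨L, a, b, hL, hab⟩ := (addLoc_iff hr p V).1 hV
    have hs := SES.coker (f := a) (Function.LeftInverse.injective hab)
    obtain ⟨e⟩ := hs.exists_equiv_of_retraction b hab
    have hQ := (((hr.addLoc p).prod_iff V (ModuleCat.of _ _)).1
      ((hr.addLoc p).of_equiv e (addLoc_of_mem p hL))).2
    obtain ⟨n, W, f, g, h, hW⟩ := thickGC_cogenerated hC hM L hL
    obtain ⟨e', -⟩ := loc_pi_equiv p n C
    have h' : SES (e'.toLinearMap ∘ₗ locMap p f) (locMap p g ∘ₗ e'.symm.toLinearMap) := by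
      have h0 := h.loc p
      refine ⟨e'.injective.comp h0.inj, fun y => ?_, h0.surj.comp e'.symm.surjective⟩
      obtain ⟨y, rfl⟩ := e'.surjective y
      have := h0.exact y
      simpa using this
    obtain ⟨D, j, i, q, h1, h2⟩ := hs.exists_comp h'
    exact ⟨n, D, _, j, h1, (hr.addLoc p).mid h2 hQ (addLoc_of_mem p hW)⟩

omit [IsNoetherianRing R] in
theorem addLoc_mono (h : M ≤ N) (p : PrimeSpectrum R) : addLoc M p ≤ addLoc N p := by
  intro V hV
  refine add_iff.1 hV _ (add_isAddClosed _) ?_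
  rintro V ⟨X, hX, ⟨e⟩⟩
  exact (add_isAddClosed _).of_equiv e.toLinearEquiv (addLoc_of_mem p (h X hX))

/-- Thickness of `add A_p` in `add M_p` follows from its thickness in the larger category of totally
`C_p`-reflexive modules. -/
theorem thickGC_subset_SC (hC : IsSemidualizing C) : thickGC C ⊆ SC C := by
  intro M hM
  have hA := minThick_isLeast hC
  refine ⟨hM.1.resolving, ⟨hA.2 hM, fun X hX => ?_⟩, fun p => ?_⟩
  · obtain ⟨n, W, f, g, h, hW⟩ := thickGC_cogenerated hC hM X hX
    exact ⟨_, _, _, _, h.comp_eq_zero, h.shortExact, hA.1.1.resolving.pi n hA.1.2, hW⟩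
  · have hAp := thickGC_addLoc hC p hA.1
    have hMp := thickGC_addLoc hC p hM
    exact ⟨hAp.1.resolving, addLoc_mono (hA.2 hM) p,
      fun S hS h₁ h₂ h₃ => hAp.1.right S hS h₁ h₂ (hMp.1.le _ h₃)⟩

/-- An extension `E` of `X` by `C` lies in `M`, so it embeds into some `B` in `A` with cokernel `Z`
in `M`. Then `D = B / C` is an extension of `Z` by `X`, so it is in `M`, and local thickness puts it
in `A`. Hence `Ext¹(D, C) = 0`, and `C → B` splits, as does its factor `C → E`. -/
theorem SC_extZero_one (hC : IsSemidualizing C) (hM : M ∈ SC C) {X : ModuleCat.{u} R} (hX : M X) :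
    ExtZero C X 1 := by
  obtain ⟨hr, ⟨hAM, hcog⟩, hloc⟩ := hM
  have hA := (minThick_isLeast hC).1
  have := hr.finite X hX
  obtain ⟨n, f, hf⟩ := exists_free_cover (R := R) X
  have hs := SES.ker hf
  refine hs.extZero_one_of_exists_extend (extZero_free n one_pos) fun φ => ?_
  obtain ⟨E, i, j, q, hiq, hc, -⟩ := hs.exists_pushout φ
  have hE : M E := hr.mid hiq (hAM _ hA.2) hX
  obtain ⟨B, Z, a, b, w, hab, hB, hZ⟩ := hcog E hE
  have hab' := SES.of_shortExact hab
  obtain ⟨D, k, _, _, h1, h2⟩ := hiq.exists_comp hab'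
  have hD : M D := hr.mid h2 hX hZ
  have hDA : minThick C D := by
    have hfD := hr.finite D hD
    refine hA.1.resolving.of_forall_locAt (X := D) fun p => ?_
    rw [← addLoc_loc_iff hA.1.resolving]
    exact (hloc p).right _ (h1.loc p).shortExact (addLoc_of_mem p hA.2) (addLoc_of_mem p hB)
      (addLoc_of_mem p hD)
  obtain ⟨ρ, hρ⟩ := h1.exists_extend ((hA.1.le _ hDA).ext 1 one_pos) LinearMap.id
  refine ⟨ρ ∘ₗ a.hom ∘ₗ j, fun x => ?_⟩
  rw [LinearMap.comp_apply, LinearMap.comp_apply, hc]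
  exact hρ (φ x)

/-- Syzygies extend `SC_extZero_one` to all positive degrees, and cogeneration by `A`, which lies in
`G_C`, then gives total reflexivity. Composing `X → B` with an embedding of `B` into a power of `C`
yields `PowCogenerated`. -/
theorem SC_subset_thickGC (hC : IsSemidualizing C) : SC C ⊆ thickGC C := by
  intro M hM
  obtain ⟨hr, ⟨hAM, hcog⟩, hloc⟩ := id hM
  have hA := (minThick_isLeast hC).1
  have hext : ∀ i, ∀ X : ModuleCat.{u} R, M X → ExtZero C X (i + 1) := by
    intro i
    induction i with
    | zero => exact fun X hX => SC_extZero_one hC hM hX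
    | succ i ih =>
      intro X hX
      have := hr.finite X hX
      obtain ⟨n, f, hf⟩ := exists_free_cover (R := R) X
      exact (SES.ker hf).extZero_right
        (ih (ModuleCat.of R _) (hr.left (SES.ker hf) (hr.free n) hX))
        (extZero_free n (Nat.succ_pos _))
  have hle : M ≤ GC C := by
    refine le_GC_of_cogenerated M (fun X hX => hr.finite X hX) (fun X hX i hi => ?_) ?_
    · obtain ⟨i, rfl⟩ := Nat.exists_eq_succ_of_ne_zero hi.ne'
      exact hext i X hX
    · intro X hX
      obtain ⟨B, Z, a, b, w, hab, hB, hZ⟩ := hcog X hX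
      exact ⟨B, Z, a.hom, b.hom, SES.of_shortExact hab, hA.1.le _ hB, hZ⟩
  refine mem_thickGC_of_cogenerated hr hle (hAM _ hA.2) fun X hX => ?_
  obtain ⟨B, Z, a, b, w, hab, hB, hZ⟩ := hcog X hX
  obtain ⟨n, W, f, g, h, hW⟩ := thickGC_cogenerated hC hA B hB
  obtain ⟨D, k, _, _, h1, h2⟩ := (SES.of_shortExact hab).exists_comp h
  exact ⟨n, D, _, k, h1, hr.mid h2 hZ (hAM _ hW)⟩

end LocalizeThick

end ResolvingSubcat

namespace ResolvingSubcat

open Abelian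

open scoped Pointwise

/-! ### Regular sequences on `C` and the resulting bound on dimensions over a local ring. -/

section RegularSequences

variable {R : Type u} [CommRing R]
variable {X Y Z K F N : Type u} [AddCommGroup X] [Module R X] [AddCommGroup Y] [Module R Y]
  [AddCommGroup Z] [Module R Z] [AddCommGroup K] [Module R K] [AddCommGroup F] [Module R F]
  [AddCommGroup N] [Module R N]

theorem SES.extZero_covariant_right {f : X →ₗ[R] Y} {g : Y →ₗ[R] Z} (h : SES f g) {i : ℕ}
    (hY : ExtZero (ModuleCat.of R Y) N i) (hX : ExtZero (ModuleCat.of R X) N (i + 1)) :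
    ExtZero (ModuleCat.of R Z) N i := by
  refine subsingleton_of_forall_eq 0 fun e => ?_
  obtain ⟨e', rfl⟩ := Ext.covariant_sequence_exact₃ _ h.shortExact e rfl (hX.eq_zero _)
  rw [hY.eq_zero e', Ext.zero_comp]

theorem SES.exists_lift_of_extZero {f : X →ₗ[R] Y} {g : Y →ₗ[R] Z} (h : SES f g)
    (hX : ExtZero (ModuleCat.of R X) N 1) (φ : N →ₗ[R] Z) :
    ∃ ψ : N →ₗ[R] Y, ∀ n, g (ψ n) = φ n := by
  obtain ⟨e, he⟩ := Ext.covariant_sequence_exact₃ _ h.shortExact (Ext.mk₀ (ModuleCat.ofHom φ))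
    (zero_add 1) (hX.eq_zero _)
  obtain ⟨ψ, rfl⟩ := Ext.homEquiv₀.symm.surjective e
  change (Ext.mk₀ ψ).comp (Ext.mk₀ (ModuleCat.ofHom g)) (zero_add 0) = _ at he
  rw [Ext.mk₀_comp_mk₀] at he
  have := (Ext.mk₀_bijective _ _).1 he
  exact ⟨ψ.hom, fun x => congrArg (fun k => k.hom x) this⟩

theorem SES.smul {r : R} (hr : IsSMulRegular N r) :
    SES (LinearMap.lsmul R N r) (Submodule.mkQ (r • (⊤ : Submodule R N))) :=
  ⟨hr, LinearMap.exact_lsmul_mkQ_smul_top N r, Submodule.mkQ_surjective _⟩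

theorem mkQ_quotSMulTop_eq_zero_iff {r : R} {n : N} :
    Submodule.mkQ (r • (⊤ : Submodule R N)) n = 0 ↔ ∃ n', n = r • n' := by
  rw [Submodule.mkQ_apply, Submodule.Quotient.mk_eq_zero, Submodule.mem_smul_pointwise_iff_exists]
  exact ⟨fun ⟨a, _, h⟩ => ⟨a, h.symm⟩, fun ⟨a, h⟩ => ⟨a, trivial, h.symm⟩⟩

theorem mem_ofList_cons_smul_top_iff {r : R} {rs : List R} {n : N} :
    n ∈ Ideal.ofList (r :: rs) • (⊤ : Submodule R N) ↔
      Submodule.mkQ (r • (⊤ : Submodule R N)) n ∈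
        Ideal.ofList rs • (⊤ : Submodule R (QuotSMulTop r N)) := by
  have h : Ideal.ofList rs • (⊤ : Submodule R (QuotSMulTop r N)) =
      Submodule.map (Submodule.mkQ (r • (⊤ : Submodule R N))) (Ideal.ofList rs • ⊤) := by
    rw [Submodule.map_smul'', Submodule.map_top, Submodule.range_mkQ]
  rw [h, ← Submodule.mem_comap, Submodule.comap_map_mkQ, Ideal.ofList_cons_smul]

/-- Maps to `N / (rs) N` lift to `N` if the higher `Ext` modules into `N` vanish. -/
theorem exists_lift_of_isWeaklyRegular (rs : List R)
    (hrs : RingTheory.Sequence.IsWeaklyRegular N rs)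
    (hext : ∀ i, ExtZero (ModuleCat.of R N) X (i + 1)) (π : N →ₗ[R] Y)
    (hπ : Function.Surjective π)
    (hker : ∀ n, π n = 0 ↔ n ∈ Ideal.ofList rs • (⊤ : Submodule R N)) (φ : X →ₗ[R] Y) :
    ∃ ψ : X →ₗ[R] N, ∀ x, π (ψ x) = φ x := by
  induction rs generalizing N with
  | nil =>
    have hinj : Function.Injective π := (injective_iff_map_eq_zero _).2 fun n hn => by
      simpa using (hker n).1 hn
    let e := LinearEquiv.ofBijective π ⟨hinj, hπ⟩
    exact ⟨e.symm ∘ₗ φ, fun x => e.apply_symm_apply _⟩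
  | cons r rs ih =>
    rw [RingTheory.Sequence.isWeaklyRegular_cons_iff] at hrs
    have hs := SES.smul hrs.1
    obtain ⟨π', hπ'⟩ := hs.exists_desc π fun n => by
      rw [hker, mem_ofList_cons_smul_top_iff, hs.comp_apply]
      exact Submodule.zero_mem _
    -- The quotient `N / rN` inherits the vanishing of `Ext`. So `φ` lifts to `N / rN` by induction,
    -- and from there to `N` because `Ext¹(X, N) = 0`.
    obtain ⟨ψ', hψ'⟩ := ih hrs.2 (fun i => hs.extZero_covariant_right (hext i) (hext (i + 1))) π'
      (fun y => by obtain ⟨n, rfl⟩ := hπ y; exact ⟨_, hπ' n⟩)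
      (fun n => by
        obtain ⟨n, rfl⟩ := hs.surj n
        rw [hπ', hker, mem_ofList_cons_smul_top_iff])
    obtain ⟨ψ, hψ⟩ := hs.exists_lift_of_extZero (hext 0) ψ'
    exact ⟨ψ, fun x => by rw [← hψ', ← hψ, hπ']⟩

theorem exists_eq_smul_of_mem {r : R} (hr : IsSMulRegular N r) (h : X →ₗ[R] N)
    (hh : ∀ x, Submodule.mkQ (r • (⊤ : Submodule R N)) (h x) = 0) :
    ∃ k : X →ₗ[R] N, h = r • k := by
  obtain ⟨k, hk⟩ := (SES.smul hr).exists_lift h hh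
  exact ⟨k, LinearMap.ext fun x => (hk x).symm⟩

theorem range_compRight_mkQ {r : R} (hr : IsSMulRegular N r)
    (hext : ExtZero (ModuleCat.of R N) X 1) :
    Function.Surjective (LinearMap.compRight R (M := X) (Submodule.mkQ (r • (⊤ : Submodule R N)))) := by
  intro φ
  obtain ⟨ψ, hψ⟩ := (SES.smul hr).exists_lift_of_extZero hext φ
  exact ⟨ψ, LinearMap.ext hψ⟩

/-- A map with image in `(rs) N` is a combination of the elements of `rs`. -/
theorem mem_ofList_smul_hom (rs : List R) (hrs : RingTheory.Sequence.IsWeaklyRegular N rs)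
    (hext : ∀ i, ExtZero (ModuleCat.of R N) X (i + 1)) (h : X →ₗ[R] N)
    (hh : ∀ x, h x ∈ Ideal.ofList rs • (⊤ : Submodule R N)) :
    h ∈ Ideal.ofList rs • (⊤ : Submodule R (X →ₗ[R] N)) := by
  induction rs generalizing N with
  | nil =>
    have : h = 0 := LinearMap.ext fun x => by simpa using hh x
    rw [this]
    exact Submodule.zero_mem _
  | cons r rs ih =>
    rw [RingTheory.Sequence.isWeaklyRegular_cons_iff] at hrs
    have hs := SES.smul hrs.1
    let q := Submodule.mkQ (r • (⊤ : Submodule R N))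
    let c := LinearMap.compRight R (M := X) q
    have h1 := ih hrs.2 (fun i => hs.extZero_covariant_right (hext i) (hext (i + 1))) (q ∘ₗ h)
      (fun x => mem_ofList_cons_smul_top_iff.1 (hh x))
    have h2 : Ideal.ofList rs • (⊤ : Submodule R (X →ₗ[R] QuotSMulTop r N)) =
        Submodule.map c (Ideal.ofList rs • ⊤) := by
      rw [Submodule.map_smul'', Submodule.map_top,
        LinearMap.range_eq_top.2 (range_compRight_mkQ hrs.1 (hext 0))]
    rw [h2] at h1
    obtain ⟨k, hk, hkh⟩ := h1
    obtain ⟨l, hl⟩ := exists_eq_smul_of_mem hrs.1 (h - k) (fun x => by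
      rw [LinearMap.sub_apply, map_sub, sub_eq_zero]
      exact (LinearMap.congr_fun hkh x).symm)
    rw [Ideal.ofList_cons_smul, eq_add_of_sub_eq hl]
    exact Submodule.add_mem_sup (Submodule.smul_mem_pointwise_smul _ _ _ trivial) hk

/-- A sequence is weakly regular on `N` if it is weakly regular on `Hom(X, N)`, where `X` is
faithful. -/
theorem isWeaklyRegular_of_hom [IsNoetherianRing R] [Module.Finite R X] [Module.Finite R N]
    (hX : Module.annihilator R X = ⊥) (rs : List R)
    (hext : ∀ i, ExtZero (ModuleCat.of R N) X (i + 1))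
    (hrs : RingTheory.Sequence.IsWeaklyRegular (X →ₗ[R] N) rs) :
    RingTheory.Sequence.IsWeaklyRegular N rs := by
  induction rs generalizing N with
  | nil => exact RingTheory.Sequence.IsWeaklyRegular.nil _ _
  | cons r rs ih =>
    rw [RingTheory.Sequence.isWeaklyRegular_cons_iff] at hrs ⊢
    have hr : IsSMulRegular N r := by
      -- Maps `X → L` are maps `X → N` killed by `r`, hence zero. So the annihilator of `X`, which
      -- is zero, contains a regular element on `L`, and this forces `L = 0`.
      let L := LinearMap.ker (LinearMap.lsmul R N r)
      have h1 : Subsingleton (X →ₗ[R] L) := by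
        refine subsingleton_of_forall_eq 0 fun φ => ?_
        have h2 : L.subtype ∘ₗ φ = 0 := hrs.1 (by
          ext x
          exact (LinearMap.mem_ker.1 (φ x).2).trans (smul_zero r).symm)
        ext x
        exact LinearMap.congr_fun h2 x
      obtain ⟨a, ha, hreg⟩ := IsSMulRegular.subsingleton_linearMap_iff.1 h1
      rw [hX, Ideal.mem_bot] at ha
      subst ha
      intro x y hxy
      have h3 : x - y ∈ L := by
        change r • (x - y) = 0
        rw [smul_sub, sub_eq_zero]
        exact hxy
      have h4 : (⟨x - y, h3⟩ : L) = 0 := hreg (by simp)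
      exact sub_eq_zero.1 (congrArg Subtype.val h4)
    have hs := SES.smul hr
    refine ⟨hr, ih (fun i => hs.extZero_covariant_right (hext i) (hext (i + 1))) ?_⟩
    let c := LinearMap.compRight R (M := X) (Submodule.mkQ (r • (⊤ : Submodule R N)))
    have hc : LinearMap.ker c = r • (⊤ : Submodule R (X →ₗ[R] N)) := by
      ext h
      constructor
      · intro hh
        obtain ⟨k, rfl⟩ := exists_eq_smul_of_mem hr h fun x => LinearMap.congr_fun hh x
        exact Submodule.smul_mem_pointwise_smul _ _ _ trivial
      · rintro ⟨k, -, rfl⟩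
        ext x
        exact mkQ_quotSMulTop_eq_zero_iff.2 ⟨k x, rfl⟩
    let e : QuotSMulTop r (X →ₗ[R] N) ≃ₗ[R] (X →ₗ[R] QuotSMulTop r N) :=
      (Submodule.quotEquivOfEq _ _ hc.symm).trans
        (c.quotKerEquivOfSurjective (range_compRight_mkQ hr (hext 0)))
    exact (LinearEquiv.isWeaklyRegular_congr e rs).1 hrs.2

theorem SES.quotSMulTop {f : X →ₗ[R] Y} {g : Y →ₗ[R] Z} (h : SES f g) {r : R}
    (hr : IsSMulRegular Z r) : SES (QuotSMulTop.map r f) (QuotSMulTop.map r g) := by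
  refine ⟨?_, QuotSMulTop.map_exact r h.exact h.surj, QuotSMulTop.map_surjective r h.surj⟩
  refine (injective_iff_map_eq_zero _).2 fun x hx => ?_
  obtain ⟨x, rfl⟩ := Submodule.mkQ_surjective _ x
  have hx' : Submodule.mkQ (r • (⊤ : Submodule R Y)) (f x) = 0 := hx
  obtain ⟨y, hy⟩ := mkQ_quotSMulTop_eq_zero_iff.1 hx'
  obtain ⟨x', rfl⟩ := h.exists_preimage (y := y) (hr (by
    change r • g y = r • 0
    rw [← map_smul, ← hy, h.comp_apply, smul_zero]))
  rw [← map_smul] at hy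
  exact mkQ_quotSMulTop_eq_zero_iff.2 ⟨x', h.inj hy⟩

/-- Exactness survives reduction modulo a sequence that is regular on the right term, one element at
a time. -/
theorem SES.mem_ofList_smul_top {f : X →ₗ[R] Y} {g : Y →ₗ[R] Z} (h : SES f g) (rs : List R)
    (hrs : RingTheory.Sequence.IsWeaklyRegular Z rs) {x : X}
    (hx : f x ∈ Ideal.ofList rs • (⊤ : Submodule R Y)) :
    x ∈ Ideal.ofList rs • (⊤ : Submodule R X) := by
  induction rs generalizing X Y Z with
  | nil =>
    have : f x = 0 := by simpa using hx
    rw [h.inj (this.trans (map_zero f).symm)]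
    exact Submodule.zero_mem _
  | cons r rs ih =>
    rw [RingTheory.Sequence.isWeaklyRegular_cons_iff] at hrs
    rw [mem_ofList_cons_smul_top_iff] at hx ⊢
    exact ih (h.quotSMulTop hrs.1) hrs.2 hx

/-- Passing to a syzygy lengthens the regular sequence by one. -/
theorem SES.isWeaklyRegular_take {f : X →ₗ[R] Y} {g : Y →ₗ[R] Z} (h : SES f g) (rs : List R)
    (hY : RingTheory.Sequence.IsWeaklyRegular Y rs) (k : ℕ)
    (hZ : RingTheory.Sequence.IsWeaklyRegular Z (rs.take k)) :
    RingTheory.Sequence.IsWeaklyRegular X (rs.take (k + 1)) := by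
  induction rs generalizing X Y Z k with
  | nil => exact RingTheory.Sequence.IsWeaklyRegular.nil _ _
  | cons r rs ih =>
    rw [RingTheory.Sequence.isWeaklyRegular_cons_iff] at hY
    have hX : IsSMulRegular X r := fun a b hab => h.inj (hY.1 (by
      change r • a = r • b at hab
      change r • f a = r • f b
      rw [← map_smul, hab, map_smul]))
    rw [List.take_succ_cons, RingTheory.Sequence.isWeaklyRegular_cons_iff]
    refine ⟨hX, ?_⟩
    rcases k with _ | k
    · rw [List.take_zero]
      exact RingTheory.Sequence.IsWeaklyRegular.nil _ _
    · rw [List.take_succ_cons, RingTheory.Sequence.isWeaklyRegular_cons_iff] at hZ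
      exact ih (h.quotSMulTop hZ.1) hY.2 k hZ.2

variable {C : ModuleCat.{u} R}

theorem IsSemidualizing.isWeaklyRegular [IsNoetherianRing R] (hC : IsSemidualizing C) {rs : List R}
    (hrs : RingTheory.Sequence.IsWeaklyRegular R rs) :
    RingTheory.Sequence.IsWeaklyRegular C rs := by
  have := hC.fg
  obtain ⟨e⟩ := hC.self_equiv
  refine isWeaklyRegular_of_hom (X := C) ?_ rs (fun i => hC.ext _ (Nat.succ_pos i))
    ((LinearEquiv.isWeaklyRegular_congr e rs).1 hrs)
  rw [eq_bot_iff]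
  intro r hr
  exact hC.eq_zero_of_smul fun c => Module.mem_annihilator.1 hr c

/-- This says that `C / (rs)C` is faithful over `R / (rs)`: multiplication by `z` lies in `(rs)
Hom(C, C)`, and `Hom(C, C)` is `R`. -/
theorem IsSemidualizing.mem_ofList [IsNoetherianRing R] (hC : IsSemidualizing C) {rs : List R}
    (hrs : RingTheory.Sequence.IsWeaklyRegular R rs) {z : R}
    (hz : ∀ c : C, z • c ∈ Ideal.ofList rs • (⊤ : Submodule R C)) : z ∈ Ideal.ofList rs := by
  have h := mem_ofList_smul_hom (X := C) (N := C) rs (hC.isWeaklyRegular hrs)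
    (fun i => hC.ext _ (Nat.succ_pos i)) (LinearMap.lsmul R C z) hz
  let e : R ≃ₗ[R] (C →ₗ[R] C) := LinearEquiv.ofBijective _ hC.homothety
  have h2 : Ideal.ofList rs • (⊤ : Submodule R (C →ₗ[R] C)) =
      Submodule.map e.toLinearMap (Ideal.ofList rs • ⊤) := by
    rw [Submodule.map_smul'', Submodule.map_top, LinearEquiv.range]
  rw [h2] at h
  obtain ⟨a, ha, hae⟩ := h
  have : a = z := hC.homothety.1 hae
  rw [← this]
  simpa using ha

theorem extend_of_isWeaklyRegular [IsNoetherianRing R] [IsLocalRing R] (hC : IsSemidualizing C)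
    {rs : List R} (hrs : RingTheory.Sequence.IsWeaklyRegular R rs) {z : R}
    (hz : z ∉ Ideal.ofList rs) (hmz : ∀ a ∈ IsLocalRing.maximalIdeal R, a * z ∈ Ideal.ofList rs)
    {n : ℕ} {f : K →ₗ[R] (Fin n → R)} {g : (Fin n → R) →ₗ[R] Y} (h : SES f g)
    (hY : RingTheory.Sequence.IsWeaklyRegular Y rs)
    (hK : GC C (ModuleCat.of R K)) (φ : K →ₗ[R] C) :
    ∃ ψ : (Fin n → R) →ₗ[R] C, ∀ x, ψ (f x) = φ x := by
  have := hC.fg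
  have : Module.Finite R K := hK.fg
  let I := Ideal.ofList rs
  let q := Submodule.mkQ (I • (⊤ : Submodule R C))
  have hq : ∀ c, q c = 0 ↔ c ∈ I • (⊤ : Submodule R C) := fun c => by simp [q]
  obtain ⟨c₀, hc₀⟩ : ∃ c₀ : C, z • c₀ ∉ I • (⊤ : Submodule R C) := by
    by_contra! hcon
    exact hz (hC.mem_ofList hrs hcon)
  let ρ := LinearMap.lcomp R C f
  by_contra! hno
  have hφ : (LinearMap.range ρ).mkQ φ ≠ 0 := by
    intro h0
    obtain ⟨ψ, hψ⟩ := (Submodule.Quotient.mk_eq_zero _).1 h0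
    obtain ⟨x, hx⟩ := hno ψ
    exact hx (LinearMap.congr_fun hψ x)
  have hns : ¬ Subsingleton (((K →ₗ[R] C) ⧸ LinearMap.range ρ) →ₗ[R]
      (C ⧸ I • (⊤ : Submodule R C))) := by
    rw [IsSMulRegular.subsingleton_linearMap_iff]
    rintro ⟨a, ha, hreg⟩
    have ham : a ∈ IsLocalRing.maximalIdeal R := by
      rw [IsLocalRing.mem_maximalIdeal, mem_nonunits_iff]
      intro hu
      have := Module.mem_annihilator.1 ha ((LinearMap.range ρ).mkQ φ)
      exact hφ (hu.smul_eq_zero.1 this)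
    refine hc₀ ((hq _).1 (hreg ?_))
    change a • q (z • c₀) = a • 0
    rw [smul_zero, ← map_smul, smul_smul, hq]
    exact Submodule.smul_mem_smul (hmz a ham) trivial
  refine hns (subsingleton_of_forall_eq 0 fun l => ?_)
  obtain ⟨Φ, hΦ⟩ := exists_lift_of_isWeaklyRegular (X := (K →ₗ[R] C)) rs (hC.isWeaklyRegular hrs)
    (fun i => hK.ext_dual _ (Nat.succ_pos i)) q (Submodule.mkQ_surjective _) hq
    (l ∘ₗ (LinearMap.range ρ).mkQ)
  obtain ⟨κ, rfl⟩ := hK.reflexive.2 Φ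
  have hκ : ∀ i, f κ i ∈ I := fun i => hC.mem_ofList hrs fun c => by
    rw [← hq]
    have := hΦ (ρ (LinearMap.toSpanSingleton R C c ∘ₗ LinearMap.proj i))
    refine Eq.trans this ?_
    rw [LinearMap.comp_apply]
    have h0 : (LinearMap.range ρ).mkQ (ρ (LinearMap.toSpanSingleton R C c ∘ₗ LinearMap.proj i)) = 0 :=
      (Submodule.Quotient.mk_eq_zero _).2 ⟨_, rfl⟩
    rw [h0, map_zero]
  have hfκ : f κ ∈ I • (⊤ : Submodule R (Fin n → R)) := by
    rw [pi_eq_sum_univ' (f κ)]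
    exact Submodule.sum_mem _ fun i _ => Submodule.smul_mem_smul (hκ i) trivial
  have hκ' := h.mem_ofList_smul_top rs hY hfκ
  ext θ
  have := hΦ θ
  change q (θ κ) = l ((LinearMap.range ρ).mkQ θ) at this
  change l ((LinearMap.range ρ).mkQ θ) = 0
  rw [← this, hq]
  have h3 : θ κ ∈ Submodule.map θ (I • ⊤) := ⟨κ, hκ', rfl⟩
  rw [Submodule.map_smul''] at h3
  exact Submodule.smul_mono le_rfl le_top h3

/-- The dimension of a module over a local ring is bounded by the length of a maximal regular
sequence. -/
theorem shift_length_of_isWeaklyRegular [IsNoetherianRing R] [IsLocalRing R]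
    {M : ObjectProperty (ModuleCat.{u} R)} (hC : IsSemidualizing C) (hM : M ∈ thickGC C)
    {rs : List R} (hrs : RingTheory.Sequence.IsWeaklyRegular R rs) {z : R}
    (hz : z ∉ Ideal.ofList rs) (hmz : ∀ a ∈ IsLocalRing.maximalIdeal R, a * z ∈ Ideal.ofList rs)
    {N : ℕ} (hX : shift^[N] M (ModuleCat.of R X)) : shift^[rs.length] M (ModuleCat.of R X) := by
  have hr := hM.1.resolving
  have hfree : ∀ n, RingTheory.Sequence.IsWeaklyRegular (Fin n → R) rs := fun n =>
    (LinearEquiv.isWeaklyRegular_congr (TensorProduct.rid R (Fin n → R)) rs).1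
      hrs.isWeaklyRegular_lTensor
  -- Each syzygy lengthens the part of `rs` regular on the module by one. After `j` of them all of
  -- `rs` is regular, and `extend_of_isWeaklyRegular` lowers the dimension.
  have step : ∀ (j k : ℕ) (X : Type u) [AddCommGroup X] [Module R X], rs.length ≤ k + j →
      RingTheory.Sequence.IsWeaklyRegular X (rs.take k) → shift^[j + 1] M (ModuleCat.of R X) →
      shift^[j] M (ModuleCat.of R X) := by
    intro j
    induction j with
    | zero =>
      intro k X _ _ hk hreg hX
      rw [List.take_of_length_le (by omega)] at hreg
      obtain ⟨n, f, hf, hK⟩ := id hX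
      refine thickGC_of_shift hC hM 0 hX ?_
      exact (SES.ker hf).extZero_one_of_exists_extend (extZero_free n one_pos)
        (extend_of_isWeaklyRegular hC hrs hz hmz (SES.ker hf) hreg (hM.1.le _ hK))
    | succ j ih =>
      intro k X _ _ hk hreg hX
      have := shift_finite (Function.iterate_succ_apply' shift (j + 1) M ▸ hX)
      obtain ⟨n, f, hf⟩ := exists_free_cover (R := R) X
      have hs := SES.ker hf
      rw [hr.shift_iterate_succ_iff hs (hr.free n)] at hX ⊢
      exact ih (k + 1) _ (by omega) (hs.isWeaklyRegular_take rs (hfree n) k hreg) hX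
  have key : ∀ l, shift^[rs.length + l] M (ModuleCat.of R X) →
      shift^[rs.length] M (ModuleCat.of R X) := by
    intro l
    induction l with
    | zero => exact id
    | succ l ih =>
      refine fun h => ih (step (rs.length + l) 0 X (by omega) ?_ h)
      exact RingTheory.Sequence.IsWeaklyRegular.nil _ _
  exact key N (hr.shift_iterate_le (by omega) _ hX)

end RegularSequences

end ResolvingSubcat

namespace ResolvingSubcat

open Abelian

/-! ### `Ext` into powers of `C` and maps of extensions. -/

section ExtPowers

variable {R : Type u} [CommRing R]
variable {X Y Z X' Y' Z' : Type u} [AddCommGroup X] [Module R X] [AddCommGroup Y] [Module R Y]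
  [AddCommGroup Z] [Module R Z] [AddCommGroup X'] [Module R X'] [AddCommGroup Y'] [Module R Y']
  [AddCommGroup Z'] [Module R Z']
variable {C : ModuleCat.{u} R}

/-- A class with values in a power vanishes if its components do. -/
theorem ext_pi_eq_zero {N : ModuleCat.{u} R} {b i : ℕ}
    (e : Ext N (ModuleCat.of R (Fin b → C)) i)
    (he : ∀ j, e.comp (Ext.mk₀ (ModuleCat.ofHom (LinearMap.proj (R := R) (φ := fun _ : Fin b => C) j)))
      (add_zero i) = 0) : e = 0 := by
  have h : 𝟙 (ModuleCat.of R (Fin b → C)) = ∑ j, ModuleCat.ofHom (LinearMap.proj j) ≫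
      ModuleCat.ofHom (LinearMap.single R (fun _ : Fin b => C) j) := by
    refine ModuleCat.hom_ext (LinearMap.ext fun x => funext fun k => ?_)
    rw [ModuleCat.hom_sum]
    simp [LinearMap.sum_apply, Finset.sum_apply, Pi.single_apply]
  rw [← Ext.comp_mk₀_id e, h, Ext.mk₀_sum, Ext.comp_sum]
  refine Finset.sum_eq_zero fun j _ => ?_
  rw [← Ext.mk₀_comp_mk₀, ← Ext.comp_assoc_of_second_deg_zero, he, Ext.zero_comp]

theorem ExtZero.covariant_pi {i : ℕ} (h : ExtZero C X i) (b : ℕ) :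
    ExtZero (ModuleCat.of R (Fin b → C)) X i :=
  subsingleton_of_forall_eq 0 fun e => ext_pi_eq_zero e fun _ => h.eq_zero _

/-- A morphism of short exact sequences and its compatibility with the extension classes. -/
theorem SES.exists_map {f : X →ₗ[R] Y} {g : Y →ₗ[R] Z} (h : SES f g)
    {f' : X' →ₗ[R] Y'} {g' : Y' →ₗ[R] Z'} (h' : SES f' g') (a : X →ₗ[R] X') (b : Y →ₗ[R] Y')
    (hab : ∀ x, b (f x) = f' (a x)) :
    ∃ c : Z →ₗ[R] Z', (∀ y, c (g y) = g' (b y)) ∧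
      (Ext.mk₀ (ModuleCat.ofHom c)).comp h'.shortExact.extClass (zero_add 1) =
        h.shortExact.extClass.comp (Ext.mk₀ (ModuleCat.ofHom a)) (add_zero 1) := by
  obtain ⟨c, hc⟩ := h.exists_desc (g' ∘ₗ b) fun x => by
    rw [LinearMap.comp_apply, hab, h'.comp_apply]
  let F : h.complex ⟶ h'.complex :=
    { τ₁ := ModuleCat.ofHom a
      τ₂ := ModuleCat.ofHom b
      τ₃ := ModuleCat.ofHom c
      comm₁₂ := by ext x; exact (hab x).symm
      comm₂₃ := by ext y; exact (hc y).symm }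
  exact ⟨c, hc, (ShortComplex.ShortExact.extClass_naturality h.shortExact h'.shortExact F).symm⟩

/-- If multiplication by `r` on the left term extends to the middle term, then multiplication by
`r` on the right term lifts to the middle term. -/
theorem SES.exists_smul_lift {f : X →ₗ[R] Y} {g : Y →ₗ[R] Z} (h : SES f g) {r : R}
    (k : Y →ₗ[R] X) (hk : ∀ x, k (f x) = r • x) : ∃ l : Z →ₗ[R] Y, ∀ z, g (l z) = r • z := by
  obtain ⟨l, hl⟩ := h.exists_desc (r • LinearMap.id - f ∘ₗ k) fun x => by simp [hk]
  refine ⟨l, fun z => ?_⟩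
  obtain ⟨y, rfl⟩ := h.surj z
  simp [hl, h.comp_apply]

theorem IsSemidualizing.exists_coeff (hC : IsSemidualizing C) {b : ℕ}
    (φ : (Fin b → C) →ₗ[R] C) : ∃ a : Fin b → R, ∀ x, φ x = ∑ j, a j • x j := by
  choose a ha using fun j => hC.exists_smul (φ ∘ₗ LinearMap.single R (fun _ : Fin b => C) j)
  refine ⟨a, fun x => ?_⟩
  conv_lhs => rw [← Finset.univ_sum_single x, map_sum]
  exact Finset.sum_congr rfl fun j _ => ha j (x j)

end ExtPowers

/-! ### Cosyzygies attached to an ideal and their `Ext` modules. -/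

section Tower

variable {R : Type u} [CommRing R] {C : ModuleCat.{u} R} {I : Ideal R}

/-- The cosyzygies `T` obtained by applying `Hom(-, C)` to the start of a free resolution of
`R ⧸ I`, together with the distinguished class in `Extⁿ⁺¹(T, C)`. -/
inductive Tower (C : ModuleCat.{u} R) (I : Ideal R) :
    (n : ℕ) → (T : ModuleCat.{u} R) → Ext T C (n + 1) → Prop
  | base {b : ℕ} (r : Fin b → R) (hr : Ideal.span (Set.range r) = I) {T : ModuleCat.{u} R}
      {g : (Fin b → C) →ₗ[R] T}
      (h : SES (LinearMap.pi fun j => r j • LinearMap.id : C →ₗ[R] (Fin b → C)) g) :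
      Tower C I 0 T h.shortExact.extClass
  | step {n : ℕ} {T : ModuleCat.{u} R} {τ : Ext T C (n + 1)} (hT : Tower C I n T τ) {b : ℕ}
      {T' : ModuleCat.{u} R} {f : T →ₗ[R] (Fin b → C)} {g : (Fin b → C) →ₗ[R] T'}
      (h : SES f g) (hext : ∀ φ : T →ₗ[R] C, ∃ ψ : (Fin b → C) →ₗ[R] C, ∀ x, ψ (f x) = φ x) :
      Tower C I (n + 1) T' (h.shortExact.extClass.comp τ (add_comm 1 (n + 1)))

namespace Tower

variable {n : ℕ} {T : ModuleCat.{u} R} {τ : Ext T C (n + 1)} {M : ObjectProperty (ModuleCat.{u} R)}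

theorem shift (hM : IsResolving M) (hMC : M C) (hT : Tower C I n T τ) :
    ResolvingSubcat.shift^[n + 1] M T := by
  induction hT with
  | base r hr h => exact (hM.shift_iterate_succ_iff h (hM.pi _ hMC) 0).2 hMC
  | step hT h hext ih => exact (hM.shift_iterate_succ_iff h (hM.pi _ hMC) _).2 ih

theorem exists_cover (hT : Tower C I n T τ) :
    ∃ (b : ℕ) (g : (Fin b → C) →ₗ[R] T), Function.Surjective g := by
  cases hT with
  | base r hr h => exact ⟨_, _, h.surj⟩
  | step hT h hext => exact ⟨_, _, h.surj⟩

/-- Multiplication by elements of `I` factors through a power of `C`. -/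
theorem factors (hT : Tower C I n T τ) {r : R} (hr : r ∈ I) :
    ∃ (b : ℕ) (u : T →ₗ[R] (Fin b → C)) (v : (Fin b → C) →ₗ[R] T), ∀ x, v (u x) = r • x := by
  induction hT with
  | base s hs h =>
    rw [← hs, Ideal.mem_span_range_iff_exists_fun] at hr
    obtain ⟨a, rfl⟩ := hr
    -- Multiplication by `∑ aᵢ sᵢ` on `C` extends to the power of `C` as `x ↦ ∑ aⱼ xⱼ`.
    obtain ⟨l, hl⟩ := h.exists_smul_lift (r := ∑ i, a i * s i)
      (∑ j, a j • LinearMap.proj j) fun x => by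
        simp [LinearMap.sum_apply, Finset.sum_smul, smul_smul]
    exact ⟨_, l, _, hl⟩
  | step hT h hext ih =>
    obtain ⟨b, u, v, huv⟩ := ih
    choose w hw using fun j => hext (LinearMap.proj j ∘ₗ u)
    obtain ⟨l, hl⟩ := h.exists_smul_lift (r := r) (v ∘ₗ LinearMap.pi w) fun x => by
      rw [← huv, LinearMap.comp_apply]
      congr 1
      funext j
      exact hw j x
    exact ⟨_, l, _, hl⟩

/-- Hence `T` belongs to `M` at every prime not containing `I`. -/
theorem le_annFac (hM : IsResolving M) (hMC : M C) (hT : Tower C I n T τ) : I ≤ annFac hM T := by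
  intro r hr
  obtain ⟨b, u, v, huv⟩ := hT.factors hr
  exact ⟨ModuleCat.of R (Fin b → C), u, v, hM.pi _ hMC, huv⟩

theorem smul_eq_zero (hC : IsSemidualizing C) (hT : Tower C I n T τ) {r : R} (hr : r ∈ I) :
    r • τ = 0 := by
  obtain ⟨b, u, v, huv⟩ := hT.factors hr
  exact smul_ext_eq_zero (X := T) huv (ExtZero.pi (X := C) (hC.ext _ (Nat.succ_pos n)) b) τ

/-- So the dimension of `T` stays `n + 1` at every prime containing `I`. After `n` syzygies, a
scalar `s` factoring through `M` kills the class in `Ext¹`, so multiplication by `s` on `C` extends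
to the power of `C`. Since maps between powers of `C` are matrices over `R`, this says that `s` is a
combination of the generators of `I`. -/
theorem exists_mem_of_shift [IsNoetherianRing R] (hC : IsSemidualizing C) (hM : M ∈ thickGC C)
    {S : Submonoid R} (hT : Tower C I n T τ) (h : ResolvingSubcat.shift^[n] (LocIn M S) T) :
    ∃ s ∈ S, s ∈ I := by
  have hr := hM.1.resolving.locIn S
  have hCS : LocIn M S C := hM.1.resolving.le_locIn S _ hM.2
  induction hT with
  | @base b r hrI T g hs =>
    obtain ⟨-, s, hsS, Y, u, v, hY, huv⟩ := h
    refine ⟨s, hsS, ?_⟩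
    have h0 := smul_ext_eq_zero (X := T) huv (GC_extVanish (hM.1.le _ hY) 1 one_pos)
      (hs.shortExact.extClass : Ext T C 1)
    have h1 : hs.shortExact.extClass.comp (Ext.mk₀ (s • 𝟙 C)) (add_zero 1) = 0 := by
      rw [Ext.mk₀_smul, Ext.comp_smul]
      erw [Ext.comp_mk₀_id]
      exact h0
    obtain ⟨e, he⟩ := Ext.contravariant_sequence_exact₁ hs.shortExact C _ (add_zero 1) h1
    obtain ⟨ψ, rfl⟩ := Ext.homEquiv₀.symm.surjective e
    change (Ext.mk₀ (ModuleCat.ofHom _)).comp (Ext.mk₀ ψ) (zero_add 0) = _ at he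
    rw [Ext.mk₀_comp_mk₀] at he
    have he' := (Ext.mk₀_bijective _ _).1 he
    obtain ⟨a, ha⟩ := hC.exists_coeff (b := b) ψ.hom
    have hsum : s - ∑ j, a j * r j = 0 := hC.eq_zero_of_smul fun c => by
      have h2 : ψ.hom (fun j => r j • c) = s • c := congrArg (fun k => k.hom c) he'
      rw [sub_smul, ← h2, ha]
      simp [Finset.sum_smul, smul_smul]
    rw [sub_eq_zero] at hsum
    rw [hsum, ← hrI]
    exact Ideal.sum_mem _ fun j _ => Ideal.mul_mem_left _ _ (Ideal.subset_span ⟨j, rfl⟩)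
  | step hT hs hext ih => exact ih ((hr.shift_iterate_succ_iff hs (hr.pi _ hCS) _).1 h)

/-- The distinguished class generates. -/
theorem exists_eq_smul (hC : IsSemidualizing C) (hT : Tower C I n T τ) (e : Ext T C (n + 1)) :
    ∃ a : R, e = a • τ := by
  induction hT with
  | base r hr h =>
    obtain ⟨e', rfl⟩ := h.exists_connecting (ExtZero.pi (X := C) (hC.ext _ one_pos) _) e
    obtain ⟨φ, rfl⟩ := Ext.homEquiv₀.symm.surjective e'
    obtain ⟨a, ha⟩ := hC.exists_smul φ.hom
    have : φ = a • 𝟙 C := by ext c; exact ha c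
    refine ⟨a, ?_⟩
    change h.shortExact.extClass.comp (Ext.mk₀ φ) _ = _
    rw [this, Ext.mk₀_smul, Ext.comp_smul]
    erw [Ext.comp_mk₀_id]
  | @step n T τ hT b T' f g h hext ih =>
    obtain ⟨e', rfl⟩ := h.exists_connecting (ExtZero.pi (X := C) (hC.ext _ (Nat.succ_pos _)) _) e
    obtain ⟨a, rfl⟩ := ih e'
    exact ⟨a, Ext.comp_smul _ _ _ _⟩

/-- Below degree `n + 1` there is no positive `Ext`. In degree `n + 1` it is generated by `τ`, which
`I` annihilates. -/
theorem extZero (hC : IsSemidualizing C) (hT : Tower C I n T τ) {j : ℕ} (hj : 0 < j)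
    (hjn : j < n + 1) : ExtZero C T j := by
  induction hT generalizing j with
  | base r hr h => omega
  | @step n T τ hT b T' f g h hext ih =>
    have hb : ∀ i, ExtZero C (Fin b → C) (i + 1) := fun i =>
      ExtZero.pi (X := C) (hC.ext _ (Nat.succ_pos _)) _
    obtain _ | _ | j := j
    · omega
    · exact h.extZero_one_of_exists_extend (hb 0) hext
    · exact h.extZero_right (ih (Nat.succ_pos j) (by omega)) (hb _)

/-- Classes annihilated by `I` factor through the distinguished class. -/
theorem exists_comp_eq (hT : Tower C I n T τ) {X : ModuleCat.{u} R} (k : ℕ) {m : ℕ}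
    (hm : k + (n + 1) = m) (hX : ∀ j, k < j → j < m → ExtZero C X j) (e : Ext X C m)
    (he : ∀ r ∈ I, r • e = 0) : ∃ g : Ext X T k, g.comp τ hm = e := by
  induction hT generalizing k m with
  | @base b r hr T g h =>
    -- The image of `e` in `Ext` of the power of `C` has components `rⱼ • e = 0`, so `e` comes from
    -- the connecting map.
    refine Ext.covariant_sequence_exact₁ _ h.shortExact e (ext_pi_eq_zero _ fun j => ?_) hm
    have h1 : ModuleCat.ofHom (LinearMap.pi fun j => r j • LinearMap.id : C →ₗ[R] (Fin b → C)) ≫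
        ModuleCat.ofHom (LinearMap.proj j) = r j • 𝟙 C := by
      ext c
      rfl
    rw [Ext.comp_assoc_of_second_deg_zero, Ext.mk₀_comp_mk₀]
    erw [h1]
    rw [Ext.mk₀_smul, Ext.comp_smul, Ext.comp_mk₀_id]
    exact he _ (by rw [← hr]; exact Ideal.subset_span ⟨j, rfl⟩)
  | @step n T τ hT b T' f g h hext ih =>
    obtain ⟨g', rfl⟩ := ih (k + 1) (by omega) (fun j h1 h2 => hX j (by omega) h2) e he
    obtain ⟨l, rfl⟩ := Ext.covariant_sequence_exact₁ _ h.shortExact g'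
      ((ExtZero.covariant_pi (X := X) (hX (k + 1) (by omega) (by omega)) b).eq_zero _) rfl
    exact ⟨l, (Ext.comp_assoc _ _ _ _ _ (by omega)).symm⟩

end Tower

end Tower

end ResolvingSubcat

namespace ResolvingSubcat

open Abelian

/-! ### Existence of towers up to the grade of the ideal. -/

section TowerExistence

variable {R : Type u} [CommRing R] {C : ModuleCat.{u} R} {I : Ideal R}

theorem eq_zero_of_extZero_quotient {T : ModuleCat.{u} R} (h : ExtZero T (R ⧸ I) 0) {x : T}
    (hx : ∀ r ∈ I, r • x = 0) : x = 0 := by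
  let φ : (R ⧸ I) →ₗ[R] T := Submodule.liftQ I (LinearMap.toSpanSingleton R T x) hx
  have h0 : Ext.mk₀ (ModuleCat.ofHom φ) = Ext.mk₀ 0 := Subsingleton.elim _ _
  have h1 := (Ext.mk₀_bijective _ _).1 h0
  have h2 : φ (Submodule.Quotient.mk 1) = 0 := congrArg (fun k => k.hom (Submodule.Quotient.mk 1)) h1
  change (1 : R) • x = 0 at h2
  rwa [one_smul] at h2

/-- Rees' argument: multiplication by `r` is zero on `Ext(R ⧸ I, N)` because `r ∈ I`, and injective
by induction on the sequence. -/
theorem extZero_quotient_of_isWeaklyRegular {N : Type u} [AddCommGroup N] [Module R N]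
    (rs : List R) (hrs : RingTheory.Sequence.IsWeaklyRegular N rs) (hI : ∀ r ∈ rs, r ∈ I) {j : ℕ}
    (hj : j < rs.length) : ExtZero (ModuleCat.of R N) (R ⧸ I) j := by
  induction rs generalizing N j with
  | nil => simp at hj
  | cons r rs ih =>
    rw [RingTheory.Sequence.isWeaklyRegular_cons_iff] at hrs
    have hs := SES.smul hrs.1
    refine subsingleton_of_forall_eq 0 fun e => ?_
    have he : e.comp (Ext.mk₀ (ModuleCat.ofHom (LinearMap.lsmul R N r))) (add_zero j) = 0 := by
      have h1 : ModuleCat.ofHom (LinearMap.lsmul R N r) = r • 𝟙 (ModuleCat.of R N) := by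
        ext x; rfl
      have h2 : r • 𝟙 (ModuleCat.of R (R ⧸ I)) = 0 := by
        refine ModuleCat.hom_ext (LinearMap.ext fun x => ?_)
        obtain ⟨y, rfl⟩ := Submodule.Quotient.mk_surjective _ x
        change r • (Submodule.Quotient.mk y : R ⧸ I) = 0
        rw [← Submodule.Quotient.mk_smul, Submodule.Quotient.mk_eq_zero]
        exact I.mul_mem_right _ (hI r (by simp))
      have h3 : r • e = (Ext.mk₀ (r • 𝟙 (ModuleCat.of R (R ⧸ I)))).comp e (zero_add j) := by
        rw [Ext.mk₀_smul, Ext.smul_comp, Ext.mk₀_id_comp]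
      rw [h1, Ext.mk₀_smul, Ext.comp_smul, Ext.comp_mk₀_id, h3, h2, Ext.mk₀_zero, Ext.zero_comp]
    rcases j with _ | j
    · obtain ⟨φ, rfl⟩ := Ext.homEquiv₀.symm.surjective e
      change (Ext.mk₀ φ).comp (Ext.mk₀ _) (add_zero 0) = 0 at he
      rw [Ext.mk₀_comp_mk₀, ← Ext.mk₀_zero] at he
      have h4 := (Ext.mk₀_bijective _ _).1 he
      have h5 : φ = 0 := by
        refine ModuleCat.hom_ext (LinearMap.ext fun x => hs.inj ?_)
        exact (congrArg (fun k => k.hom x) h4).trans (map_zero (LinearMap.lsmul R N r)).symm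
      change Ext.mk₀ φ = 0
      rw [h5, Ext.mk₀_zero]
    · obtain ⟨x, rfl⟩ := Ext.covariant_sequence_exact₁ _ hs.shortExact e he rfl
      have := ih hrs.2 (fun a ha => hI a (by simp [ha])) (j := j) (by simpa using hj)
      rw [this.eq_zero x, Ext.zero_comp]

/-- Only injectivity of the maps into powers of `C` is at stake. An element of the kernel is killed
by `I`, since multiplication by `I` factors through powers of `C` and all maps to `C` factor through
`f`. It then vanishes because `Hom(R ⧸ I, T) = 0`; each step uses up one degree of the vanishing of
`Ext(R ⧸ I, C)`. -/
theorem exists_tower [IsNoetherianRing R] (hC : IsSemidualizing C) {N : ℕ}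
    (hext : ∀ j < N, ExtZero C (R ⧸ I) j) {n : ℕ} (hn : n < N) :
    ∃ (T : ModuleCat.{u} R) (τ : Ext T C (n + 1)), Tower C I n T τ ∧ Module.Finite R T ∧
      ∀ j, j + n + 1 < N → ExtZero T (R ⧸ I) j := by
  have := hC.fg
  induction n with
  | zero =>
    obtain ⟨b, r, hr⟩ := Submodule.fg_iff_exists_fin_generating_family.1 (IsNoetherian.noetherian I)
    have hinj : Function.Injective
        (LinearMap.pi fun j => r j • LinearMap.id : C →ₗ[R] (Fin b → C)) := by
      refine (injective_iff_map_eq_zero _).2 fun c hc => ?_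
      refine eq_zero_of_extZero_quotient (hext 0 hn) fun a ha => ?_
      have hle : I ≤ LinearMap.ker (LinearMap.toSpanSingleton R C c) := by
        rw [← hr, Submodule.span_le]
        rintro _ ⟨j, rfl⟩
        exact congrFun hc j
      exact hle ha
    have hs := SES.coker hinj
    refine ⟨ModuleCat.of R _, _, Tower.base r hr hs, inferInstance, fun j hj => ?_⟩
    exact hs.extZero_covariant_right (ExtZero.covariant_pi (hext j (by omega)) b)
      (hext (j + 1) (by omega))
  | succ n ih =>
    obtain ⟨T, τ, hT, hfin, hText⟩ := ih (by omega)
    obtain ⟨b, π, hπ⟩ := exists_free_cover (R := R) (T →ₗ[R] C)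
    let f : T →ₗ[R] (Fin b → C) := LinearMap.pi fun i => π (Pi.single i 1)
    have hφ : ∀ φ : T →ₗ[R] C, ∃ ψ : (Fin b → C) →ₗ[R] C, ∀ x, ψ (f x) = φ x := by
      intro φ
      obtain ⟨a, rfl⟩ := hπ φ
      refine ⟨∑ i, a i • LinearMap.proj i, fun x => ?_⟩
      conv_rhs => rw [pi_eq_sum_univ' a, map_sum]
      simp [f, LinearMap.sum_apply]
    have hinj : Function.Injective f := by
      refine (injective_iff_map_eq_zero _).2 fun x hx => ?_
      refine eq_zero_of_extZero_quotient (hText 0 (by omega)) fun a ha => ?_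
      obtain ⟨b', u, v, huv⟩ := hT.factors ha
      rw [← huv]
      have : u x = 0 := by
        funext j
        obtain ⟨ψ, hψ⟩ := hφ (LinearMap.proj j ∘ₗ u)
        have := hψ x
        rw [hx, map_zero] at this
        exact this.symm
      rw [this, map_zero]
    have hs := SES.coker hinj
    refine ⟨ModuleCat.of R _, _, Tower.step hT hs hφ, inferInstance, fun j hj => ?_⟩
    exact hs.extZero_covariant_right (ExtZero.covariant_pi (hext j (by omega)) b)
      (hText (j + 1) (by omega))

end TowerExistence

/-! ### Approximation by modules resolved by powers of `C`, and maps from towers to them. -/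

section Approximation

variable {R : Type u} [CommRing R] {C : ModuleCat.{u} R} {M : ObjectProperty (ModuleCat.{u} R)}

/-- Modules with a resolution of length `n` by powers of `C`. -/
inductive PowResolved (C : ModuleCat.{u} R) : ℕ → ModuleCat.{u} R → Prop
  | pow (b : ℕ) : PowResolved C 0 (ModuleCat.of R (Fin b → C))
  | step {n b : ℕ} {K Z : ModuleCat.{u} R} (hK : PowResolved C n K) {f : K →ₗ[R] (Fin b → C)}
      {g : (Fin b → C) →ₗ[R] Z} (h : SES f g) : PowResolved C (n + 1) Z

/-- Modules of dimension at most `n` embed into modules resolved by powers of `C`, with cokernel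
in `M`. -/
theorem exists_approximation [IsNoetherianRing R] (hC : IsSemidualizing C) (hM : M ∈ thickGC C)
    {n : ℕ} {X : ModuleCat.{u} R} (hX : shift^[n] M X) :
    ∃ (Z W : ModuleCat.{u} R) (f : X →ₗ[R] Z) (g : Z →ₗ[R] W),
      SES f g ∧ PowResolved C n Z ∧ M W := by
  have hr := hM.1.resolving
  have hcog := thickGC_cogenerated hC hM
  induction n generalizing X with
  | zero =>
    obtain ⟨b, W, f, g, h, hW⟩ := hcog X hX
    exact ⟨_, W, f, g, h, .pow b, hW⟩
  | succ n ih =>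
    rw [Function.iterate_succ_apply'] at hX
    obtain ⟨m, π, hπ, hK⟩ := hX
    obtain ⟨Z, W, f, g, h, hZ, hW⟩ := ih hK
    -- `G` is an extension of `W` by a free module, hence in `M`, and of `X` by `Z`. Embedding `G`
    -- into a power of `C` and dividing by `Z` gives the module containing `X`.
    obtain ⟨G, i, q, j, q', h1, h2⟩ := (SES.ker hπ).exists_pushout_pair h
    obtain ⟨b, W', f', g', h', hW'⟩ := hcog G (hr.mid h2 (hr.free m) hW)
    obtain ⟨D, j, i, q, h3, h4⟩ := h1.exists_comp h'
    exact ⟨D, W', i, q, h4, .step hZ h3, hW'⟩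

/-- The class of an extension of powers of `C` that is not split is nonzero modulo the maximal
ideal. -/
theorem exists_minimal_pair [IsNoetherianRing R] [IsLocalRing R] (hC : IsSemidualizing C)
    {b c : ℕ} (A : (Fin b → C) →ₗ[R] (Fin c → C))
    (hA : ¬ ∀ φ : (Fin b → C) →ₗ[R] C, ∃ ψ : (Fin c → C) →ₗ[R] C, ∀ x, ψ (A x) = φ x) :
    ∃ (θ : C →ₗ[R] (Fin b → C)) (η : (Fin b → C) →ₗ[R] C) (β : Fin c → R),
      (∀ x, η (θ x) = x) ∧ (∀ i, β i ∈ IsLocalRing.maximalIdeal R) ∧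
      ∀ x i, A (θ x) i = β i • x := by
  have := hC.fg
  let ρ := LinearMap.lcomp R C A
  have hρ : LinearMap.range ρ ≠ ⊤ := fun h => hA fun φ => by
    obtain ⟨ψ, hψ⟩ := LinearMap.range_eq_top.1 h φ
    exact ⟨ψ, fun x => LinearMap.congr_fun hψ x⟩
  -- `Hom(Cᵇ, C)` modulo the maximal submodule `L` is one-dimensional over the residue field. A
  -- coordinate `P k` outside `L` spans it, and `t'` records the classes of all coordinates. The
  -- rows of `A` lie in `L`, so pairing them with `t'` gives elements of the maximal ideal.
  obtain ⟨L, hL, hle⟩ := (eq_top_or_exists_le_coatom (LinearMap.range ρ)).resolve_left hρ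
  let P : Fin b → ((Fin b → C) →ₗ[R] C) := fun j => LinearMap.proj j
  have hspan : ∀ φ : (Fin b → C) →ₗ[R] C, ∃ a : Fin b → R, φ = ∑ j, a j • P j := fun φ => by
    obtain ⟨a, ha⟩ := hC.exists_coeff φ
    exact ⟨a, LinearMap.ext fun x => by simp [ha, P, LinearMap.sum_apply]⟩
  obtain ⟨k, hk⟩ : ∃ k, P k ∉ L := by
    by_contra! hcon
    refine hL.1 (eq_top_iff.2 fun φ _ => ?_)
    obtain ⟨a, rfl⟩ := hspan φ
    exact Submodule.sum_mem _ fun j _ => L.smul_mem _ (hcon j)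
  have hsup : L ⊔ Submodule.span R {P k} = ⊤ := hL.2 _ (by
    refine lt_of_le_of_ne le_sup_left fun h => hk ?_
    rw [h]
    exact Submodule.mem_sup_right (Submodule.mem_span_singleton_self _))
  have hθ : ∀ j, ∃ a : R, P j - a • P k ∈ L := fun j => by
    have : P j ∈ L ⊔ Submodule.span R {P k} := by rw [hsup]; trivial
    obtain ⟨l, hl, y, hy, hly⟩ := Submodule.mem_sup.1 this
    obtain ⟨a, rfl⟩ := Submodule.mem_span_singleton.1 hy
    exact ⟨a, by rwa [← hly, add_sub_cancel_right]⟩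
  choose t ht using hθ
  let t' : Fin b → R := fun j => if j = k then 1 else t j
  have ht' : ∀ j, P j - t' j • P k ∈ L := fun j => by
    by_cases hj : j = k
    · simp [t', hj]
    · simpa [t', hj] using ht j
  choose a ha using fun i => hspan (LinearMap.proj i ∘ₗ A)
  refine ⟨LinearMap.pi fun j => t' j • LinearMap.id, P k, fun i => ∑ j, a i j * t' j,
    fun x => by simp [P, t'], fun i => ?_, fun x i => ?_⟩
  · rw [IsLocalRing.mem_maximalIdeal, mem_nonunits_iff]
    rintro hu
    have h1 : (∑ j, a i j • P j) ∈ L := by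
      rw [← ha]
      exact hle ⟨LinearMap.proj i, rfl⟩
    have h2 : (∑ j, a i j * t' j) • P k ∈ L := by
      have h3 : (∑ j, a i j * t' j) • P k =
          (∑ j, a i j • P j) - ∑ j, a i j • (P j - t' j • P k) := by
        simp [Finset.sum_smul, smul_sub, smul_smul]
      rw [h3]
      exact L.sub_mem h1 (Submodule.sum_mem _ fun j _ => L.smul_mem _ (ht' j))
    obtain ⟨v, hv⟩ := hu.exists_left_inv
    have := L.smul_mem v h2
    rw [smul_smul, hv, one_smul] at this
    exact hk this
  · have := LinearMap.congr_fun (ha i) (fun j => t' j • x)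
    refine this.trans ?_
    simp [P, LinearMap.sum_apply, Finset.sum_smul, smul_smul]

/-- Over a local ring, the distinguished class of a tower over the maximal ideal is pulled back
from every module of the same dimension that is resolved by powers of `C`. -/
theorem Tower.exists_comp_eq_of_powResolved [IsNoetherianRing R] [IsLocalRing R]
    (hC : IsSemidualizing C) (hM : M ∈ thickGC C) {n : ℕ} {T : ModuleCat.{u} R}
    {τ : Ext T C (n + 1)} (hT : Tower C (IsLocalRing.maximalIdeal R) n T τ) {Z : ModuleCat.{u} R}
    (hZ : PowResolved C (n + 1) Z) (hZM : ¬ ResolvingSubcat.shift^[n] M Z) :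
    ∃ (g : T →ₗ[R] Z) (e : Ext Z C (n + 1)),
      (Ext.mk₀ (ModuleCat.ofHom g)).comp e (zero_add (n + 1)) = τ := by
  have hr := hM.1.resolving
  induction hT generalizing Z with
  | @base b r hrI T g h =>
    cases hZ with
    | @step _ c K _ hK A g' h' =>
    cases hK with
    | pow b' =>
    obtain ⟨θ, η, β, hηθ, hβ, hA⟩ := exists_minimal_pair hC A fun hall => hZM (by
      refine thickGC_of_shift hC hM 0 (hr.shift_of_ses h' (hr.pi _ hM.2) (hr.pi _ hM.2)) ?_
      exact h'.extZero_one_of_exists_extend (ExtZero.pi (X := C) (hC.ext _ one_pos) _) hall)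
    -- The `β i` are combinations of the generators `r` of the maximal ideal, so `A ∘ θ` factors
    -- through the first map of the tower. This gives a map of extensions, and `η` recovers `τ`.
    choose w hw using fun i => (Ideal.mem_span_range_iff_exists_fun.1
      (show β i ∈ Ideal.span (Set.range r) by rw [hrI]; exact hβ i))
    obtain ⟨k, -, hk⟩ := h.exists_map h' θ (LinearMap.pi fun i => ∑ j, w i j • LinearMap.proj j)
      (fun x => funext fun i => by
        rw [hA, ← hw]
        simp [LinearMap.sum_apply, Finset.sum_smul, smul_smul])
    refine ⟨k, h'.shortExact.extClass.comp (Ext.mk₀ (ModuleCat.ofHom η)) (add_zero 1), ?_⟩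
    rw [← Ext.comp_assoc_of_third_deg_zero]
    erw [hk]
    rw [Ext.comp_assoc_of_third_deg_zero, Ext.mk₀_comp_mk₀]
    have hid : ModuleCat.ofHom θ ≫ ModuleCat.ofHom η = 𝟙 C := by
      ext x; exact hηθ x
    erw [hid, Ext.comp_mk₀_id]
  | @step n T τ hT b T' f g h hext ih =>
    cases hZ with
    | @step _ c K _ hK f' g' h' =>
    obtain ⟨k, e, hke⟩ := ih hK fun hc => hZM ((hr.shift_iterate_succ_iff h' (hr.pi _ hM.2) _).2 hc)
    choose w hw using fun i => hext (LinearMap.proj i ∘ₗ f' ∘ₗ k)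
    obtain ⟨l, -, hl⟩ := h.exists_map h' k (LinearMap.pi w) (fun x => funext fun i => hw i x)
    refine ⟨l, h'.shortExact.extClass.comp e (add_comm 1 (n + 1)), ?_⟩
    rw [← hke]
    erw [← Ext.comp_assoc (a₁₂ := 1) _ _ _ (zero_add 1) (add_comm 1 (n + 1)) (by omega), hl,
      Ext.comp_assoc_of_second_deg_zero]

end Approximation

end ResolvingSubcat

namespace ResolvingSubcat

open Abelian

/-! ### Maximal regular sequences and socle elements. -/

section RegularSequences

variable {R : Type u} [CommRing R] [IsNoetherianRing R]

/-- A regular sequence of maximal length in `p` has an associated prime containing `p`. -/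
theorem exists_maximal_isWeaklyRegular (p : Ideal R) (hp : p ≠ ⊤) :
    ∃ (rs : List R) (q : Ideal R) (z : R), (∀ r ∈ rs, r ∈ p) ∧
      RingTheory.Sequence.IsWeaklyRegular R rs ∧ q.IsPrime ∧ p ≤ q ∧ z ∉ Ideal.ofList rs ∧
      ∀ a, a ∈ q ↔ a * z ∈ Ideal.ofList rs := by
  -- The sequence is chosen so that the ideal it generates is maximal; appending an element outside
  -- this ideal would enlarge it.
  obtain ⟨J, ⟨rs, hmem, hrs, rfl⟩, hmax⟩ := set_has_maximal_iff_noetherian.2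
    (inferInstance : IsNoetherian R R)
    {J : Ideal R | ∃ rs : List R, (∀ r ∈ rs, r ∈ p) ∧
      RingTheory.Sequence.IsWeaklyRegular R rs ∧ Ideal.ofList rs = J}
    ⟨_, [], by simp, RingTheory.Sequence.IsWeaklyRegular.nil R R, rfl⟩
  let Q := R ⧸ (Ideal.ofList rs • ⊤ : Submodule R R)
  have hJ : (Ideal.ofList rs • ⊤ : Submodule R R) = Ideal.ofList rs := by simp
  have hle : Ideal.ofList rs ≤ p := Ideal.span_le.2 fun r hr => hmem r hr
  -- No element of `p` is regular on `Q`, so `R ⧸ p` maps nontrivially to `Q`. The image of `1` is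
  -- killed by `p`, hence by an associated prime of `Q` containing `p`.
  have hnot : ¬ Subsingleton ((R ⧸ p) →ₗ[R] Q) := by
    rw [IsSMulRegular.subsingleton_linearMap_iff]
    rintro ⟨r, hr, hreg⟩
    rw [Ideal.annihilator_quotient] at hr
    have hr' : r ∈ Ideal.ofList rs := by
      by_contra hr'
      refine hmax (Ideal.ofList (rs ++ [r])) ⟨rs ++ [r], ?_, ?_, rfl⟩ ?_
      · intro a ha
        rcases List.mem_append.1 ha with h | h
        · exact hmem a h
        · rw [List.mem_singleton.1 h]; exact hr
      · rw [RingTheory.Sequence.isWeaklyRegular_append_iff]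
        refine ⟨hrs, ?_⟩
        rw [RingTheory.Sequence.isWeaklyRegular_singleton_iff]
        exact hreg
      · rw [Ideal.ofList_append]
        refine lt_of_le_of_ne le_sup_left fun h => hr' ?_
        rw [h]
        exact Ideal.mem_sup_right (Ideal.subset_span (by simp))
    have h1 : (Submodule.Quotient.mk 1 : Q) = 0 := hreg (by
      change r • (Submodule.Quotient.mk 1 : Q) = r • 0
      rw [smul_zero, ← Submodule.Quotient.mk_smul, Submodule.Quotient.mk_eq_zero, hJ]
      simpa using hr')
    rw [Submodule.Quotient.mk_eq_zero, hJ] at h1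
    exact hp ((Ideal.eq_top_iff_one p).2 (hle h1))
  obtain ⟨φ, hφ⟩ : ∃ φ : (R ⧸ p) →ₗ[R] Q, φ ≠ 0 := by
    by_contra! hcon
    exact hnot (subsingleton_of_forall_eq 0 hcon)
  have hy : φ (Submodule.Quotient.mk 1) ≠ 0 := fun h0 => hφ (by
    refine LinearMap.ext fun x => ?_
    obtain ⟨a, rfl⟩ := Submodule.Quotient.mk_surjective _ x
    have : (Submodule.Quotient.mk a : R ⧸ p) = a • Submodule.Quotient.mk 1 := by
      rw [← Submodule.Quotient.mk_smul, smul_eq_mul, mul_one]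
    rw [this, map_smul, h0, smul_zero]
    rfl)
  obtain ⟨q, hq, hcolon⟩ := exists_le_isAssociatedPrime_of_isNoetherianRing R _ hy
  obtain ⟨hprime, x, hx⟩ := isAssociatedPrime_iff.1 hq
  obtain ⟨z, rfl⟩ := Submodule.Quotient.mk_surjective _ x
  have hmemq : ∀ a, a ∈ q ↔ a * z ∈ Ideal.ofList rs := fun a => by
    rw [hx, Submodule.mem_colon_singleton, Submodule.mem_bot, ← Submodule.Quotient.mk_smul,
      Submodule.Quotient.mk_eq_zero, hJ, smul_eq_mul]
  refine ⟨rs, q, z, hmem, hrs, hprime, fun a ha => hcolon ?_, fun hz => hprime.ne_top ?_,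
    hmemq⟩
  · have h0 : a • (Submodule.Quotient.mk 1 : R ⧸ p) = 0 := by
      rw [← Submodule.Quotient.mk_smul, Submodule.Quotient.mk_eq_zero]
      simpa using ha
    rw [Submodule.mem_colon_singleton, Submodule.mem_bot, ← map_smul, h0, map_zero]
  · rw [Ideal.eq_top_iff_one, hmemq, one_mul]
    exact hz

theorem exists_socle [IsLocalRing R] {E : Type*} [AddCommGroup E] [Module R E] [Nontrivial E]
    (h : ∀ s ∈ IsLocalRing.maximalIdeal R, ∃ k : ℕ, ∀ e : E, s ^ k • e = 0) :
    ∃ e : E, e ≠ 0 ∧ ∀ s ∈ IsLocalRing.maximalIdeal R, s • e = 0 := by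
  obtain ⟨x, hx⟩ := exists_ne (0 : E)
  obtain ⟨q, hq, -⟩ := exists_le_isAssociatedPrime_of_isNoetherianRing R x hx
  obtain ⟨hprime, e, he⟩ := isAssociatedPrime_iff.1 hq
  have hmem : ∀ a, a ∈ q ↔ a • e = 0 := fun a => by
    rw [he, Submodule.mem_colon_singleton, Submodule.mem_bot]
  refine ⟨e, fun h0 => hprime.ne_top ?_, fun s hs => ?_⟩
  · rw [Ideal.eq_top_iff_one, hmem, h0, smul_zero]
  · obtain ⟨k, hk⟩ := h s hs
    rw [← hmem]
    exact hprime.mem_of_pow_mem k ((hmem _).2 (hk e))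

end RegularSequences

/-! ### Functoriality of `Ext` and kernels of maps from a product. -/

section ExtPull

variable {R : Type u} [CommRing R] {C : ModuleCat.{u} R}
variable {X Y Z : Type u} [AddCommGroup X] [Module R X] [AddCommGroup Y] [Module R Y]
  [AddCommGroup Z] [Module R Z]

variable (C) in
/-- The map on `Extⁱ(-, C)` induced by a linear map. -/
noncomputable def extPull (k : X →ₗ[R] Y) (i : ℕ) :
    Ext (ModuleCat.of R Y) C i →ₗ[R] Ext (ModuleCat.of R X) C i :=
  Ext.bilinearCompOfLinear R _ _ _ 0 i i (zero_add i) (Ext.mk₀ (ModuleCat.ofHom k))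

theorem extPull_apply (k : X →ₗ[R] Y) (i : ℕ) (e : Ext (ModuleCat.of R Y) C i) :
    extPull C k i e = (Ext.mk₀ (ModuleCat.ofHom k)).comp e (zero_add i) := rfl

theorem extPull_extPull (k : X →ₗ[R] Y) (l : Y →ₗ[R] Z) (i : ℕ) (e : Ext (ModuleCat.of R Z) C i) :
    extPull C k i (extPull C l i e) = extPull C (l ∘ₗ k) i e := by
  simp only [extPull_apply, ModuleCat.ofHom_comp]
  rw [← Ext.mk₀_comp_mk₀_assoc]

theorem extPull_add (k l : X →ₗ[R] Y) (i : ℕ) (e : Ext (ModuleCat.of R Y) C i) :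
    extPull C (k + l) i e = extPull C k i e + extPull C l i e := by
  simp only [extPull_apply, ← Ext.add_comp, ← Ext.mk₀_add]
  rfl

theorem extPull_smul (r : R) (k : X →ₗ[R] Y) (i : ℕ) (e : Ext (ModuleCat.of R Y) C i) :
    extPull C (r • k) i e = r • extPull C k i e := by
  simp only [extPull_apply, ← Ext.smul_comp, ← Ext.mk₀_smul]
  rfl

theorem extPull_id (i : ℕ) (e : Ext (ModuleCat.of R X) C i) :
    extPull C LinearMap.id i e = e := Ext.mk₀_id_comp e

theorem SES.exists_extPull_eq {f : X →ₗ[R] Y} {g : Y →ₗ[R] Z} (h : SES f g) {i : ℕ}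
    (hZ : ExtZero C Z (i + 1)) (e : Ext (ModuleCat.of R X) C i) : ∃ e', extPull C f i e' = e :=
  Ext.contravariant_sequence_exact₁ h.shortExact C e (add_comm 1 i) (hZ.eq_zero _)

theorem SES.exists_extPull_eq_of_extPull {f : X →ₗ[R] Y} {g : Y →ₗ[R] Z} (h : SES f g) {i : ℕ}
    (e : Ext (ModuleCat.of R Y) C i) (he : extPull C f i e = 0) : ∃ e', extPull C g i e' = e :=
  Ext.contravariant_sequence_exact₂ h.shortExact C e he

/-- If `Extⁱ(Y, C) = 0`, then `Extⁱ(X × Y, C)` is pulled back from `X`. -/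
theorem extPull_fst_inl {i : ℕ} (hY : ExtZero C Y i) (e : Ext (ModuleCat.of R (X × Y)) C i) :
    extPull C (LinearMap.fst R X Y) i (extPull C (LinearMap.inl R X Y) i e) = e := by
  have h : (LinearMap.id : X × Y →ₗ[R] X × Y) = LinearMap.inl R X Y ∘ₗ LinearMap.fst R X Y +
      LinearMap.inr R X Y ∘ₗ LinearMap.snd R X Y := by
    ext <;> simp
  conv_rhs => rw [← extPull_id i e, h, extPull_add, ← extPull_extPull, ← extPull_extPull,
    hY.eq_zero (extPull C (LinearMap.inr R X Y) i e), map_zero, add_zero]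

variable {V A B : Type u} [AddCommGroup V] [Module R V] [AddCommGroup A] [Module R A]
  [AddCommGroup B] [Module R B] {ι : V →ₗ[R] A × B} {g : A →ₗ[R] Z} {c : B →ₗ[R] Z}

/-- When `B` has no `Ext` in degree `i`, replacing `A` by the kernel `V` of `(g, c)` divides
`Extⁱ(A, C)`: the map to `Extⁱ(V, C)` is onto if `Extⁱ⁺¹(Z, C) = 0`, and it kills what is pulled
back along `g` by `extPull_fst_extPull`. -/
theorem SES.exists_extPull_fst_eq (h : SES ι (g.coprod c)) {i : ℕ} (hB : ExtZero C B i)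
    (hZ : ExtZero C Z (i + 1)) (e : Ext (ModuleCat.of R V) C i) :
    ∃ e', extPull C (LinearMap.fst R A B ∘ₗ ι) i e' = e := by
  obtain ⟨e, rfl⟩ := h.exists_extPull_eq hZ e
  exact ⟨_, by rw [← extPull_extPull, extPull_fst_inl hB]⟩

theorem SES.extPull_fst_extPull (h : SES ι (g.coprod c)) {i : ℕ} (hB : ExtZero C B i)
    (e : Ext (ModuleCat.of R Z) C i) :
    extPull C (LinearMap.fst R A B ∘ₗ ι) i (extPull C g i e) = 0 := by
  have h0 : g ∘ₗ LinearMap.fst R A B ∘ₗ ι = (-1 : R) • c ∘ₗ LinearMap.snd R A B ∘ₗ ι := by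
    refine LinearMap.ext fun v => ?_
    have := h.comp_apply v
    simp only [LinearMap.coprod_apply] at this
    simpa using eq_neg_of_add_eq_zero_left this
  rw [extPull_extPull, h0, extPull_smul, ← extPull_extPull, hB.eq_zero (extPull C c i e), map_zero,
    smul_zero]

end ExtPull

end ResolvingSubcat

namespace ResolvingSubcat

open Abelian

/-! ### The local theorem on resolving subcategories and the punctured spectrum. -/

section Local

variable {R : Type u} [CommRing R] [IsNoetherianRing R] [IsLocalRing R]
variable {C : ModuleCat.{u} R} {M P Q : ObjectProperty (ModuleCat.{u} R)}

/-- The modules that belong to `P` on the punctured spectrum of a local ring. -/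
def Punctured (P : ObjectProperty (ModuleCat.{u} R)) : ObjectProperty (ModuleCat.{u} R) :=
  sInf {Q | ∃ s ∈ IsLocalRing.maximalIdeal R, Q = LocIn P (Submonoid.powers s)}

omit [IsNoetherianRing R] in
theorem punctured_iff {X : ModuleCat.{u} R} :
    Punctured P X ↔ ∀ s ∈ IsLocalRing.maximalIdeal R, LocIn P (Submonoid.powers s) X := by
  rw [Punctured, sInf_objectProperty_iff]
  exact ⟨fun h s hs => h _ ⟨s, hs, rfl⟩, by rintro h _ ⟨s, hs, rfl⟩; exact h s hs⟩

theorem IsResolving.punctured (hP : IsResolving P) : IsResolving (Punctured P) :=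
  isResolving_sInf ⟨_, 0, Ideal.zero_mem _, rfl⟩ (by rintro _ ⟨s, -, rfl⟩; exact hP.locIn _)

omit [IsNoetherianRing R] in
theorem IsResolving.le_punctured (hP : IsResolving P) : P ≤ Punctured P := fun X hX =>
  punctured_iff.2 fun _ _ => hP.le_locIn _ X hX

omit [IsNoetherianRing R] in
theorem Tower.punctured {n : ℕ} {T : ModuleCat.{u} R} {τ : Ext T C (n + 1)} (hM : IsResolving M)
    (hMC : M C) (hT : Tower C (IsLocalRing.maximalIdeal R) n T τ) : Punctured M T :=
  punctured_iff.2 fun s hs => ⟨(hM.shift_iterate _).finite _ (hT.shift hM hMC), s,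
    Submonoid.mem_powers s, hT.le_annFac hM hMC hs⟩

/-- The grade of the maximal ideal is at least the dimension of any module of finite dimension. -/
theorem extZero_residue (hC : IsSemidualizing C) (hM : M ∈ thickGC C) {X : ModuleCat.{u} R}
    {N n : ℕ} (hX : shift^[N] M X) (hn : ¬ shift^[n] M X) {j : ℕ} (hj : j < n + 1) :
    ExtZero C (R ⧸ IsLocalRing.maximalIdeal R) j := by
  obtain ⟨rs, q, z, hmem, hrs, hq, hle, hz, hqz⟩ := exists_maximal_isWeaklyRegular
    (IsLocalRing.maximalIdeal R) (Ideal.IsPrime.ne_top inferInstance)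
  have h := shift_length_of_isWeaklyRegular (X := X) hC hM hrs hz (fun a ha => (hqz a).1 (hle ha)) hX
  have hlt : n < rs.length := by
    by_contra hcon
    exact hn (hM.1.resolving.shift_iterate_le (not_lt.1 hcon) _ h)
  exact extZero_quotient_of_isWeaklyRegular (N := C) rs (hC.isWeaklyRegular hrs) hmem (by omega)

/-- A resolving subcategory that contains the towers over the maximal ideal contains all modules
that belong to `M` on the punctured spectrum. -/
theorem mem_of_towers (hC : IsSemidualizing C) (hM : M ∈ thickGC C) (hP : IsResolving P)
    (hle : M ≤ P) {n : ℕ}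
    (hT : ∀ i ≤ n, ∃ (T : ModuleCat.{u} R) (τ : Ext T C (i + 1)),
      Tower C (IsLocalRing.maximalIdeal R) i T τ ∧ P T)
    {X : ModuleCat.{u} R} (hX : shift^[n + 1] M X) (hXP : Punctured M X) : P X := by
  have hr := hM.1.resolving
  have hrn := hr.shift_iterate (n + 1)
  have := hC.fg
  -- Descending induction on the number `i` of degrees in which `Ext` already vanishes; for `i = n +
  -- 1` the module lies in `M`.
  have key : ∀ d i, i + d = n + 1 → ∀ X : ModuleCat.{u} R, shift^[n + 1] M X → Punctured M X →
      (∀ j, 0 < j → j ≤ i → ExtZero C X j) → P X := by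
    intro d
    induction d with
    | zero =>
      intro i hi X hX hXP hext
      refine hle _ ((thickGC_shift_iff hC hM (X := X) hX 0).2 fun j hj => ?_)
      by_cases hji : j ≤ i
      · exact hext j hj hji
      · exact extVanish_of_shift hM.1.le (n + 1) hX j (by omega)
    | succ d ih =>
      intro i hi X hX hXP hext
      obtain ⟨T, τ, hTow, hTP⟩ := hT i (by omega)
      obtain ⟨b, c, hc⟩ := hTow.exists_cover
      have : Module.Finite R X := hrn.finite _ hX
      have hCb : ∀ k, ExtZero C (Fin b → C) (k + 1) := fun k =>
        ExtZero.pi (X := C) (hC.ext _ (Nat.succ_pos k)) b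
      have hTshift : shift^[n + 1] M T :=
        hr.shift_iterate_le (by omega) _ (hTow.shift hr hM.2)
      -- The modules `V` have `Extⁱ⁺¹(V, C)` a quotient of the Noetherian module `Extⁱ⁺¹(X, C)`. The
      -- induction is on the kernel, which grows as socle elements are killed.
      have inner : ∀ (K : Submodule R (Ext X C (i + 1))) (V : ModuleCat.{u} R)
          (π : Ext X C (i + 1) →ₗ[R] Ext V C (i + 1)), shift^[n + 1] M V → Punctured M V →
          (∀ j, 0 < j → j ≤ i → ExtZero C V j) → Function.Surjective π → LinearMap.ker π = K →
          P V := by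
        intro K
        induction K using WellFoundedGT.induction with
        | ind K ihK =>
        intro V π hV hVP hVext hπ hK
        by_cases hzero : ExtZero C V (i + 1)
        · refine ih (i + 1) (by omega) V hV hVP fun j h0 hj => ?_
          rcases hj.lt_or_eq with h | rfl
          · exact hVext j h0 (by omega)
          · exact hzero
        have : Nontrivial (Ext V C (i + 1)) := not_subsingleton_iff_nontrivial.1 hzero
        obtain ⟨e, he0, he⟩ := exists_socle (R := R) (E := Ext V C (i + 1)) fun s hs => by
          obtain ⟨-, _, ⟨k, rfl⟩, Y, u, v, hY, huv⟩ := punctured_iff.1 hVP s hs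
          exact ⟨k, fun e => smul_ext_eq_zero (X := V) huv
            (GC_extVanish (hM.1.le _ hY) _ (Nat.succ_pos i)) e⟩
        -- The socle element `e` is the pullback of `τ` along a map `g : V → T`; passing to the
        -- kernel of `V × Cᵇ → T` kills it.
        obtain ⟨g₀, hg₀⟩ := hTow.exists_comp_eq 0 (zero_add (i + 1))
          (fun j h1 h2 => hVext j h1 (by omega)) e he
        obtain ⟨g, rfl⟩ := Ext.homEquiv₀.symm.surjective g₀
        have hg : extPull C g.hom (i + 1) τ = e := hg₀
        have hsurj : Function.Surjective (g.hom.coprod c) := fun t => by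
          obtain ⟨y, rfl⟩ := hc t
          exact ⟨(0, y), by simp⟩
        have hs := SES.ker hsurj
        have hPV : ∀ {Q : ObjectProperty (ModuleCat.{u} R)}, IsResolving Q → Q C → Q V → Q T →
            Q (ModuleCat.of R (LinearMap.ker (g.hom.coprod c))) := fun hQ hQC hQV hQT =>
          hQ.left hs (hQ.prod (X := V) hQV (hQ.pi b hQC)) hQT
        have hPK := ihK (LinearMap.ker (extPull C (LinearMap.fst R V (Fin b → C) ∘ₗ
            (LinearMap.ker (g.hom.coprod c)).subtype) (i + 1) ∘ₗ π)) ?_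
          (ModuleCat.of R (LinearMap.ker (g.hom.coprod c))) _
          (hPV hrn (hr.le_shift_iterate _ _ hM.2) hV hTshift)
          (hPV hr.punctured (hr.le_punctured _ hM.2) hVP (hTow.punctured hr hM.2)) ?_ ?_ rfl
        · exact ((hP.prod_iff V (ModuleCat.of R (Fin b → C))).1 (hP.mid hs hPK hTP)).1
        · subst hK
          refine lt_of_le_of_ne (LinearMap.ker_le_ker_comp _ _) fun heq => he0 ?_
          obtain ⟨x, hx⟩ := hπ e
          have : x ∈ LinearMap.ker π := by
            rw [heq, LinearMap.mem_ker, LinearMap.comp_apply, hx, ← hg]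
            exact hs.extPull_fst_extPull (hCb i) τ
          rw [← hx]
          exact this
        · intro j h0 hj
          obtain ⟨j, rfl⟩ := Nat.exists_eq_succ_of_ne_zero h0.ne'
          have hprod : ExtZero C (V × (Fin b → C)) (j + 1) :=
            ExtZero.prod (X := V) (hVext (j + 1) h0 hj) (hCb j)
          rcases hj.lt_or_eq with h | rfl
          · exact hs.extZero_left hprod (hTow.extZero hC (Nat.succ_pos _) (by omega))
          -- In the top degree, `x` is sent by the connecting map to some `a • τ` with `a • e = 0`.
          -- As `e ≠ 0`, the scalar `a` is not a unit, and therefore it kills `τ`.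
          · refine subsingleton_of_forall_eq 0 fun x => hs.connecting_injective hprod ?_
            obtain ⟨a, ha⟩ := hTow.exists_eq_smul hC
              (hs.shortExact.extClass.comp x (add_comm 1 (j + 1)))
            have hae : a • e = 0 := by
              have h0 : extPull C (g.hom.coprod c) (j + 1 + 1) (a • τ) = 0 := by
                rw [← ha]
                exact hs.shortExact.comp_extClass_assoc x (add_comm 1 (j + 1))
              have h1 := congrArg (extPull C (LinearMap.inl R V (Fin b → C)) (j + 1 + 1)) h0
              rw [extPull_extPull, LinearMap.coprod_inl, map_smul, map_zero] at h1
              rw [← hg]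
              exact h1
            rw [ha]
            refine hTow.smul_eq_zero hC ?_
            rw [IsLocalRing.mem_maximalIdeal, mem_nonunits_iff]
            exact fun hu => he0 (hu.smul_eq_zero.1 hae)
        · rw [LinearMap.coe_comp]
          refine Function.Surjective.comp (fun x => ?_) hπ
          exact hs.exists_extPull_fst_eq (hCb i)
            (extVanish_of_shift hM.1.le (i + 1) (hTow.shift hr hM.2) _ (by omega)) x
      exact inner _ X LinearMap.id hX hXP hext Function.surjective_id rfl
  exact key (n + 1) 0 (by omega) X hX hXP fun j h0 hj => by omega

/-- The tower of length `n` belongs to a resolving subcategory with a module of dimension `n`. -/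
theorem Tower.mem (hC : IsSemidualizing C) (hM : M ∈ thickGC C) (hP : IsResolving P) (hle : M ≤ P)
    {n : ℕ} (hlow : ∀ X : ModuleCat.{u} R, Punctured M X → ResolvingSubcat.shift^[n] M X → P X)
    {T : ModuleCat.{u} R} {τ : Ext T C (n + 1)}
    (hT : Tower C (IsLocalRing.maximalIdeal R) n T τ) {Z : ModuleCat.{u} R} (hZ : P Z)
    (hZP : Punctured M Z) (hZM : ResolvingSubcat.shift^[n + 1] M Z)
    (hZn : ¬ ResolvingSubcat.shift^[n] M Z) : P T := by
  have hr := hM.1.resolving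
  obtain ⟨Z', W, f, g, h, hres, hW⟩ := exists_approximation hC hM hZM
  have hmid : ∀ {Q : ObjectProperty (ModuleCat.{u} R)}, IsResolving Q → M ≤ Q → Q Z → Q Z' :=
    fun hQ hMQ hQZ => hQ.mid h hQZ (hMQ _ hW)
  -- Since `τ` generates `Extⁿ⁺¹(T, C)` and is pulled back from `Z'` along `k`, the kernel of `T ×
  -- Cᵇ → Z'` has no `Ext` in degree `n + 1`. It thus has dimension at most `n` and lies in `P` by
  -- `hlow`.
  obtain ⟨k, e, hke⟩ := hT.exists_comp_eq_of_powResolved hC hM hres fun hc =>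
    hZn ((hr.shift_iterate n).left h hc (hr.le_shift_iterate n _ hW))
  obtain ⟨b, c, hc⟩ : ∃ (b : ℕ) (c : (Fin b → C) →ₗ[R] Z'), Function.Surjective c := by
    cases hres with
    | step _ h => exact ⟨_, _, h.surj⟩
  have hsurj : Function.Surjective (k.coprod c) := fun z => by
    obtain ⟨y, rfl⟩ := hc z
    exact ⟨(0, y), by simp⟩
  have hs := SES.ker hsurj
  have hker : ∀ {Q : ObjectProperty (ModuleCat.{u} R)}, IsResolving Q → M ≤ Q → Q Z → Q T →
      Q (ModuleCat.of R (LinearMap.ker (k.coprod c))) := fun hQ hMQ hQZ hQT =>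
    hQ.left hs (hQ.prod (X := T) hQT (hQ.pi b (hMQ _ hM.2))) (hmid hQ hMQ hQZ)
  have hCb : ExtZero C (Fin b → C) (n + 1) := ExtZero.pi (X := C) (hC.ext _ (Nat.succ_pos n)) b
  have hZ' : ResolvingSubcat.shift^[n + 1] M Z' :=
    hmid (hr.shift_iterate _) (hr.le_shift_iterate _) hZM
  have hV : P (ModuleCat.of R (LinearMap.ker (k.coprod c))) := by
    refine hlow _ (hker hr.punctured hr.le_punctured hZP (hT.punctured hr hM.2)) ?_
    refine thickGC_of_shift hC hM n (hker (hr.shift_iterate _) (hr.le_shift_iterate _) hZM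
      (hT.shift hr hM.2)) ?_
    refine subsingleton_of_forall_eq 0 fun x => ?_
    obtain ⟨y, rfl⟩ := hs.exists_extPull_fst_eq hCb
      (extVanish_of_shift hM.1.le (n + 1) hZ' _ (by omega)) x
    obtain ⟨a, rfl⟩ := hT.exists_eq_smul hC y
    rw [map_smul, ← hke]
    erw [hs.extPull_fst_extPull hCb e]
    rw [smul_zero]
  exact ((hP.prod_iff T (ModuleCat.of R (Fin b → C))).1 (hP.mid hs hV (hmid hP hle hZ))).1

/-- Induction on `n`: a syzygy of `Z` yields all such modules of dimension at most `n`, among them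
the lower towers. `Tower.mem` adds the top tower, and `mem_of_towers` gives everything else. -/
theorem mem_of_punctured (hC : IsSemidualizing C) (hM : M ∈ thickGC C) (hP : IsResolving P)
    (hle : M ≤ P) {n : ℕ} {Z X : ModuleCat.{u} R} (hZ : P Z) (hZP : Punctured M Z)
    (hZM : shift^[n + 1] M Z) (hZn : ¬ shift^[n] M Z) (hX : shift^[n + 1] M X)
    (hXP : Punctured M X) : P X := by
  have hr := hM.1.resolving
  induction n generalizing Z X with
  | zero =>
    obtain ⟨T, τ, hT, -⟩ := exists_tower (I := IsLocalRing.maximalIdeal R) hC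
      (fun j hj => extZero_residue hC hM hZM hZn hj) (Nat.lt_succ_self 0)
    refine mem_of_towers hC hM hP hle (n := 0) (fun i hi => ?_) hX hXP
    obtain rfl : i = 0 := by omega
    exact ⟨T, τ, hT, hT.mem hC hM hP hle (n := 0) (fun X _ hX => hle X hX) hZ hZP hZM hZn⟩
  | succ n ih =>
    have hlow : ∀ X : ModuleCat.{u} R, Punctured M X → shift^[n + 1] M X → P X := by
      have : Module.Finite R Z := hP.finite _ hZ
      obtain ⟨m, π, hπ⟩ := exists_free_cover (R := R) Z
      have hs := SES.ker hπ
      intro X hXP hX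
      refine ih (Z := ModuleCat.of R (LinearMap.ker π)) (hP.left hs (hP.free m) hZ)
        (hr.punctured.left hs (hr.punctured.free m) hZP)
        ((hr.shift_iterate_succ_iff hs (hr.free m) _).1 hZM)
        (fun hc => hZn ((hr.shift_iterate_succ_iff hs (hr.free m) _).2 hc)) hX hXP
    refine mem_of_towers hC hM hP hle (n := n + 1) (fun i hi => ?_) hX hXP
    obtain ⟨T, τ, hT, -⟩ := exists_tower (I := IsLocalRing.maximalIdeal R) hC
      (fun j hj => extZero_residue hC hM hZM hZn hj) (Nat.lt_succ_of_le hi)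
    refine ⟨T, τ, hT, ?_⟩
    rcases hi.lt_or_eq with h | rfl
    · exact hlow T (hT.punctured hr hM.2) (hr.shift_iterate_le (by omega) _ (hT.shift hr hM.2))
    · exact hT.mem hC hM hP hle hlow hZ hZP hZM hZn

omit [IsNoetherianRing R] [IsLocalRing R] in
/-- The pullback of a free cover of `X` along multiplication by `s`. It belongs to every resolving
subcategory that contains `X`, and multiplication by `s` on it factors through a free module. -/
theorem exists_twist (X : ModuleCat.{u} R) [Module.Finite R X] (s : R) :
    ∃ (m : ℕ) (N : ModuleCat.{u} R) (π : (Fin m → R) →ₗ[R] X) (ι : N →ₗ[R] (Fin m → R) × X),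
      Function.Surjective π ∧ SES ι (π.coprod (-(s • LinearMap.id))) ∧
      ∃ (u : N →ₗ[R] (Fin m → R)) (v : (Fin m → R) →ₗ[R] N), ∀ x, v (u x) = s • x := by
  obtain ⟨m, π, hπ⟩ := exists_free_cover (R := R) X
  let d : (Fin m → R) × X →ₗ[R] X := π.coprod (-(s • LinearMap.id))
  have hd : Function.Surjective d := fun x => by
    obtain ⟨y, rfl⟩ := hπ x
    exact ⟨(y, 0), by simp [d]⟩
  let v : (Fin m → R) →ₗ[R] LinearMap.ker d :=
    ((s • LinearMap.id).prod π).codRestrict _ fun y => by simp [d]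
  refine ⟨m, ModuleCat.of R (LinearMap.ker d), π, (LinearMap.ker d).subtype, hπ, SES.ker hd,
    LinearMap.fst R _ _ ∘ₗ (LinearMap.ker d).subtype, v, fun x => ?_⟩
  have hx : π x.1.1 = s • x.1.2 := by
    have h0 := LinearMap.mem_ker.1 x.2
    change π x.1.1 + -(s • x.1.2) = 0 at h0
    exact add_neg_eq_zero.1 h0
  exact Subtype.ext (Prod.ext rfl hx)

/-! ### Twisting by a scalar: reduction to modules in `M` on the punctured spectrum. -/

section Twist

variable {X N : Type u} [AddCommGroup X] [Module R X] [AddCommGroup N] [Module R N] {m : ℕ} {s : R}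
  {π : (Fin m → R) →ₗ[R] X} {ι : N →ₗ[R] (Fin m → R) × X}

omit [IsNoetherianRing R] [IsLocalRing R] in
theorem twist_mem (hP : IsResolving P) (h : SES ι (π.coprod (-(s • LinearMap.id))))
    (hX : P (ModuleCat.of R X)) : P (ModuleCat.of R N) :=
  hP.left h (hP.prod (hP.free m) hX) hX

omit [IsNoetherianRing R] [IsLocalRing R] in
-- With `s = b a` factoring through `W` and `E` the pullback of `π` along `b`, the sequence `0 → N →
-- E × X → W → 0` is exact, so `E × X` lies in `P`.
theorem mem_of_twist_mem (hP : IsResolving P) (hπ : Function.Surjective π)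
    (h : SES ι (π.coprod (-(s • LinearMap.id)))) (hs : Factors P X s)
    (hN : P (ModuleCat.of R N)) : P (ModuleCat.of R X) := by
  obtain ⟨W, a, b, hW, hab⟩ := hs
  have hι : ∀ x, π (ι x).1 = s • (ι x).2 := fun x => by
    have h0 := h.comp_apply x
    change π (ι x).1 + -(s • (ι x).2) = 0 at h0
    exact add_neg_eq_zero.1 h0
  let E := LinearMap.ker (π.coprod (-b))
  have hE : ∀ y w, (y, w) ∈ E ↔ π y = b w := fun y w => by
    change π y + -(b w) = 0 ↔ _
    exact add_neg_eq_zero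
  let pr : E →ₗ[R] W := LinearMap.snd R _ _ ∘ₗ E.subtype
  let j₀ : N →ₗ[R] E := ((LinearMap.fst R _ _ ∘ₗ ι).prod (a ∘ₗ LinearMap.snd R _ _ ∘ₗ ι)).codRestrict
    E fun x => (hE _ _).2 (by simp [hι, hab])
  let j : N →ₗ[R] E × X := j₀.prod (LinearMap.snd R _ _ ∘ₗ ι)
  have hj : SES j (pr.coprod (-a)) := by
    refine ⟨fun x y hxy => h.inj ?_, fun e => ⟨fun he => ?_, ?_⟩, fun w => ?_⟩
    · exact Prod.ext (congrArg (fun k => k.1.1.1) hxy) (congrArg (fun k => k.2) hxy)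
    · obtain ⟨⟨⟨y, w⟩, hyw⟩, x⟩ := e
      change w + -(a x) = 0 at he
      obtain rfl := add_neg_eq_zero.1 he
      have h0 : π y + -(s • x) = 0 := by
        rw [(hE _ _).1 hyw, hab, add_neg_cancel]
      obtain ⟨n, hn⟩ := h.exists_preimage (y := (y, x)) h0
      refine ⟨n, Prod.ext (Subtype.ext (Prod.ext ?_ ?_)) ?_⟩
      · exact congrArg (fun k => k.1) hn
      · exact congrArg (fun k => a k.2) hn
      · exact congrArg (fun k => k.2) hn
    · rintro ⟨n, rfl⟩
      exact add_neg_cancel _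
    · obtain ⟨y, hy⟩ := hπ (b w)
      exact ⟨(⟨(y, w), (hE _ _).2 hy⟩, 0), by simp [pr]⟩
  exact ((hP.prod_iff (ModuleCat.of R E) (ModuleCat.of R X)).1 (hP.mid hj hN hW)).2

/-- If `N` had dimension at most `n`, then `Extⁿ⁺¹(N, C) = 0` would make multiplication by `s`
surjective on the finite module `Extⁿ⁺¹(X, C)`, which vanishes by Nakayama. -/
theorem not_shift_twist (hC : IsSemidualizing C) (hM : M ∈ thickGC C)
    (h : SES ι (π.coprod (-(s • LinearMap.id)))) (hs : s ∈ IsLocalRing.maximalIdeal R) {n : ℕ}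
    (hX : shift^[n + 1] M (ModuleCat.of R X)) (hXn : ¬ shift^[n] M (ModuleCat.of R X)) :
    ¬ shift^[n] M (ModuleCat.of R N) := by
  intro hN
  have := hC.fg
  have : Module.Finite R X := (hM.1.resolving.shift_iterate (n + 1)).finite _ hX
  refine hXn (thickGC_of_shift hC hM n hX ?_)
  have hNext := extVanish_of_shift hM.1.le n hN (n + 1) (Nat.lt_succ_self n)
  have key : ∀ e : Ext (ModuleCat.of R X) C (n + 1), ∃ e', e = s • e' := fun e => by
    obtain ⟨e', he'⟩ := h.exists_extPull_eq_of_extPull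
      (extPull C (LinearMap.snd R (Fin m → R) X) (n + 1) e) (hNext.eq_zero _)
    refine ⟨-e', ?_⟩
    have h1 := congrArg (extPull C (LinearMap.inr R (Fin m → R) X) (n + 1)) he'
    rw [extPull_extPull, extPull_extPull, LinearMap.coprod_inr, LinearMap.snd_comp_inr,
      extPull_id, ← neg_smul, extPull_smul, extPull_id] at h1
    rw [← h1, neg_smul, smul_neg]
  have hbot : (⊤ : Submodule R (Ext (ModuleCat.of R X) C (n + 1))) = ⊥ := by
    refine Submodule.eq_bot_of_le_smul_of_le_jacobson_bot (IsLocalRing.maximalIdeal R) _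
      Module.Finite.fg_top (fun e _ => ?_) (IsLocalRing.maximalIdeal_le_jacobson _)
    obtain ⟨e', rfl⟩ := key e
    exact Submodule.smul_mem_smul hs trivial
  exact (Submodule.subsingleton_iff R).1 (subsingleton_of_bot_eq_top hbot.symm)

end Twist

omit [IsLocalRing R] in
/-- The radical of `annFac` grows strictly under twisting. -/
theorem exists_twist_lt (hP : IsResolving P) {X : ModuleCat.{u} R} [Module.Finite R X] {s : R}
    (hs : ¬ LocIn P (Submonoid.powers s) X) (k : ℕ) :
    ∃ (m : ℕ) (N : ModuleCat.{u} R) (π : (Fin m → R) →ₗ[R] X) (ι : N →ₗ[R] (Fin m → R) × X),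
      Function.Surjective π ∧ SES ι (π.coprod (-((s ^ k) • LinearMap.id))) ∧
      (annFac hP X).radical < (annFac hP N).radical := by
  obtain ⟨m, N, π, ι, hπ, h, u, v, huv⟩ := exists_twist X (s ^ k)
  have : Module.Finite R N := Module.Finite.of_injective ι h.inj
  refine ⟨m, N, π, ι, hπ, h, lt_of_le_of_ne (fun t ht => ?_) fun heq => hs ?_⟩
  · rw [mem_radical_annFac_iff hP] at ht ⊢
    exact twist_mem (hP.locIn _) h ht
  · rw [← mem_radical_annFac_iff hP, heq, mem_radical_annFac_iff hP]
    exact ⟨‹_›, s ^ k, ⟨k, rfl⟩, ModuleCat.of R (Fin m → R), u, v, hP.free m, huv⟩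

/-- Twisting preserves `P` and the exact dimension and strictly enlarges the radical of `annFac`, so
the process stops, with a module in `M` on the punctured spectrum. -/
theorem exists_mem_punctured (hC : IsSemidualizing C) (hM : M ∈ thickGC C) (hP : IsResolving P)
    {n : ℕ} {Z : ModuleCat.{u} R} (hZ : P Z) (hZM : shift^[n + 1] M Z) (hZn : ¬ shift^[n] M Z) :
    ∃ Z' : ModuleCat.{u} R, P Z' ∧ Punctured M Z' ∧ shift^[n + 1] M Z' ∧ ¬ shift^[n] M Z' := by
  have hr := hM.1.resolving
  induction hI : (annFac hr Z).radical using WellFoundedGT.induction generalizing Z with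
  | ind I ih =>
  subst hI
  by_cases hZP : Punctured M Z
  · exact ⟨Z, hZ, hZP, hZM, hZn⟩
  rw [punctured_iff] at hZP
  push Not at hZP
  obtain ⟨s, hs, hsZ⟩ := hZP
  have : Module.Finite R Z := hP.finite _ hZ
  obtain ⟨m, N, π, ι, hπ, h, hlt⟩ := exists_twist_lt hr hsZ 1
  exact ih _ hlt (twist_mem hP h hZ) (twist_mem (hr.shift_iterate _) h hZM)
    (not_shift_twist hC hM h (by rwa [pow_one]) hZM hZn) rfl

/-- A resolving subcategory containing `M` and a module of dimension `n + 1` contains every module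
of dimension at most `n + 1` that belongs to it on the punctured spectrum. -/
theorem mem_of_punctured_mem (hC : IsSemidualizing C) (hM : M ∈ thickGC C) (hP : IsResolving P)
    (hle : M ≤ P) {n : ℕ} {Z X : ModuleCat.{u} R} (hZ : P Z) (hZM : shift^[n + 1] M Z)
    (hZn : ¬ shift^[n] M Z) (hX : shift^[n + 1] M X) (hXP : Punctured P X) : P X := by
  have hr := hM.1.resolving
  obtain ⟨Z', hZ', hZ'P, hZ'M, hZ'n⟩ := exists_mem_punctured hC hM hP hZ hZM hZn
  induction hI : (annFac hr X).radical using WellFoundedGT.induction generalizing X with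
  | ind I ih =>
  subst hI
  by_cases hXM : Punctured M X
  · exact mem_of_punctured hC hM hP hle hZ' hZ'P hZ'M hZ'n hX hXM
  rw [punctured_iff] at hXM
  push Not at hXM
  obtain ⟨s, hs, hsX⟩ := hXM
  -- The exponent `k` is such that `s ^ k` on `X` factors through `P`, so that membership of the
  -- twist in `P` can be passed back to `X`.
  obtain ⟨hfin, _, ⟨k, rfl⟩, hk⟩ := punctured_iff.1 hXP s hs
  obtain ⟨m, N, π, ι, hπ, h, hlt⟩ := exists_twist_lt hr hsX k
  exact mem_of_twist_mem hP hπ h hk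
    (ih _ hlt (twist_mem (hr.shift_iterate _) h hX) (twist_mem hP.punctured h hXP) rfl)

end Local

end ResolvingSubcat

namespace ResolvingSubcat

open Abelian

/-! ### The maps `Λ`, `Φ`, `η` and `ρ` over the whole spectrum. -/

section Global

variable {R : Type u} [CommRing R] [IsNoetherianRing R]
variable {C : ModuleCat.{u} R} {M N P Q : ObjectProperty (ModuleCat.{u} R)}

theorem enat_le_of_forall_natCast {a b : ℕ∞} (h : ∀ n : ℕ, b ≤ n → a ≤ n) : a ≤ b := by
  induction b using ENat.recTopCoe with
  | top => exact le_top
  | coe b => exact h b le_rfl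

omit [IsNoetherianRing R] in
theorem Factors.loc (p : PrimeSpectrum R) {X : Type u} [AddCommGroup X] [Module R X] {s : R}
    (h : Factors P X s) : Factors (addLoc P p) (Loc p X) (algebraMap R (LocRing p) s) := by
  obtain ⟨W, a, b, hW, hab⟩ := h
  refine ⟨locModule W p, locMap p a, locMap p b, addLoc_of_mem p hW, fun x => ?_⟩
  have : locMap p b ∘ₗ locMap p a = algebraMap R (LocRing p) s • LinearMap.id :=
    loc_hom_ext fun x => by
      simp only [LinearMap.comp_apply, locMap_mk, hab, LinearMap.smul_apply, LinearMap.id_apply,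
        map_smul, algebraMap_smul]
  exact LinearMap.congr_fun this x

/-- At a minimal prime of `annFac hP X`, the localization of `X` belongs to `addLoc P p` on the
punctured spectrum. -/
theorem punctured_of_mem_minimalPrimes (hP : IsResolving P) {X : ModuleCat.{u} R}
    [Module.Finite R X] {p : PrimeSpectrum R} (hp : p.asIdeal ∈ (annFac hP X).minimalPrimes) :
    Punctured (addLoc P p) (locModule X p) := by
  have hle : (annFac hP X).map (algebraMap R (LocRing p)) ≤ annFac (hP.addLoc p) (Loc p X) :=
    Ideal.map_le_iff_le_comap.2 fun s hs => Factors.loc p hs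
  have hrad := Ideal.radical_mono hle
  rw [IsLocalization.AtPrime.radical_map_of_mem_minimalPrimes (LocRing p) p.asIdeal _ hp,
    IsLocalization.AtPrime.map_eq_maximalIdeal p.asIdeal (LocRing p)] at hrad
  refine punctured_iff.2 fun s hs => ?_
  exact (mem_radical_annFac_iff (hP.addLoc p)).1 (hrad hs)

theorem pdim_loc_mono (hM : IsResolving M) {X : ModuleCat.{u} R} [Module.Finite R X]
    {p q : PrimeSpectrum R} (h : p ≤ q) :
    pdim (addLoc M p) (locModule X p) ≤ pdim (addLoc M q) (locModule X q) := by
  refine enat_le_of_forall_natCast fun n hn => ?_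
  rw [pdim_addLoc_le_iff hM] at hn ⊢
  exact shift_iterate_mono (locAt_anti M h) n _ hn

theorem pdim_loc_le (hM : IsResolving M) {X : ModuleCat.{u} R} {n : ℕ} (hX : shift^[n] M X)
    (p : PrimeSpectrum R) : pdim (addLoc M p) (locModule X p) ≤ n := by
  have := (hM.shift_iterate n).finite _ hX
  rw [pdim_addLoc_le_iff hM]
  exact shift_iterate_mono (hM.le_locIn _) n _ hX

/-- The dimensions of the localizations at `p` of the modules of finite dimension are bounded by
the length of a regular sequence in `p`. -/
theorem exists_isRegular_pdim_le (hC : IsSemidualizing C) (hM : M ∈ thickGC C)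
    (p : PrimeSpectrum R) :
    ∃ rs : List R, (∀ r ∈ rs, r ∈ p.asIdeal) ∧ RingTheory.Sequence.IsRegular R rs ∧
      ∀ X, finDim M X → pdim (addLoc M p) (locModule X p) ≤ rs.length := by
  have hr := hM.1.resolving
  obtain ⟨rs, q, z, hmem, hrs, hq, hle, hz, hqz⟩ :=
    exists_maximal_isWeaklyRegular p.asIdeal p.isPrime.ne_top
  refine ⟨rs, hmem, ⟨hrs, fun h => p.isPrime.ne_top ?_⟩, fun X hX => ?_⟩
  · rw [eq_comm, smul_eq_mul, Ideal.mul_top] at h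
    exact eq_top_iff.2 (h.ge.trans (Ideal.span_le.2 fun r hr => hmem r hr))
  have hfin : Module.Finite R X := hX.1
  obtain ⟨N, hN⟩ := (hr.finDim_iff X).1 hX
  let q' : PrimeSpectrum R := ⟨q, hq⟩
  -- The dimension only grows on passing to the associated prime `q` containing `p`. At `q` the
  -- element `z` is a socle element modulo `rs`, as `shift_length_of_isWeaklyRegular` requires.
  refine (pdim_loc_mono (q := q') hr hle).trans ?_
  let ρ := algebraMap R (LocRing q')
  have hmap : Ideal.ofList (rs.map ρ) = (Ideal.ofList rs).map ρ := (Ideal.map_ofList _ _).symm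
  have hNq : shift^[N] (addLoc M q') (locModule X q') :=
    ((hr.addLoc q').pdim_le_iff N _).1 (pdim_loc_le hr hN q')
  rw [(hr.addLoc q').pdim_le_iff, ← List.length_map (as := rs) ρ]
  refine shift_length_of_isWeaklyRegular (X := locModule X q') (z := ρ z) (hC.loc q')
    (thickGC_addLoc hC q' hM)
    (RingTheory.Sequence.IsWeaklyRegular.of_isLocalization (LocRing q') q.primeCompl hrs) ?_ ?_ hNq
  · rw [hmap]
    intro hmem
    obtain ⟨⟨⟨a, ha⟩, t⟩, hat⟩ := (IsLocalization.mem_map_algebraMap_iff q.primeCompl _).1 hmem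
    rw [← map_mul] at hat
    obtain ⟨v, hv⟩ := (IsLocalization.eq_iff_exists q.primeCompl (LocRing q')).1 hat
    refine (q.primeCompl.mul_mem v.2 t.2 : (v : R) * t ∉ q) ((hqz _).2 ?_)
    have : (v : R) * t * z = v * a := by rw [← hv]; ring
    rw [this]
    exact Ideal.mul_mem_left _ _ ha
  · intro a ha
    rw [hmap]
    rw [← IsLocalization.AtPrime.map_eq_maximalIdeal q (LocRing q')] at ha
    have : (q.map ρ) ≤ ((Ideal.ofList rs).map ρ).colon {ρ z} := by
      refine Ideal.map_le_iff_le_comap.2 fun b hb => ?_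
      rw [Ideal.mem_comap, Submodule.mem_colon_singleton, smul_eq_mul, ← map_mul]
      exact Ideal.mem_map_of_mem _ ((hqz b).1 hb)
    exact Submodule.mem_colon_singleton.1 (this ha)

theorem Phi_mem_gradeConsistent (hC : IsSemidualizing C) (hM : M ∈ thickGC C)
    (hP : P ∈ resolvingOver M) : Phi M P ∈ gradeConsistent R := by
  have hbound : ∀ p : PrimeSpectrum R, ∃ n : ℕ, Phi M P p ≤ n ∧ (n : ℕ∞) ≤ grade p.asIdeal := by
    intro p
    obtain ⟨rs, hmem, hrs, hle⟩ := exists_isRegular_pdim_le hC hM p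
    exact ⟨rs.length, iSup₂_le fun X hX => hle X (hP.2.2 X hX),
      le_iSup₂_of_le (f := fun (rs : List R) _ => (rs.length : ℕ∞)) rs ⟨hmem, hrs⟩ le_rfl⟩
  refine ⟨fun p => ?_, fun p q hpq => ?_, fun p => ?_⟩
  · obtain ⟨n, hn, -⟩ := hbound p
    exact (hn.trans_lt (ENat.natCast_lt_top n)).ne
  · refine iSup₂_le fun X hX => ?_
    have := hP.1.finite X hX
    exact (pdim_loc_mono hM.1.resolving hpq).trans
      (le_iSup₂ (f := fun (Y : ModuleCat.{u} R) (_ : P Y) =>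
        pdim (addLoc M q) (locModule Y q)) X hX)
  · obtain ⟨n, hn, hn'⟩ := hbound p
    exact hn.trans hn'

omit [IsNoetherianRing R] in
theorem pdim_le_Phi {X : ModuleCat.{u} R} (hX : P X) (p : PrimeSpectrum R) :
    pdim (addLoc M p) (locModule X p) ≤ Phi M P p :=
  le_iSup₂ (f := fun (Y : ModuleCat.{u} R) (_ : P Y) => pdim (addLoc M p) (locModule Y p)) X hX

theorem Lam_mem_resolvingOver (hM : IsResolving M) {f : PrimeSpectrum R → ℕ∞}
    (hf : ∀ p, f p ≠ ⊤) : Lam M f ∈ resolvingOver M := by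
  have hiff : ∀ X, Lam M f X ↔
      ModuleCat.isFG R X ∧ ∀ p, shift^[(f p).toNat] (LocAt M p) X := by
    intro X
    refine and_congr_right fun (hX : Module.Finite R X) => forall_congr' fun p => ?_
    rw [← pdim_addLoc_le_iff hM, ENat.natCast_toNat (hf p)]
  -- An intersection of resolving subcategories. Since `0 ∈ ⊤`, the member `LocIn M ⊤` only imposes
  -- finite generation.
  have heq : Lam M f = sInf ({LocIn M ⊤} ∪
      {Q | ∃ p, Q = shift^[(f p).toNat] (LocAt M p)}) := by
    ext X
    rw [hiff, sInf_objectProperty_iff]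
    constructor
    · rintro ⟨h1, h2⟩ Q (rfl | ⟨p, rfl⟩)
      · exact ⟨h1, 0, trivial, Ideal.zero_mem (annFac hM X)⟩
      · exact h2 p
    · exact fun h => ⟨(h _ (Or.inl rfl)).1, fun p => h _ (Or.inr ⟨p, rfl⟩)⟩
  refine ⟨?_, fun X hX => ⟨hM.fg X hX, fun p => ?_⟩, fun X hX => ?_⟩
  · rw [heq]
    refine isResolving_sInf ⟨_, Or.inl rfl⟩ ?_
    rintro Q (rfl | ⟨p, rfl⟩)
    · exact hM.locIn _
    · exact (hM.locIn _).shift_iterate _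
  · exact (pdim_loc_le hM (n := 0) hX p).trans (by simp)
  · have : Module.Finite R X := hX.1
    refine (hM.finDim_iff X).2 (hM.exists_shift_of_forall fun p => ?_)
    exact ⟨_, ((hiff X).1 hX).2 p⟩

/-- Every prime has a module whose dimension at `p` is a given number bounded by the grade. -/
theorem Phi_Lam (hC : IsSemidualizing C) (hM : M ∈ thickGC C) {f : PrimeSpectrum R → ℕ∞}
    (hf : f ∈ gradeConsistent R) : Phi M (Lam M f) = f := by
  have hr := hM.1.resolving
  refine funext fun p => le_antisymm (iSup₂_le fun X hX => hX.2 p) ?_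
  obtain ⟨n, hn⟩ := ENat.ne_top_iff_exists.1 (hf.1 p)
  rcases n with _ | n
  · rw [← hn]
    exact zero_le
  have hlt : (n : ℕ∞) < grade p.asIdeal := by
    refine lt_of_lt_of_le ?_ (hf.2.2 p)
    rw [← hn]
    exact_mod_cast Nat.lt_succ_self n
  obtain ⟨rs, hrs⟩ := lt_iSup_iff.1 hlt
  obtain ⟨⟨hmem, hreg⟩, hlen⟩ := lt_iSup_iff.1 hrs
  -- The tower of level `n` over `p` has dimension at most `n + 1 = f p ≤ f q` at the primes `q`
  -- containing `p`, and dimension zero elsewhere. At `p` itself it attains `n + 1`.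
  obtain ⟨T, τ, hT, hfin, -⟩ := exists_tower (I := p.asIdeal) hC (N := rs.length)
    (fun j hj => extZero_quotient_of_isWeaklyRegular (N := C) rs
      (hC.isWeaklyRegular hreg.toIsWeaklyRegular) hmem hj) (n := n) (by exact_mod_cast hlen)
  have hTM := hT.shift hr hM.2
  have hTL : Lam M f T := by
    refine ⟨hfin, fun q => ?_⟩
    by_cases hpq : p ≤ q
    · refine (pdim_loc_le hr hTM q).trans ?_
      rw [hn]
      exact hf.2.1 hpq
    · have : LocAt M q T := (locAt_iff hr q).2 fun h => hpq ((hT.le_annFac hr hM.2).trans h)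
      have h0 := (pdim_addLoc_le_iff hr q 0 T).2 this
      exact h0.trans (by simp)
  refine le_trans ?_ (pdim_le_Phi hTL p)
  rw [← hn]
  by_contra hcon
  have hle : pdim (addLoc M p) (locModule T p) ≤ n := by
    rw [not_le] at hcon
    exact Order.le_of_lt_add_one (by exact_mod_cast hcon)
  rw [pdim_addLoc_le_iff hr] at hle
  obtain ⟨s, hs, hsp⟩ := hT.exists_mem_of_shift hC hM hle
  exact hs hsp

/-- At a minimal prime `p` of `annFac hPr X`, the localization of an `X` outside `P` lies in `add
P_p` on the punctured spectrum but not at `p`. Some `Y` in `P` attains the dimension `Φ(p)` at `p`,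
and `mem_of_punctured_mem` over the local ring gives a contradiction. -/
theorem Lam_Phi (hC : IsSemidualizing C) (hM : M ∈ thickGC C) (hP : P ∈ resolvingOver M) :
    Lam M (Phi M P) = P := by
  have hr := hM.1.resolving
  have hPr := hP.1
  refine le_antisymm (fun X hX => ?_) fun X hX => ⟨hP.1.fg X hX, pdim_le_Phi hX⟩
  have hfin : Module.Finite R X := hX.1
  by_contra hXP
  have hne : annFac hPr X ≠ ⊤ := fun h => hXP ((one_mem_annFac_iff hPr).1 (h ▸ trivial))
  obtain ⟨p, hp⟩ := Ideal.nonempty_minimalPrimes hne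
  let p' : PrimeSpectrum R := ⟨p, hp.1.1⟩
  have hXp : ¬ addLoc P p' (locModule X p') := fun h =>
    (locAt_iff hPr p').1 ((addLoc_loc_iff hPr p').1 h) hp.1.2
  have hle := addLoc_mono hP.2.1 p'
  have hrp := hr.addLoc p'
  obtain ⟨n, hn⟩ := ENat.ne_top_iff_exists.1 ((Phi_mem_gradeConsistent hC hM hP).1 p')
  have hXn : shift^[n] (addLoc M p') (locModule X p') := by
    rw [← hrp.pdim_le_iff, hn]
    exact hX.2 p'
  rcases n with _ | n
  · exact hXp (hle _ hXn)
  obtain ⟨Y, hY, hYn⟩ : ∃ Y, P Y ∧ ¬ shift^[n] (addLoc M p') (locModule Y p') := by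
    by_contra! hcon
    have : Phi M P p' ≤ n := iSup₂_le fun Y hY => (hrp.pdim_le_iff n _).2 (hcon Y hY)
    rw [← hn] at this
    have := ENat.natCast_le_natCast.1 this
    omega
  have hYM : shift^[n + 1] (addLoc M p') (locModule Y p') := by
    rw [← hrp.pdim_le_iff, hn]
    exact pdim_le_Phi hY p'
  exact hXp (mem_of_punctured_mem (hC.loc p') (thickGC_addLoc hC p' hM) (hPr.addLoc p') hle
    (addLoc_of_mem p' hY) hYM hYn hXn (punctured_of_mem_minimalPrimes hPr hp))

theorem Lam_inf_GC (hC : IsSemidualizing C) (hM : M ∈ thickGC C) {f : PrimeSpectrum R → ℕ∞}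
    (hf : ∀ p, f p ≠ ⊤) : Lam M f ⊓ GC C = M := by
  have hL := Lam_mem_resolvingOver hM.1.resolving hf
  refine le_antisymm (fun X hX => ?_) (le_inf hL.2.1 hM.1.le)
  obtain ⟨n, hn⟩ := (hM.1.resolving.finDim_iff X).1 (hL.2.2 X hX.1)
  exact (thickGC_iff_GC (X := X) hC hM hn).2 hX.2

/-- The dimensions with respect to two thick subcategories agree where both are finite. -/
theorem pdim_eq_of_le (hC : IsSemidualizing C) (hM : M ∈ thickGC C) (hN : N ∈ thickGC C)
    (hMN : M ≤ N) {X : ModuleCat.{u} R} {n : ℕ} (hX : shift^[n] M X) : pdim M X = pdim N X := by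
  have key : ∀ k : ℕ, pdim M X ≤ k ↔ pdim N X ≤ k := fun k => by
    rw [hM.1.resolving.pdim_le_iff, hN.1.resolving.pdim_le_iff]
    exact (thickGC_shift_iff (X := X) hC hM hX k).trans
      (thickGC_shift_iff (X := X) hC hN (shift_iterate_mono hMN n _ hX) k).symm
  exact le_antisymm (enat_le_of_forall_natCast fun k => (key k).2)
    (enat_le_of_forall_natCast fun k => (key k).1)

theorem pdim_loc_eq (hC : IsSemidualizing C) (hM : M ∈ thickGC C) (hN : N ∈ thickGC C)
    (hMN : M ≤ N) {X : ModuleCat.{u} R} (hX : finDim M X) (p : PrimeSpectrum R) :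
    pdim (addLoc M p) (locModule X p) = pdim (addLoc N p) (locModule X p) := by
  obtain ⟨n, hn⟩ := (hM.1.resolving.finDim_iff X).1 hX
  have hMp := thickGC_addLoc hC p hM
  exact pdim_eq_of_le (hC.loc p) hMp (thickGC_addLoc hC p hN) (addLoc_mono hMN p)
    ((hMp.1.resolving.pdim_le_iff n _).1 (pdim_loc_le hM.1.resolving hn p))

theorem rho_Lam (hC : IsSemidualizing C) (hM : M ∈ thickGC C) (hN : N ∈ thickGC C)
    (hMN : M ≤ N) {f : PrimeSpectrum R → ℕ∞} (hf : ∀ p, f p ≠ ⊤) :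
    rho M N (Lam N f) = Lam M f := by
  refine le_antisymm ?_ fun X hX => ?_
  · refine fun X hX => ⟨hX.1.1, fun p => ?_⟩
    rw [pdim_loc_eq hC hM hN hMN hX.2]
    exact hX.1.2 p
  · have hfin := (Lam_mem_resolvingOver hM.1.resolving hf).2.2 X hX
    refine ⟨⟨hX.1, fun p => ?_⟩, hfin⟩
    rw [← pdim_loc_eq hC hM hN hMN hfin]
    exact hX.2 p

/-- The generated subcategory contains `Λ_M(f)` and lies in `Λ_N(f)`. As dimensions over `M` and `N`
agree, its `Φ_N` is squeezed to `f`, and `Lam_Phi` identifies it. -/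
theorem eta_Lam (hC : IsSemidualizing C) (hM : M ∈ thickGC C) (hN : N ∈ thickGC C)
    (hMN : M ≤ N) {f : PrimeSpectrum R → ℕ∞} (hf : f ∈ gradeConsistent R) :
    eta M N (Lam M f) = Lam N f := by
  have hLN := Lam_mem_resolvingOver hN.1.resolving hf.1
  have hMem : IsResolving (Lam N f) ∧ Lam M f ⊔ N ≤ Lam N f := by
    refine ⟨hLN.1, sup_le ?_ hLN.2.1⟩
    rw [← rho_Lam hC hM hN hMN hf.1]
    exact inf_le_left
  have hle : eta M N (Lam M f) ≤ Lam N f := sInf_le hMem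
  have hge : Lam M f ⊔ N ≤ eta M N (Lam M f) := le_sInf fun Q hQ => hQ.2
  have hmem : eta M N (Lam M f) ∈ resolvingOver N :=
    ⟨isResolving_sInf ⟨_, hMem⟩ fun Q hQ => hQ.1, le_sup_right.trans hge, hle.trans hLN.2.2⟩
  have hPhi : Phi N (eta M N (Lam M f)) = f := by
    refine le_antisymm (fun p => iSup₂_le fun X hX => (hle X hX).2 p) fun p => ?_
    conv_lhs => rw [← Phi_Lam hC hM hf]
    refine iSup₂_le fun X hX => ?_
    rw [pdim_loc_eq hC hM hN hMN ((Lam_mem_resolvingOver hM.1.resolving hf.1).2.2 X hX)]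
    exact pdim_le_Phi (hge X (Or.inl hX)) p
  rw [← Lam_Phi hC hN hmem, hPhi]

end Global

end ResolvingSubcat

/-! ### Assembly of the theorem. -/

theorem theoremB {R : Type u} [CommRing R] [IsNoetherianRing R] (C : ModuleCat.{u} R)
    (hC : IsSemidualizing C) :
    -- the smallest thick subcategory `A` of `G_C` containing `C` exists
    IsLeast (thickGC C) (minThick C) ∧
    -- every thick subcategory of `G_C` containing `C` belongs to `S(C)`
    thickGC C ⊆ SC C ∧
    -- `Λ_M` and `Φ_M` are mutually inverse bijections
    (∀ M ∈ SC C,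
      Set.MapsTo (Lam M) (gradeConsistent R) (resolvingOver M) ∧
      Set.MapsTo (Phi M) (resolvingOver M) (gradeConsistent R) ∧
      Set.InvOn (Phi M) (Lam M) (gradeConsistent R) (resolvingOver M)) ∧
    -- `Λ` is a bijection from `S(C) × Γ` onto the union of the `R(M)`
    Set.BijOn (fun q : ObjectProperty (ModuleCat.{u} R) × (PrimeSpectrum R → ℕ∞) => Lam q.1 q.2)
      (SC C ×ˢ gradeConsistent R) (⋃ M ∈ SC C, resolvingOver M) ∧
    -- for `M ⊆ N` the maps `η_M^N` and `ρ_M^N` are mutually inverse and commute with the `Φ`'s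
    (∀ M ∈ SC C, ∀ N ∈ SC C, M ≤ N →
      Set.MapsTo (eta M N) (resolvingOver M) (resolvingOver N) ∧
      Set.MapsTo (rho M N) (resolvingOver N) (resolvingOver M) ∧
      Set.InvOn (rho M N) (eta M N) (resolvingOver M) (resolvingOver N) ∧
      (∀ X ∈ resolvingOver M, Phi N (eta M N X) = Phi M X) ∧
      (∀ X ∈ resolvingOver N, Phi M (rho M N X) = Phi N X)) ∧
    -- the lower triangle of the diagram
    (∀ M ∈ SC C, ∀ X ∈ resolvingOver (minThick C),
      eta (minThick C) M X ∈ resolvingOver M ∧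
      Phi M (eta (minThick C) M X) = Phi (minThick C) X) := by
  have hSC : SC C = thickGC C := (SC_subset_thickGC hC).antisymm (thickGC_subset_SC hC)
  have hLam : ∀ M ∈ thickGC C, Set.MapsTo (Lam M) (gradeConsistent R) (resolvingOver M) :=
    fun M hM f hf => Lam_mem_resolvingOver hM.1.resolving hf.1
  have hPhi : ∀ M ∈ thickGC C, Set.MapsTo (Phi M) (resolvingOver M) (gradeConsistent R) :=
    fun M hM P hP => Phi_mem_gradeConsistent hC hM hP
  -- Through the bijections with `Γ`, both `η` and `ρ` become the identity of `Γ`, from which the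
  -- remaining claims are formal.
  have heta : ∀ M ∈ thickGC C, ∀ N ∈ thickGC C, M ≤ N → ∀ X ∈ resolvingOver M,
      eta M N X = Lam N (Phi M X) := fun M hM N hN hMN X hX => by
    conv_lhs => rw [← Lam_Phi hC hM hX]
    exact eta_Lam hC hM hN hMN (hPhi M hM hX)
  have hrho : ∀ M ∈ thickGC C, ∀ N ∈ thickGC C, M ≤ N → ∀ X ∈ resolvingOver N,
      rho M N X = Lam M (Phi N X) := fun M hM N hN hMN X hX => by
    conv_lhs => rw [← Lam_Phi hC hN hX]
    exact rho_Lam hC hM hN hMN (hPhi N hN hX).1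
  have hA := minThick_isLeast hC
  refine ⟨hA, thickGC_subset_SC hC, ?_⟩
  rw [hSC]
  refine ⟨fun M hM => ⟨hLam M hM, hPhi M hM, fun f hf => Phi_Lam hC hM hf,
    fun P hP => Lam_Phi hC hM hP⟩, ⟨?_, ?_, ?_⟩, fun M hM N hN hMN => ⟨?_, ?_, ⟨?_, ?_⟩, ?_, ?_⟩,
    fun M hM X hX => ⟨?_, ?_⟩⟩
  · rintro ⟨M, f⟩ ⟨hM, hf⟩
    exact Set.mem_biUnion hM (hLam M hM hf)
  · rintro ⟨M, f⟩ ⟨hM, hf⟩ ⟨N, g⟩ ⟨hN, hg⟩ (h : Lam M f = Lam N g)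
    have hMN : M = N := (Lam_inf_GC hC hM hf.1).symm.trans (h ▸ Lam_inf_GC hC hN hg.1)
    subst hMN
    have hfg : f = g := (Phi_Lam hC hM hf).symm.trans (h ▸ Phi_Lam hC hM hg)
    rw [hfg]
  · intro P hP
    obtain ⟨M, hM, hP⟩ := Set.mem_iUnion₂.1 hP
    exact ⟨(M, Phi M P), ⟨hM, hPhi M hM hP⟩, Lam_Phi hC hM hP⟩
  · intro X hX
    rw [heta M hM N hN hMN X hX]
    exact hLam N hN (hPhi M hM hX)
  · intro X hX
    rw [hrho M hM N hN hMN X hX]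
    exact hLam M hM (hPhi N hN hX)
  · intro X hX
    rw [heta M hM N hN hMN X hX, rho_Lam hC hM hN hMN (hPhi M hM hX).1, Lam_Phi hC hM hX]
  · intro X hX
    rw [hrho M hM N hN hMN X hX, eta_Lam hC hM hN hMN (hPhi N hN hX), Lam_Phi hC hN hX]
  · intro X hX
    rw [heta M hM N hN hMN X hX, Phi_Lam hC hN (hPhi M hM hX)]
  · intro X hX
    rw [hrho M hM N hN hMN X hX, Phi_Lam hC hM (hPhi N hN hX)]
  · rw [heta _ hA.1 M hM (hA.2 hM) X hX]
    exact hLam M hM (hPhi _ hA.1 hX)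
  · rw [heta _ hA.1 M hM (hA.2 hM) X hX, Phi_Lam hC hM (hPhi _ hA.1 hX)]
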